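/- **Setting.** Formulas are in separated linear form $F=\mathcal L_0\wedge\mathcal N$ over variables $x_1,\dots,x_n$: $\mathcal L_0$ is a finite set of clauses (disjunctions) of atomic linear constraints $q+c_1x_1+\dots+c_nx_n\diamond 0$ with rational coefficients, and $\mathcal N$ is a finite set of atomic non-linear constraints $P: f(\vec x)\diamond 0$, where $\diamond\in\{>,\ge\}$ and $f$ is a partial real function applied to a tuple $\vec x=(x_{i_1},\dots,x_{i_k})$ of variables. Let $B_i\subseteq\mathbb R$ be the set of values satisfying all clauses of $\mathcal L_0$ that are univariate in $x_i$, $D_F=\prod_{i=1}^n B_i$ and $D_P=\prod_{j=1}^k B_{i_j}$. $F$ is a *bounded instance* if $D_F$ is bounded and $\overline{D_P}\subseteq\operatorname{dom} f$ for every $P\in\mathcal N$. Norms are maximum norms and $B(\vec c,\varepsilon)$ is the open ball. For $\delta\in\mathbb Q_{>0}$ the $\delta$-weakening $F_\delta$ replaces each $f(\vec x)\diamond0$ in $\mathcal N$ by $f(\vec x)+\delta\diamond 0$ and leaves $\mathcal L_0$ unchanged. Each non-linear $f$ is given by a function-oracle machine $M_f^{?}$ computing it (on every name of every $\vec x\in\operatorname{dom}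 f$, that is, every sequence of rational vectors $\varphi_m$ with $\|\varphi_m-\vec x\|\le 2^{-m}$, and every $p\in\mathbb N$, it outputs a rational within $2^{-p}$ of $f(\vec x)$) and by a program for a uniform modulus of continuity $\mu_f:\mathbb N\to\mathbb N$ of $f$ on $\overline{D_P}$: $\|\vec y-\vec z\|\le2^{-\mu_f(k)}$ implies $|f(\vec y)-f(\vec z)|\le 2^{-k}$. **The calculus $\delta$-ksmt with full-box linearisations.** Fix an order of the variables and $p\in\mathbb N$ with $p\ge-\lfloor\log_2\min\{1,\delta/4\}\rfloor$. Non-final states are pairs $(\alpha,\mathcal L)$ of a finite sequence $\alpha$ of assignments of rationals to distinct variables and a finite set $\mathcal L$ of linear clauses; the initial state is $(\mathrm{nil},\mathcal L_0)$. A linear constraint has a truth value under $\alpha$ only if all its variables are assigned; a clause is true if one of its literals is true and false if all are false; $\mathcal L$ is true if all its clauses are true and false if one of them is false. The transitions are: * (A) If $\mathcal L$ is not false under $\alpha$, $z$ is the next unassigned variable in the order, and $\mathcal L$ is not false under $\alpha::z\mapsto q$, where $q\in\mathbb Q$, go to $(\alpha::z\mapsto q,\mathcal L)$. * (R) If $\mathcal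 L$ is not false under $\alpha$, $z$ is unassigned, and $\mathcal L$ is false under $\alpha::z\mapsto q$ for all $q\in\mathbb Q$, go to $(\alpha,\mathcal L\cup R)$, where $R$ is a non-empty finite set of clauses that do not contain $z$, are false under $\alpha$, and are obtained by (repeated) arithmetical resolution on $z$ from clauses of $\mathcal L$ containing only $z$ and variables assigned in $\alpha$. One arithmetical resolution step takes from two clauses a literal $t_1\diamond_1 0$ with coefficient $c>0$ at $z$ and a literal $t_2\diamond_2 0$ with coefficient $-c'<0$ at $z$, and yields the remaining literals of both clauses together with $c't_1+c\,t_2\diamond0$, which is strict if one of the two literals is. * (B) If $\mathcal L$ is false under $\alpha$ and $\gamma$ is the longest prefix of $\alpha$ under which $\mathcal L$ is not false, go to $(\gamma,\mathcal L)$. * (nlinStep$_\delta$) If $\alpha$ is total and $\mathcal L$ is true under $\alpha$, let $\vec a$ be the values of $\vec x$ under $\alpha$ and, for each $P:f(\vec x)\diamond0$ in $\mathcal N$ in turn, let $\tilde y$ be the output of $M_f^{?}$ on the constant name of $\vec a$ at precision $p$. For the first $P$ such that $\tilde y\diamond-\delta/2$ fails, go to $(\alpha,\mathcal L\cup\{\vec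 x\notin B(\vec a,2^{-\mu_f(p)})\})$; if there is none, go to the final state $\delta$-SAT. * (SAT) If $\alpha$ is total, $\mathcal L$ is true under $\alpha$, and no $P\in\mathcal N$ false under $\alpha$ has a linearisation at $\alpha$ (a clause false under $\alpha$ and true under every assignment making $P$ true), go to the final state SAT. * (UNSAT) If $\mathcal L$ is false under the empty assignment, go to the final state UNSAT. **Theorem.** $\delta$-ksmt with full-box linearisations is a $\delta$-complete decision procedure: 1. Let $F$ be a bounded instance given as above, $\delta\in\mathbb Q_{>0}$, and let $p$ and the order of the variables be as above. Then every run from the initial state is finite, and every state reachable from it that has no successor is a final state whose answer is correct: if it is UNSAT, then no real assignment satisfies $F$; if it is $\delta$-SAT, then some rational assignment satisfies $F_\delta$; if it is SAT, then some rational assignment satisfies both $F$ and $F_\delta$. 2. The procedure is effective: there is one algorithm that, given $\delta\in\mathbb Q_{>0}$, an order of the variables and any bounded instance (its linear clauses, and for each non-linear constraint its variables, its predicate, $M_f^{?}$ and a program for $\mu_f$), halts and outputs some $p\ge-\lfloor\log_2\min\{1,\delta/4\}\rfloor$ and a complete run for this $p$, from the initial state to UNSAT or $\delta$-SAT. -/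

import Mathlib

namespace DeltaKsmt

/-! ### Function-oracle machines and computable real functions -/

/-- Programs of oracle machines over `ℕ`: the partial recursive programs of
`Nat.Partrec.Code` with one additional instruction, which queries the oracle. -/
inductive OCode : Type
  | zero : OCode
  | succ : OCode
  | left : OCode
  | right : OCode
  | oracle : OCode
  | pair : OCode → OCode → OCode
  | comp : OCode → OCode → OCode
  | prec : OCode → OCode → OCode
  | rfind' : OCode → OCode

/-- The partial function computed by a program when run with oracle `φ`. The program does not
depend on `φ`. -/
def OCode.eval (φ : ℕ → ℕ) : OCode → ℕ →. ℕ
  | .zero => fun _ => Part.some 0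
  | .succ => fun n => Part.some (n + 1)
  | .left => fun n => Part.some n.unpair.1
  | .right => fun n => Part.some n.unpair.2
  | .oracle => fun n => Part.some (φ n)
  | .pair cf cg => fun n => Nat.pair <$> cf.eval φ n <*> cg.eval φ n
  | .comp cf cg => fun n => cg.eval φ n >>= cf.eval φ
  | .prec cf cg =>
    Nat.unpaired fun a n =>
      n.rec (cf.eval φ a) fun y IH => do
        let i ← IH
        cg.eval φ (Nat.pair a (Nat.pair y i))
  | .rfind' cf =>
    Nat.unpaired fun a m =>
      (Nat.rfind fun n => (fun m => m = 0) <$> cf.eval φ (Nat.pair a (n + m))).map (· + m)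

/-- The number of a program. -/
def OCode.toNat : OCode → ℕ
  | .zero => 0
  | .succ => 1
  | .left => 2
  | .right => 3
  | .oracle => 4
  | .pair cf cg => 4 * Nat.pair cf.toNat cg.toNat + 5
  | .comp cf cg => 4 * Nat.pair cf.toNat cg.toNat + 6
  | .prec cf cg => 4 * Nat.pair cf.toNat cg.toNat + 7
  | .rfind' cf => 4 * cf.toNat + 8

/-- Finite presentation of a rational: positive part of the numerator, negative part of the
numerator, denominator (in lowest terms). -/
abbrev RatData : Type := ℕ × ℕ × ℕ

def ratData (q : ℚ) : RatData := (q.num.toNat, (-q.num).toNat, q.den)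

/-- The natural number that stands for a rational. -/
def ratCode (q : ℚ) : ℕ := Encodable.encode (ratData q)

/-- A name of `x ∈ ℝᵏ`: a sequence of rational vectors whose `m`-th member approximates `x` up to
`2⁻ᵐ` in the maximum norm (the norm of `Fin k → ℝ`). -/
def IsName {k : ℕ} (x : Fin k → ℝ) (φ : ℕ → Fin k → ℚ) : Prop :=
  ∀ m : ℕ, ‖(fun i => (φ m i : ℝ)) - x‖ ≤ 2⁻¹ ^ m

/-- A sequence of rational vectors as an oracle: query `m` is answered by the `m`-th vector. -/
def nameOracle {k : ℕ} (φ : ℕ → Fin k → ℚ) (m : ℕ) : ℕ :=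
  Encodable.encode (List.ofFn fun i => ratData (φ m i))

/-- The machine `M` computes the partial function `f : ℝᵏ → ℝ`: on every name of every point `x`
of the domain of `f` and for every `p`, it halts with a rational `p`-approximation of `f x`. -/
def Computes {k : ℕ} (M : OCode) (f : (Fin k → ℝ) →. ℝ) : Prop :=
  ∀ x, ∀ y ∈ f x, ∀ φ, IsName x φ → ∀ p : ℕ,
    ∃ q : ℚ, ratCode q ∈ M.eval (nameOracle φ) p ∧ |(q : ℝ) - y| ≤ 2⁻¹ ^ p

/-- `μ` is a uniform modulus of continuity of `f` on the set `D`. -/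
def IsUniformModulus {k : ℕ} (μ : ℕ → ℕ) (f : (Fin k → ℝ) →. ℝ) (D : Set (Fin k → ℝ)) : Prop :=
  ∀ p : ℕ, ∀ y ∈ D, ∀ z ∈ D, ‖y - z‖ ≤ 2⁻¹ ^ μ p → ∀ u ∈ f y, ∀ v ∈ f z, |u - v| ≤ 2⁻¹ ^ p

/-! ### Formulas in separated linear form -/

/-- `t ⋄ 0`, where `⋄` is `>` if `strict` is true, and `≥` otherwise. -/
def RelZero (strict : Bool) (t : ℝ) : Prop := if strict then t > 0 else t ≥ 0

/-- An atomic linear constraint `const + ∑ i, coeff i * x i ⋄ 0` over the variables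
`x 0, …, x (n - 1)`. The variable `x i` occurs in it iff `coeff i ≠ 0`. -/
structure Lit (n : ℕ) where
  coeff : Fin n → ℚ
  const : ℚ
  strict : Bool
  deriving DecidableEq

/-- A linear clause: the disjunction of its literals. -/
abbrev Clause (n : ℕ) : Type := List (Lit n)

/-- An atomic non-linear constraint `f (x (args 0), …, x (args (k - 1))) ⋄ 0`, together with the
programs that the procedure uses for `f`: an oracle machine and a program for a modulus. -/
structure NLConstraint (n : ℕ) where
  arity : ℕ
  args : Fin arity → Fin n
  fn : (Fin arity → ℝ) →. ℝ
  strict : Bool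
  machine : OCode
  modulus : Nat.Partrec.Code

/-- A formula `L₀ ∧ N` in separated linear form over `n` variables. -/
structure Formula (n : ℕ) where
  lin : List (Clause n)
  nl : List (NLConstraint n)

def Lit.Holds {n : ℕ} (l : Lit n) (x : Fin n → ℝ) : Prop :=
  RelZero l.strict ((l.const : ℝ) + ∑ i, (l.coeff i : ℝ) * x i)

def Clause.Holds {n : ℕ} (C : Clause n) (x : Fin n → ℝ) : Prop := ∃ l ∈ C, l.Holds x

def NLConstraint.Holds {n : ℕ} (P : NLConstraint n) (x : Fin n → ℝ) : Prop :=
  ∃ y ∈ P.fn (fun j => x (P.args j)), RelZero P.strict y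

/-- The `δ`-weakening `f (x) + δ ⋄ 0`. -/
def NLConstraint.WeakHolds {n : ℕ} (δ : ℚ) (P : NLConstraint n) (x : Fin n → ℝ) : Prop :=
  ∃ y ∈ P.fn (fun j => x (P.args j)), RelZero P.strict (y + δ)

/-- `x` satisfies the formula. -/
def Formula.Sat {n : ℕ} (F : Formula n) (x : Fin n → ℝ) : Prop :=
  (∀ C ∈ F.lin, Clause.Holds C x) ∧ ∀ P ∈ F.nl, P.Holds x

/-- `x` satisfies the `δ`-weakening of the formula; linear constraints are not weakened. -/
def Formula.WeakSat {n : ℕ} (δ : ℚ) (F : Formula n) (x : Fin n → ℝ) : Prop :=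
  (∀ C ∈ F.lin, Clause.Holds C x) ∧ ∀ P ∈ F.nl, P.WeakHolds δ x

/-! ### Bounded instances -/

/-- `x i` is the only variable that occurs in `C`. -/
def Clause.Univariate {n : ℕ} (C : Clause n) (i : Fin n) : Prop :=
  (∀ l ∈ C, ∀ j, j ≠ i → l.coeff j = 0) ∧ ∃ l ∈ C, l.coeff i ≠ 0

/-- The set `B i` of the values of `x i` that satisfy all linear clauses univariate in `x i` (for
these clauses the values of the other variables do not matter). -/
def Formula.B {n : ℕ} (F : Formula n) (i : Fin n) : Set ℝ :=
  {t | ∀ C ∈ F.lin, Clause.Univariate C i → Clause.Holds C (fun _ => t)}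

/-- The set `D_F`. -/
def Formula.D {n : ℕ} (F : Formula n) : Set (Fin n → ℝ) := {x | ∀ i, x i ∈ F.B i}

/-- The set `D_P`. -/
def Formula.DP {n : ℕ} (F : Formula n) (P : NLConstraint n) : Set (Fin P.arity → ℝ) :=
  {x | ∀ j, x j ∈ F.B (P.args j)}

def Formula.BoundedInstance {n : ℕ} (F : Formula n) : Prop :=
  Bornology.IsBounded F.D ∧ ∀ P ∈ F.nl, closure (F.DP P) ⊆ P.fn.Dom

/-- The programs attached to the non-linear constraints do what they are meant to do: the oracle
machine computes the function, and the other program computes a (total) uniform modulus of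
continuity of the function on the closure of `D_P`. -/
def Formula.WellPresented {n : ℕ} (F : Formula n) : Prop :=
  ∀ P ∈ F.nl, Computes P.machine P.fn ∧
    ∃ μ : ℕ → ℕ, (∀ p, μ p ∈ P.modulus.eval p) ∧ IsUniformModulus μ P.fn (closure (F.DP P))

/-! ### Partial assignments -/

/-- A partial assignment of the variables to rationals. -/
abbrev Asg (n : ℕ) : Type := Fin n → Option ℚ

/-- A partial assignment as the solver builds it, in chronological order: `α ++ [(z, q)]` extends
`α` by `z ↦ q`. -/
abbrev Trail (n : ℕ) : Type := List (Fin n × ℚ)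

def Trail.asg {n : ℕ} (α : Trail n) : Asg n := fun i => α.lookup i

/-- All variables are assigned. -/
def Asg.Total {n : ℕ} (β : Asg n) : Prop := ∀ i, (β i).isSome

/-- The rational values of the variables (used only for assigned variables). -/
def Asg.val {n : ℕ} (β : Asg n) : Fin n → ℚ := fun i => (β i).getD 0

/-- All variables that occur in the literal are assigned. -/
def Lit.Assigned {n : ℕ} (l : Lit n) (β : Asg n) : Prop := ∀ i, l.coeff i ≠ 0 → (β i).isSome

/-- The literal evaluates to true. -/
def Lit.TrueAt {n : ℕ} (l : Lit n) (β : Asg n) : Prop :=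
  l.Assigned β ∧ l.Holds (fun i => (β.val i : ℝ))

/-- The literal evaluates to false. -/
def Lit.FalseAt {n : ℕ} (l : Lit n) (β : Asg n) : Prop :=
  l.Assigned β ∧ ¬ l.Holds (fun i => (β.val i : ℝ))

def Clause.TrueAt {n : ℕ} (C : Clause n) (β : Asg n) : Prop := ∃ l ∈ C, l.TrueAt β

def Clause.FalseAt {n : ℕ} (C : Clause n) (β : Asg n) : Prop := ∀ l ∈ C, l.FalseAt β

/-- The set of clauses evaluates to true. -/
def LinTrue {n : ℕ} (L : List (Clause n)) (β : Asg n) : Prop := ∀ C ∈ L, Clause.TrueAt C β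

/-- The set of clauses evaluates to false. -/
def LinFalse {n : ℕ} (L : List (Clause n)) (β : Asg n) : Prop := ∃ C ∈ L, Clause.FalseAt C β

/-- The non-linear constraint evaluates to true. -/
def NLConstraint.TrueAt {n : ℕ} (P : NLConstraint n) (β : Asg n) : Prop :=
  (∀ j, (β (P.args j)).isSome) ∧
    ∃ y ∈ P.fn (fun j => (β.val (P.args j) : ℝ)), RelZero P.strict y

/-- The non-linear constraint evaluates to false. -/
def NLConstraint.FalseAt {n : ℕ} (P : NLConstraint n) (β : Asg n) : Prop :=
  (∀ j, (β (P.args j)).isSome) ∧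
    ∃ y ∈ P.fn (fun j => (β.val (P.args j) : ℝ)), ¬ RelZero P.strict y

/-- `C` is a linearisation of `P` at `α`. -/
def IsLinearisation {n : ℕ} (P : NLConstraint n) (α : Asg n) (C : Clause n) : Prop :=
  (∀ β : Asg n, P.TrueAt β → Clause.TrueAt C β) ∧ Clause.FalseAt C α

/-! ### Arithmetical resolution -/

/-- The positive combination of a lower bound `l₁` (`coeff z > 0`) and an upper bound `l₂`
(`coeff z < 0`) on `z` that eliminates `z`. -/
def Lit.elim {n : ℕ} (z : Fin n) (l₁ l₂ : Lit n) : Lit n where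
  coeff i := -(l₂.coeff z) * l₁.coeff i + l₁.coeff z * l₂.coeff i
  const := -(l₂.coeff z) * l₁.const + l₁.coeff z * l₂.const
  strict := l₁.strict || l₂.strict

/-- Clauses obtained by arithmetical resolution on `z` from those clauses of `L` in which no
variable occurs other than `z` and the variables assigned by `α`. -/
inductive Derives {n : ℕ} (α : Asg n) (L : List (Clause n)) (z : Fin n) : Clause n → Prop
  | base (C : Clause n) (hC : C ∈ L)
      (hvar : ∀ l ∈ C, ∀ i, l.coeff i ≠ 0 → i = z ∨ (α i).isSome) : Derives α L z C
  | resolve (C₁ C₂ : Clause n) (l₁ l₂ : Lit n) (h₁ : Derives α L z C₁) (h₂ : Derives α L z C₂)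
      (hl₁ : l₁ ∈ C₁) (hl₂ : l₂ ∈ C₂) (hpos : 0 < l₁.coeff z) (hneg : l₂.coeff z < 0) :
      Derives α L z
        (C₁.filter (fun l => l ≠ l₁) ++ C₂.filter (fun l => l ≠ l₂) ++ [l₁.elim z l₂])

/-- A resolvent on `z`: a non-empty finite set of clauses that are derived by arithmetical
resolution on `z`, do not contain `z`, and evaluate to false under `α`. -/
def IsResolvent {n : ℕ} (α : Asg n) (L : List (Clause n)) (z : Fin n) (R : List (Clause n)) :
    Prop :=
  R ≠ [] ∧ ∀ C ∈ R, Derives α L z C ∧ (∀ l ∈ C, l.coeff z = 0) ∧ Clause.FalseAt C α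

/-! ### Full-box linearisations -/

/-- The precision `p ≥ -⌊log₂ (min {1, δ / 4})⌋`. -/
def Precise (δ : ℚ) (p : ℕ) : Prop := -⌊Real.logb 2 (min 1 ((δ : ℝ) / 4))⌋ ≤ (p : ℤ)

/-- The clause `(x (args 0), …, x (args (k - 1))) ∉ B(a, ε)`, where `B(a, ε)` is the open ball in
the maximum norm: some `x (args j)` is at most `a (args j) - ε` or at least `a (args j) + ε`. -/
def boxClause {n : ℕ} (P : NLConstraint n) (a : Fin n → ℚ) (ε : ℚ) : Clause n :=
  (List.ofFn fun j => (⟨Pi.single (P.args j) (-1), a (P.args j) - ε, false⟩ : Lit n)) ++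
    List.ofFn fun j => (⟨Pi.single (P.args j) 1, -(a (P.args j)) - ε, false⟩ : Lit n)

/-- The function `linearise` for one constraint at the total assignment `a`. The machine is run on
the constant name of the argument vector; `y` is the rational that it returns. The result is
`none` if `y ⋄ -δ / 2`, and otherwise the clause that excludes the open box of radius
`2 ^ (-μ p)`. -/
inductive Linearise {n : ℕ} (δ : ℚ) (p : ℕ) (a : Fin n → ℚ) (P : NLConstraint n) :
    Option (Clause n) → Prop
  | accept (y : ℚ) (hy : ratCode y ∈ P.machine.eval (nameOracle fun _ j => a (P.args j)) p)
      (hrel : RelZero P.strict ((y : ℝ) + δ / 2)) : Linearise δ p a P none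
  | box (y : ℚ) (hy : ratCode y ∈ P.machine.eval (nameOracle fun _ j => a (P.args j)) p)
      (hrel : ¬ RelZero P.strict ((y : ℝ) + δ / 2)) (m : ℕ) (hm : m ∈ P.modulus.eval p) :
      Linearise δ p a P (some (boxClause P a (2⁻¹ ^ m)))

/-- The loop of `nlinStep`: it returns the first clause found (rule `(L)`), or `none` if all
constraints are accepted (rule `(F^δsat)`). -/
inductive NlinLoop {n : ℕ} (δ : ℚ) (p : ℕ) (a : Fin n → ℚ) :
    List (NLConstraint n) → Option (Clause n) → Prop
  | done : NlinLoop δ p a [] none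
  | found (P : NLConstraint n) (N : List (NLConstraint n)) (C : Clause n)
      (h : Linearise δ p a P (some C)) : NlinLoop δ p a (P :: N) (some C)
  | next (P : NLConstraint n) (N : List (NLConstraint n)) (r : Option (Clause n))
      (h : Linearise δ p a P none) (hr : NlinLoop δ p a N r) : NlinLoop δ p a (P :: N) r

/-! ### The calculus -/

/-- States; the non-linear part never changes and is kept outside. -/
inductive State (n : ℕ) : Type
  | run (α : Trail n) (L : List (Clause n)) : State n
  | unsat : State n
  | deltaSat : State n
  | sat : State n

/-- The initial state `(nil, L₀, N)`. -/
def Formula.init {n : ℕ} (F : Formula n) : State n := .run [] F.lin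

/-- `z` is the next variable to be assigned with respect to the order `π 0, π 1, …`. -/
def IsNext {n : ℕ} (π : Equiv.Perm (Fin n)) (α : Trail n) (z : Fin n) : Prop :=
  α.asg z = none ∧ ∀ i, π.symm i < π.symm z → (α.asg i).isSome

/-- The transitions of the calculus with full-box linearisations, where `π` is the order in which
the variables get assigned. In the rule `sat` the first two premises already exclude the rules
`assign`, `resolve` and `backjump`. -/
inductive Step {n : ℕ} (F : Formula n) (π : Equiv.Perm (Fin n)) (δ : ℚ) (p : ℕ) :
    State n → State n → Prop
  | assign (α : Trail n) (L : List (Clause n)) (z : Fin n) (q : ℚ)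
      (hL : ¬ LinFalse L α.asg) (hz : IsNext π α z)
      (hq : ¬ LinFalse L (Trail.asg (α ++ [(z, q)]))) :
      Step F π δ p (.run α L) (.run (α ++ [(z, q)]) L)
  | resolve (α : Trail n) (L : List (Clause n)) (z : Fin n) (R : List (Clause n))
      (hL : ¬ LinFalse L α.asg) (hz : α.asg z = none)
      (hq : ∀ q : ℚ, LinFalse L (Trail.asg (α ++ [(z, q)])))
      (hR : IsResolvent α.asg L z R) :
      Step F π δ p (.run α L) (.run α (R ++ L))
  | backjump (α γ : Trail n) (L : List (Clause n))
      (hL : LinFalse L α.asg) (hpre : γ <+: α) (hγ : ¬ LinFalse L γ.asg)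
      (hmax : ∀ γ' : Trail n, γ' <+: α → ¬ LinFalse L γ'.asg → γ' <+: γ) :
      Step F π δ p (.run α L) (.run γ L)
  | linearise (α : Trail n) (L : List (Clause n)) (C : Clause n)
      (hα : α.asg.Total) (hL : LinTrue L α.asg)
      (hC : NlinLoop δ p α.asg.val F.nl (some C)) :
      Step F π δ p (.run α L) (.run α (C :: L))
  | deltaSat (α : Trail n) (L : List (Clause n))
      (hα : α.asg.Total) (hL : LinTrue L α.asg)
      (hN : NlinLoop δ p α.asg.val F.nl none) :
      Step F π δ p (.run α L) .deltaSat
  | sat (α : Trail n) (L : List (Clause n))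
      (hα : α.asg.Total) (hL : LinTrue L α.asg)
      (hN : ¬ ∃ P ∈ F.nl, P.FalseAt α.asg ∧ ∃ C, IsLinearisation P α.asg C) :
      Step F π δ p (.run α L) .sat
  | unsat (α : Trail n) (L : List (Clause n))
      (hL : LinFalse L (Trail.asg [])) :
      Step F π δ p (.run α L) .unsat

/-- The meaning of the state in which a derivation ends. A derivation that ends in a non-final
state is not an answer. -/
def Formula.CorrectAnswer {n : ℕ} (F : Formula n) (δ : ℚ) : State n → Prop
  | .run _ _ => False
  | .unsat => ∀ x : Fin n → ℝ, ¬ F.Sat x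
  | .deltaSat => ∃ a : Fin n → ℚ, F.WeakSat δ (fun i => (a i : ℝ))
  | .sat => ∃ a : Fin n → ℚ, F.Sat (fun i => (a i : ℝ)) ∧ F.WeakSat δ (fun i => (a i : ℝ))

/-! ### Finite presentations of inputs and states -/

/-- Coefficients, constant, strictness. -/
abbrev LitData : Type := List RatData × RatData × Bool

def Lit.data {n : ℕ} (l : Lit n) : LitData :=
  (List.ofFn fun i => ratData (l.coeff i), ratData l.const, l.strict)

def Clause.data {n : ℕ} (C : Clause n) : List LitData := C.map Lit.data

/-- Arguments, strictness, oracle machine, program for the modulus. The real function itself is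
not part of the input of the procedure. -/
abbrev NLData : Type := List ℕ × Bool × ℕ × Nat.Partrec.Code

def NLConstraint.data {n : ℕ} (P : NLConstraint n) : NLData :=
  (List.ofFn fun j => (P.args j : ℕ), P.strict, P.machine.toNat, P.modulus)

/-- The precision parameter, the variable order, the linear part and the non-linear part. -/
abbrev InputData : Type := RatData × List ℕ × List (List LitData) × List NLData

def Formula.data {n : ℕ} (F : Formula n) (π : Equiv.Perm (Fin n)) (δ : ℚ) : InputData :=
  (ratData δ, List.ofFn fun i => (π i : ℕ), F.lin.map Clause.data, F.nl.map NLConstraint.data)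

/-- Either trail and linear part, or the number of a final state. -/
abbrev StateData : Type := (List (ℕ × RatData) × List (List LitData)) ⊕ ℕ

def State.data {n : ℕ} : State n → StateData
  | .run α L => .inl (α.map fun e => ((e.1 : ℕ), ratData e.2), L.map Clause.data)
  | .unsat => .inr 0
  | .deltaSat => .inr 1
  | .sat => .inr 2

end DeltaKsmt

open DeltaKsmt

/-! The proof combines an invariant, a progress property, a compactness argument and a search over
coded runs.

Soundness. The linear part always contains `F.lin` and consists of clauses true at every real
solution of `F`. For resolvents this is soundness of arithmetical resolution. For a box clause at
`a` (`Linearise.box_sound`), the machine's error at `a` and the variation of `f` over the box,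
within `D_P`, are each at most `2⁻ᵖ ≤ δ/4`. So if `f x ⋄ 0` held at a point `x` of the box, the
output at `a` would pass the test with `δ/2`. Conversely, an accepted output gives `f a + δ ⋄ 0`.
Every false constraint has a linearisation (`isLinearisation_pointClause`), so the rule `sat` fires
only at genuine solutions.

Progress (`RunInv.exists_effStep`). If the linear part is false, UNSAT or a backjump applies. If it
is not false and the trail is total, the point lies in `D_F`, so the machines halt there. If the
trail is partial, either the next variable has an admissible rational value, or resolution refutes
all its values. The last claim is `exists_derives_false`. A clause false far to the left contains
only lower bounds on `z`. Resolving away the upper bounds of a clause that is false just above the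
least of these bounds gives a clause whose lower bounds are all strictly larger. There are finitely
many end points, so `z` eventually disappears.

Termination. Assigned variables form an initial segment of the order, so resolution on `z` combines
only literals whose last variable is `z` and yields literals ending earlier. Hence finitely many
literals arise without box steps, and each resolvent is new as a set of literals, since it is false
while the old linear part is not. An infinite run therefore excludes infinitely many boxes
(`frequently_isBoxStep`). Their centres lie in the bounded set `D_F` and are pairwise at least a
fixed positive distance apart, contradicting Bolzano–Weierstrass.

Effectiveness. Progress uses only the checkable transitions `EffStep`, so these alone give a
complete run. On constant names an oracle machine is an ordinary program. With a fuel bounding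
running times and rounds of resolution, being a complete run is a primitive recursive property of
finite data (`primrecRel_runQ`), and unbounded search finds such a run. -/

namespace DeltaKsmt

variable {n : ℕ}

/-! ### Evaluation of literals at rational points -/

/-- The value of the linear form of a literal at a rational point. -/
def Lit.evalQ (l : Lit n) (a : Fin n → ℚ) : ℚ := l.const + ∑ i, l.coeff i * a i

/-- `t ⋄ 0` for a rational `t`. -/
def RelZeroQ (s : Bool) (t : ℚ) : Prop := if s then 0 < t else 0 ≤ t

theorem relZero_cast (s : Bool) (t : ℚ) : RelZero s (t : ℝ) ↔ RelZeroQ s t := by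
  cases s <;> simp [RelZero, RelZeroQ]

theorem Lit.holds_cast (l : Lit n) (a : Fin n → ℚ) :
    l.Holds (fun i => (a i : ℝ)) ↔ RelZeroQ l.strict (l.evalQ a) := by
  rw [← relZero_cast, Lit.Holds, Lit.evalQ]
  push_cast
  rfl

theorem Lit.elim_coeff_self (z : Fin n) (l₁ l₂ : Lit n) : (l₁.elim z l₂).coeff z = 0 := by
  simp only [Lit.elim]; ring

theorem Lit.evalQ_elim (z : Fin n) (l₁ l₂ : Lit n) (a : Fin n → ℚ) :
    (l₁.elim z l₂).evalQ a = -(l₂.coeff z) * l₁.evalQ a + l₁.coeff z * l₂.evalQ a := by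
  simp only [Lit.elim, Lit.evalQ, mul_add, Finset.mul_sum, add_mul, Finset.sum_add_distrib]
  have h1 : ∀ c : ℚ, ∀ i, c * (l₁.coeff i * a i) = c * l₁.coeff i * a i := fun _ _ => by ring
  have h2 : ∀ c : ℚ, ∀ i, c * (l₂.coeff i * a i) = c * l₂.coeff i * a i := fun _ _ => by ring
  simp only [h1, h2]
  ring

/-- Both multipliers are positive, so the combination preserves the inequalities and is strict as
soon as one of them is. -/
theorem Lit.elim_holds {z : Fin n} {l₁ l₂ : Lit n} (h₁ : 0 < l₁.coeff z) (h₂ : l₂.coeff z < 0)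
    {x : Fin n → ℝ} (hx₁ : l₁.Holds x) (hx₂ : l₂.Holds x) : (l₁.elim z l₂).Holds x := by
  have key : ((l₁.elim z l₂).const : ℝ) + ∑ i, ((l₁.elim z l₂).coeff i : ℝ) * x i =
      -(l₂.coeff z : ℝ) * ((l₁.const : ℝ) + ∑ i, (l₁.coeff i : ℝ) * x i) +
        (l₁.coeff z : ℝ) * ((l₂.const : ℝ) + ∑ i, (l₂.coeff i : ℝ) * x i) := by
    simp only [Lit.elim, mul_add, Finset.mul_sum]
    push_cast
    simp only [add_mul, Finset.sum_add_distrib, mul_assoc]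
    ring
  have p₁ : (0 : ℝ) < l₁.coeff z := by exact_mod_cast h₁
  have p₂ : (0 : ℝ) < -(l₂.coeff z : ℝ) := by
    have : (l₂.coeff z : ℝ) < 0 := by exact_mod_cast h₂
    linarith
  unfold Lit.Holds at *
  rw [key]
  have hs : (l₁.elim z l₂).strict = (l₁.strict || l₂.strict) := rfl
  rw [hs]
  revert hx₁ hx₂
  generalize (l₁.const : ℝ) + ∑ i, (l₁.coeff i : ℝ) * x i = u
  generalize (l₂.const : ℝ) + ∑ i, (l₂.coeff i : ℝ) * x i = v
  cases l₁.strict <;> cases l₂.strict <;> simp only [RelZero] <;> simp <;> intro hu hv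
  · have := mul_nonneg p₂.le hu; have := mul_nonneg p₁.le hv; linarith
  · have := mul_nonneg p₂.le hu; have := mul_pos p₁ hv; linarith
  · have := mul_pos p₂ hu; have := mul_nonneg p₁.le hv; linarith
  · have := mul_pos p₂ hu; have := mul_pos p₁ hv; linarith

/-- Arithmetical resolution is sound. -/
theorem Derives.holds {α : Asg n} {L : List (Clause n)} {z : Fin n} {C : Clause n}
    (h : Derives α L z C) {x : Fin n → ℝ}
    (hL : ∀ C ∈ L, (∀ l ∈ C, ∀ i, l.coeff i ≠ 0 → i = z ∨ (α i).isSome) → Clause.Holds C x) :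
    Clause.Holds C x := by
  induction h with
  | base C hC hv => exact hL C hC hv
  | resolve C₁ C₂ l₁ l₂ _ _ hl₁ hl₂ hpos hneg ih₁ ih₂ =>
    obtain ⟨k₁, hk₁, hx₁⟩ := ih₁
    obtain ⟨k₂, hk₂, hx₂⟩ := ih₂
    -- Unless the true literals of both parents are exactly the resolved ones, a true literal
    -- survives the filters.
    by_cases e₁ : k₁ = l₁
    · by_cases e₂ : k₂ = l₂
      · subst e₁ e₂
        exact ⟨_, by simp, Lit.elim_holds hpos hneg hx₁ hx₂⟩
      · exact ⟨k₂, by simp [hk₂, e₂], hx₂⟩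
    · exact ⟨k₁, by simp [hk₁, e₁], hx₁⟩

/-! ### Partial assignments -/

theorem Asg.val_update (β : Asg n) (z : Fin n) (q : ℚ) :
    Asg.val (Function.update β z (some q)) = Function.update β.val z q := by
  funext i
  by_cases h : i = z
  · subst h; simp [Asg.val]
  · simp [Asg.val, h]

theorem Trail.asg_append (α γ : Trail n) (i : Fin n) :
    Trail.asg (α ++ γ) i = (α.asg i).or (γ.asg i) := by
  simp [Trail.asg, List.lookup_append]

theorem Trail.asg_concat (α : Trail n) (z : Fin n) (q : ℚ) (hz : α.asg z = none) :
    Trail.asg (α ++ [(z, q)]) = Function.update α.asg z (some q) := by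
  funext i
  rw [Trail.asg_append]
  by_cases h : i = z
  · subst h; rw [hz]; simp [Trail.asg, List.lookup]
  · have : (i == z) = false := by simpa using h
    simp [h, Trail.asg, List.lookup, this]

/-- `γ` extends `β`. -/
def Asg.Le (β γ : Asg n) : Prop := ∀ i q, β i = some q → γ i = some q

theorem Asg.le_update {β : Asg n} {z : Fin n} (hz : β z = none) (q : ℚ) :
    β.Le (Function.update β z (some q)) := by
  intro i r h
  have : i ≠ z := by rintro rfl; simp [hz] at h
  simpa [this] using h

theorem Lit.Assigned.mono {l : Lit n} {β γ : Asg n} (h : β.Le γ) (hl : l.Assigned β) :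
    l.Assigned γ := by
  intro i hi
  obtain ⟨q, hq⟩ := Option.isSome_iff_exists.1 (hl i hi)
  simp [h i q hq]

theorem Lit.holds_congr {l : Lit n} {x y : Fin n → ℝ} (h : ∀ i, l.coeff i ≠ 0 → x i = y i) :
    l.Holds x ↔ l.Holds y := by
  have : ∑ i, (l.coeff i : ℝ) * x i = ∑ i, (l.coeff i : ℝ) * y i := by
    refine Finset.sum_congr rfl fun i _ => ?_
    by_cases hi : l.coeff i = 0
    · simp [hi]
    · rw [h i hi]
  simp only [Lit.Holds, this]

theorem Lit.holds_val_congr {l : Lit n} {β γ : Asg n} (h : β.Le γ) (hl : l.Assigned β) :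
    l.Holds (fun i => (β.val i : ℝ)) ↔ l.Holds (fun i => (γ.val i : ℝ)) := by
  refine Lit.holds_congr fun i hi => ?_
  obtain ⟨q, hq⟩ := Option.isSome_iff_exists.1 (hl i hi)
  simp [Asg.val, hq, h i q hq]

theorem Lit.FalseAt.mono {l : Lit n} {β γ : Asg n} (h : β.Le γ) (hl : l.FalseAt β) :
    l.FalseAt γ :=
  ⟨hl.1.mono h, fun hh => hl.2 ((Lit.holds_val_congr h hl.1).2 hh)⟩

/-- Under a total assignment, a set of clauses is true iff it is not false. -/
theorem linTrue_iff {L : List (Clause n)} {β : Asg n} (hβ : β.Total) :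
    LinTrue L β ↔ ¬ LinFalse L β := by
  unfold LinTrue LinFalse Clause.TrueAt Clause.FalseAt Lit.TrueAt Lit.FalseAt
  have : ∀ l : Lit n, l.Assigned β := fun l i _ => hβ i
  simp [this]

theorem LinTrue.holds {L : List (Clause n)} {β : Asg n} (h : LinTrue L β) :
    ∀ C ∈ L, Clause.Holds C (fun i => (β.val i : ℝ)) := by
  intro C hC
  obtain ⟨l, hl, hh⟩ := h C hC
  exact ⟨l, hl, hh.2⟩

/-! ### Completeness of arithmetical resolution on one variable -/

/-- The value of the literal with `z` set to `0`. -/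
def Lit.rest (l : Lit n) (z : Fin n) (a : Fin n → ℚ) : ℚ := l.evalQ (Function.update a z 0)

theorem Lit.evalQ_update (l : Lit n) (z : Fin n) (a : Fin n → ℚ) (q : ℚ) :
    l.evalQ (Function.update a z q) = l.coeff z * q + l.rest z a := by
  have : ∀ r : ℚ, ∑ i, l.coeff i * Function.update a z r i =
      l.coeff z * r + ∑ i ∈ Finset.univ.erase z, l.coeff i * a i := by
    intro r
    rw [← Finset.add_sum_erase _ _ (Finset.mem_univ z)]
    congr 1
    · simp
    · refine Finset.sum_congr rfl fun i hi => ?_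
      rw [Function.update_of_ne (Finset.ne_of_mem_erase hi)]
  simp only [Lit.rest, Lit.evalQ, this]
  ring

/-- The boundary point of the set of values of `z` that make the literal true, as a cut: a lower
bound `l` is true at `q` iff `cut l ≤ (q, false)`, an upper bound iff `(q, false) < cut l`. -/
def Lit.cut (l : Lit n) (z : Fin n) (a : Fin n → ℚ) : ℚ ×ₗ Bool :=
  toLex (-(l.rest z a) / l.coeff z, if 0 < l.coeff z then l.strict else !l.strict)

theorem Lit.lower_iff {l : Lit n} {z : Fin n} (a : Fin n → ℚ) (h : 0 < l.coeff z) (q : ℚ) :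
    RelZeroQ l.strict (l.evalQ (Function.update a z q)) ↔ l.cut z a ≤ toLex (q, false) := by
  rw [Lit.evalQ_update, Lit.cut, if_pos h, Prod.Lex.toLex_le_toLex]
  simp only [div_lt_iff₀ h, div_eq_iff h.ne']
  cases l.strict <;> simp [RelZeroQ]
  · rw [← le_iff_lt_or_eq, neg_le_iff_add_nonneg, mul_comm]
  · rw [mul_comm, neg_lt_iff_pos_add]
    exact ⟨Or.inl, fun h => h.resolve_right fun h => absurd h.2 (by decide)⟩

theorem Lit.upper_iff {l : Lit n} {z : Fin n} (a : Fin n → ℚ) (h : l.coeff z < 0) (q : ℚ) :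
    RelZeroQ l.strict (l.evalQ (Function.update a z q)) ↔ toLex (q, false) < l.cut z a := by
  rw [Lit.evalQ_update, Lit.cut, if_neg h.le.not_gt, Prod.Lex.toLex_lt_toLex]
  simp only [lt_div_iff_of_neg h, eq_div_iff h.ne, eq_comm (b := -l.rest z a)]
  cases l.strict <;> simp [RelZeroQ]
  · rw [← le_iff_lt_or_eq, neg_le_iff_add_nonneg, mul_comm]
  · rw [neg_lt_iff_pos_add, mul_comm]

/-- The upper bound ends no later than the lower bound starts, so no value of `z` meets both. The
eliminated literal expresses precisely this comparison of end points. -/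
theorem Lit.elim_false_of_cut_le {l₁ l₂ : Lit n} {z : Fin n} {a : Fin n → ℚ}
    (h₁ : 0 < l₁.coeff z) (h₂ : l₂.coeff z < 0) (h : l₂.cut z a ≤ l₁.cut z a) :
    ¬ RelZeroQ (l₁.elim z l₂).strict ((l₁.elim z l₂).evalQ a) := by
  have e : (l₁.elim z l₂).evalQ a = -(l₂.coeff z) * l₁.rest z a + l₁.coeff z * l₂.rest z a := by
    rw [Lit.evalQ_elim]
    have := fun l : Lit n => Lit.evalQ_update l z a (a z)
    simp only [Function.update_eq_self] at this
    rw [this, this]; ring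
  rw [e]
  rw [Lit.cut, Lit.cut, if_pos h₁, if_neg h₂.le.not_gt, Prod.Lex.toLex_le_toLex] at h
  have hs : (l₁.elim z l₂).strict = (l₁.strict || l₂.strict) := rfl
  rw [hs]
  generalize l₁.rest z a = r₁ at *
  generalize l₂.rest z a = r₂ at *
  -- The value is a positive multiple of upper end point minus lower end point. If these coincide,
  -- the Boolean components of the cuts say that one literal is strict, so the value `0` is still
  -- not enough.
  have k : -(l₂.coeff z) * r₁ + l₁.coeff z * r₂ =
      (l₁.coeff z * -(l₂.coeff z)) * (-r₂ / l₂.coeff z - -r₁ / l₁.coeff z) := by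
    field_simp [h₁.ne', h₂.ne]; ring
  have hp : 0 < l₁.coeff z * -(l₂.coeff z) := mul_pos h₁ (by linarith)
  rw [k]
  rcases h with h | ⟨h, h'⟩
  · have := mul_neg_of_pos_of_neg hp (sub_neg.2 h)
    cases l₁.strict <;> cases l₂.strict <;> simp only [RelZeroQ] <;> simp <;> linarith
  · dsimp only at h h'
    rw [h, sub_self, mul_zero]
    revert h'
    cases l₁.strict <;> cases l₂.strict <;> simp [RelZeroQ]

/-- A cut `(b, false)` is the rational `b` itself, while `(b, true)` lies immediately after it. In
the second case `q` is taken above `b` and before the next larger first component in the finite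
list. -/
theorem exists_rat_above_cut (K : List (ℚ ×ₗ Bool)) (κ₀ : ℚ ×ₗ Bool) :
    ∃ q : ℚ, κ₀ ≤ toLex (q, false) ∧ ∀ κ ∈ K, κ ≤ toLex (q, false) → κ ≤ κ₀ := by
  obtain ⟨⟨b, s⟩, rfl⟩ := toLex.surjective κ₀
  cases s with
  | false => exact ⟨b, le_rfl, fun _ _ h => h⟩
  | true =>
    have : ∃ q : ℚ, b < q ∧ ∀ κ ∈ K, b < (ofLex κ).1 → q < (ofLex κ).1 := by
      induction K with
      | nil => exact ⟨b + 1, by linarith, by simp⟩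
      | cons κ K ih =>
        obtain ⟨q, hq, hK⟩ := ih
        by_cases hb : b < (ofLex κ).1
        · obtain ⟨r, hr₁, hr₂⟩ := exists_between (lt_min hq hb)
          refine ⟨r, hr₁, ?_⟩
          intro κ' h' hb'
          rcases List.mem_cons.1 h' with rfl | h'
          · exact hr₂.trans_le (min_le_right _ _)
          · exact (hr₂.trans_le (min_le_left _ _)).trans (hK κ' h' hb')
        · refine ⟨q, hq, ?_⟩
          intro κ' h' hb'
          rcases List.mem_cons.1 h' with rfl | h'
          · exact absurd hb' hb
          · exact hK κ' h' hb'
    obtain ⟨q, hq, hK⟩ := this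
    refine ⟨q, by rw [Prod.Lex.toLex_le_toLex]; exact Or.inl hq, fun κ hκ hle => ?_⟩
    have hb : ¬ b < (ofLex κ).1 := fun hb => by
      have := hK κ hκ hb
      obtain ⟨⟨c, t⟩, rfl⟩ := toLex.surjective κ
      rw [Prod.Lex.toLex_le_toLex] at hle
      simp at this hle
      rcases hle with h | h
      · linarith
      · linarith [h.1]
    obtain ⟨⟨c, t⟩, rfl⟩ := toLex.surjective κ
    rw [Prod.Lex.toLex_le_toLex]
    simp at hb ⊢
    rcases hb.lt_or_eq with h | h
    · exact Or.inl h
    · exact Or.inr h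

/-- At such a point every upper bound is true, so a clause false there has only lower bounds on `z`.
-/
theorem exists_rat_below_cuts (K : List (ℚ ×ₗ Bool)) :
    ∃ q : ℚ, ∀ κ ∈ K, toLex (q, false) < κ := by
  induction K with
  | nil => exact ⟨0, by simp⟩
  | cons κ K ih =>
    obtain ⟨q, hq⟩ := ih
    refine ⟨min q ((ofLex κ).1 - 1), ?_⟩
    intro κ' h'
    rcases List.mem_cons.1 h' with rfl | h'
    · obtain ⟨⟨c, t⟩, rfl⟩ := toLex.surjective κ'
      rw [Prod.Lex.toLex_lt_toLex]
      left
      simp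
    · refine lt_of_le_of_lt ?_ (hq κ' h')
      rw [Prod.Lex.toLex_le_toLex]
      rcases (min_le_left q ((ofLex κ).1 - 1)).lt_or_eq with h | h
      · exact Or.inl h
      · exact Or.inr ⟨h, le_rfl⟩

/-- A derived clause whose literals without `z` are false. -/
structure DerivesGood (β : Asg n) (L : List (Clause n)) (z : Fin n) (E : Clause n) : Prop where
  derives : Derives β L z E
  vars : ∀ l ∈ E, ∀ i, l.coeff i ≠ 0 → i = z ∨ (β i).isSome
  good : ∀ l ∈ E, l.coeff z = 0 → l.FalseAt β

/-- The only new literal is free of `z` and false because the two bounds clash. All literals with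
`z` are inherited, without the resolved pair. -/
theorem DerivesGood.resolve {β : Asg n} {L : List (Clause n)} {z : Fin n} {D C : Clause n}
    (hD : DerivesGood β L z D) (hC : DerivesGood β L z C) {l u : Lit n} (hl : l ∈ D) (hu : u ∈ C)
    (hlp : 0 < l.coeff z) (hun : u.coeff z < 0) (hcut : u.cut z β.val ≤ l.cut z β.val) :
    ∃ E, DerivesGood β L z E ∧
      ∀ k ∈ E, k.coeff z ≠ 0 → (k ∈ D ∧ k ≠ l) ∨ (k ∈ C ∧ k ≠ u) := by
  have hv : ∀ i, (l.elim z u).coeff i ≠ 0 → i = z ∨ (β i).isSome := by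
    intro i hi
    by_cases h1 : l.coeff i = 0
    · by_cases h2 : u.coeff i = 0
      · simp [Lit.elim, h1, h2] at hi
      · exact hC.vars u hu i h2
    · exact hD.vars l hl i h1
  refine ⟨_, ⟨Derives.resolve D C l u hD.derives hC.derives hl hu hlp hun, ?_, ?_⟩, ?_⟩
  · intro k hk
    simp only [List.mem_append, List.mem_filter, List.mem_singleton, decide_eq_true_eq] at hk
    rcases hk with (hk | hk) | rfl
    · exact hD.vars k hk.1
    · exact hC.vars k hk.1
    · exact hv
  · intro k hk hkz
    simp only [List.mem_append, List.mem_filter, List.mem_singleton, decide_eq_true_eq] at hk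
    rcases hk with (hk | hk) | rfl
    · exact hD.good k hk.1 hkz
    · exact hC.good k hk.1 hkz
    · refine ⟨fun i hi => ?_, ?_⟩
      · rcases hv i hi with rfl | h
        · exact absurd hkz hi
        · exact h
      · rw [Lit.holds_cast]
        exact Lit.elim_false_of_cut_le hlp hun hcut
  · intro k hk hkz
    simp only [List.mem_append, List.mem_filter, List.mem_singleton, decide_eq_true_eq] at hk
    rcases hk with (hk | hk) | rfl
    · exact Or.inl hk
    · exact Or.inr hk
    · exact absurd (Lit.elim_coeff_self z l u) hkz

/-- Resolving all lower bounds of a clause with the upper bound `u`. -/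
theorem DerivesGood.resolve_lower {β : Asg n} {L : List (Clause n)} {z : Fin n} {C : Clause n}
    (hC : DerivesGood β L z C) {u : Lit n} (hu : u ∈ C) (hun : u.coeff z < 0) (T : List (Lit n))
    (hT : ∀ l ∈ T, 0 < l.coeff z ∧ u.cut z β.val ≤ l.cut z β.val) (E : Clause n)
    (hE : DerivesGood β L z E) (hET : ∀ k ∈ E, k.coeff z ≠ 0 → (k ∈ C ∧ k ≠ u) ∨ k ∈ T) :
    ∃ E', DerivesGood β L z E' ∧ ∀ k ∈ E', k.coeff z ≠ 0 → k ∈ C ∧ k ≠ u := by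
  -- `T` lists the lower bounds still to be removed from `E`. Each resolution removes one and brings
  -- in only literals of `C` other than `u`, besides literals without `z`.
  induction T generalizing E with
  | nil => exact ⟨E, hE, fun k hk hz => by simpa using hET k hk hz⟩
  | cons l T ih =>
    have hT' : ∀ l ∈ T, 0 < l.coeff z ∧ u.cut z β.val ≤ l.cut z β.val :=
      fun k hk => hT k (List.mem_cons_of_mem _ hk)
    by_cases hl : l ∈ E
    · obtain ⟨E₁, hE₁, h₁⟩ := hE.resolve hC hl hu (hT l (by simp)).1 hun (hT l (by simp)).2
      refine ih hT' E₁ hE₁ fun k hk hz => ?_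
      rcases h₁ k hk hz with ⟨h, hne⟩ | h
      · rcases hET k h hz with h | h
        · exact Or.inl h
        · exact Or.inr ((List.mem_cons.1 h).resolve_left hne)
      · exact Or.inl h
    · refine ih hT' E hE fun k hk hz => ?_
      rcases hET k hk hz with h | h
      · exact Or.inl h
      · refine Or.inr ((List.mem_cons.1 h).resolve_left ?_)
        rintro rfl
        exact hl hk

/-- Resolving all upper bounds of a clause with the lower bounds of the clause `D`. -/
theorem DerivesGood.resolve_upper {β : Asg n} {L : List (Clause n)} {z : Fin n} {D : Clause n}
    (hD : DerivesGood β L z D) (hDl : ∀ l ∈ D, l.coeff z ≠ 0 → 0 < l.coeff z)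
    (W U : List (Lit n)) (hU : ∀ u ∈ U, u.coeff z < 0 ∧
      ∀ l ∈ D, l.coeff z ≠ 0 → u.cut z β.val ≤ l.cut z β.val)
    (E : Clause n) (hE : DerivesGood β L z E)
    (hEU : ∀ k ∈ E, k.coeff z ≠ 0 → k ∈ W ∨ k ∈ U) :
    ∃ E', DerivesGood β L z E' ∧ ∀ k ∈ E', k.coeff z ≠ 0 → k ∈ W := by
  -- `W` collects the literals that may stay and `U` the upper bounds still to be removed. Each of
  -- the latter is consumed by starting afresh from `D` and resolving all its lower bounds with `u`.
  induction U generalizing E with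
  | nil => exact ⟨E, hE, fun k hk hz => by simpa using hEU k hk hz⟩
  | cons u U ih =>
    have hU' := fun k hk => hU k (List.mem_cons_of_mem u hk)
    by_cases hu : u ∈ E
    · obtain ⟨hun, hcut⟩ := hU u (by simp)
      obtain ⟨E₁, hE₁, h₁⟩ := hE.resolve_lower hu hun (D.filter fun l => l.coeff z ≠ 0)
        (fun l hl => by
          simp only [List.mem_filter, decide_eq_true_eq] at hl
          exact ⟨hDl l hl.1 hl.2, hcut l hl.1 hl.2⟩) D hD
        (fun k hk hz => Or.inr (by simp [hk, hz]))
      refine ih hU' E₁ hE₁ fun k hk hz => ?_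
      obtain ⟨h, hne⟩ := h₁ k hk hz
      rcases hEU k h hz with h | h
      · exact Or.inl h
      · exact Or.inr ((List.mem_cons.1 h).resolve_left hne)
    · refine ih hU' E hE fun k hk hz => ?_
      rcases hEU k hk hz with h | h
      · exact Or.inl h
      · refine Or.inr ((List.mem_cons.1 h).resolve_left ?_)
        rintro rfl
        exact hu hk

theorem Lit.falseAt_of_update {β : Asg n} {z : Fin n} {q : ℚ} {l : Lit n} (hlz : l.coeff z = 0)
    (h : l.FalseAt (Function.update β z (some q))) : l.FalseAt β := by
  refine ⟨fun i hi => ?_, fun hh => h.2 ?_⟩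
  · have hne : i ≠ z := by rintro rfl; exact hi hlz
    simpa [hne] using h.1 i hi
  · refine (Lit.holds_congr fun i hi => ?_).1 hh
    have hne : i ≠ z := by rintro rfl; exact hi hlz
    simp [Asg.val_update, hne]

/-- If the clauses exclude every value of `z`, then some clause without `z` that is false under the
given assignment can be derived by arithmetical resolution. -/
theorem exists_derives_false {β : Asg n} {L : List (Clause n)} {z : Fin n}
    (hL : ∀ q : ℚ, LinFalse L (Function.update β z (some q))) :
    ∃ C, Derives β L z C ∧ (∀ l ∈ C, l.coeff z = 0) ∧ Clause.FalseAt C β := by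
  classical
  set K : List (ℚ ×ₗ Bool) := L.flatten.map fun l => l.cut z β.val with hK
  -- A clause of `L` false at `z ↦ q` has all its lower bounds after `q` and all its upper bounds
  -- ending by `q`; it mentions only `z` and assigned variables, so it may be used for resolution.
  have hbase : ∀ q : ℚ, ∃ C, DerivesGood β L z C ∧ C ∈ L ∧
      (∀ l ∈ C, 0 < l.coeff z → toLex (q, false) < l.cut z β.val) ∧
      (∀ l ∈ C, l.coeff z < 0 → l.cut z β.val ≤ toLex (q, false)) := by
    intro q
    obtain ⟨C, hC, hf⟩ := hL q
    have hv : ∀ l ∈ C, ∀ i, l.coeff i ≠ 0 → i = z ∨ (β i).isSome := by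
      intro l hl i hi
      by_cases hne : i = z
      · exact Or.inl hne
      · exact Or.inr (by simpa [hne] using (hf l hl).1 i hi)
    have hn : ∀ l ∈ C, ¬ RelZeroQ l.strict (l.evalQ (Function.update β.val z q)) := by
      intro l hl
      have := (hf l hl).2
      rwa [Lit.holds_cast, Asg.val_update] at this
    refine ⟨C, ⟨.base C hC hv, hv, fun l hl hlz => Lit.falseAt_of_update hlz (hf l hl)⟩, hC, ?_, ?_⟩
    · intro l hl h
      have := hn l hl
      rwa [Lit.lower_iff _ h, not_le] at this
    · intro l hl h
      have := hn l hl
      rwa [Lit.upper_iff _ h, not_lt] at this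
  have hmemK : ∀ C ∈ L, ∀ l ∈ C, l.cut z β.val ∈ K := fun C hC l hl =>
    List.mem_map.2 ⟨l, List.mem_flatten.2 ⟨C, hC, hl⟩, rfl⟩
  -- resolving a clause without upper bounds with the base clauses that are false just above `κ₀`
  have next : ∀ (κ₀ : ℚ ×ₗ Bool) (D : Clause n), DerivesGood β L z D →
      (∀ l ∈ D, l.coeff z ≠ 0 → 0 < l.coeff z ∧ κ₀ ≤ l.cut z β.val) →
      ∃ E, DerivesGood β L z E ∧ ∀ l ∈ E, l.coeff z ≠ 0 →
        0 < l.coeff z ∧ κ₀ < l.cut z β.val ∧ l.cut z β.val ∈ K := by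
    intro κ₀ D hD hDl
    obtain ⟨q, hq, hqK⟩ := exists_rat_above_cut K κ₀
    obtain ⟨C, hC, hCL, hlow, hup⟩ := hbase q
    -- Upper bounds of `C` end by `q`, hence by `κ₀`, since no cut of `K` lies in between. Lower
    -- bounds of `D` start at `κ₀` or later, so every pair clashes.
    obtain ⟨E, hE, hEl⟩ := hD.resolve_upper (fun l hl hz => (hDl l hl hz).1)
      (C.filter fun l => 0 < l.coeff z) (C.filter fun l => l.coeff z < 0)
      (fun u hu => by
        simp only [List.mem_filter, decide_eq_true_eq] at hu
        exact ⟨hu.2, fun l hl hz => (hqK _ (hmemK C hCL u hu.1) (hup u hu.1 hu.2)).trans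
          (hDl l hl hz).2⟩) C hC
      (fun k hk hz => by
        rcases lt_or_gt_of_ne hz with h | h
        · right; simp [hk, h]
        · left; simp [hk, h])
    refine ⟨E, hE, fun l hl hne => ?_⟩
    have := hEl l hl hne
    simp only [List.mem_filter, decide_eq_true_eq] at this
    exact ⟨this.2, hq.trans_lt (hlow l this.1 this.2), hmemK C hCL l this.1⟩
  -- Induction on the number of cuts above `κ₀`. The least cut of the lower bounds in the new clause
  -- is the next `κ₀`, and it is strictly larger.
  have main : ∀ N : ℕ, ∀ (κ₀ : ℚ ×ₗ Bool) (D : Clause n), DerivesGood β L z D →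
      (∀ l ∈ D, l.coeff z ≠ 0 → 0 < l.coeff z ∧ κ₀ ≤ l.cut z β.val) →
      (K.toFinset.filter fun κ => κ₀ < κ).card ≤ N →
      ∃ C, Derives β L z C ∧ (∀ l ∈ C, l.coeff z = 0) ∧ Clause.FalseAt C β := by
    intro N
    induction N with
    | zero =>
      intro κ₀ D hD hDl hN
      obtain ⟨E, hE, hE'⟩ := next κ₀ D hD hDl
      have hz : ∀ l ∈ E, l.coeff z = 0 := by
        intro l hl
        by_contra hne
        rw [Nat.le_zero, Finset.card_eq_zero, Finset.filter_eq_empty_iff] at hN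
        exact hN (List.mem_toFinset.2 (hE' l hl hne).2.2) (hE' l hl hne).2.1
      exact ⟨E, hE.derives, hz, fun l hl => hE.good l hl (hz l hl)⟩
    | succ N ih =>
      intro κ₀ D hD hDl hN
      obtain ⟨E, hE, hE'⟩ := next κ₀ D hD hDl
      by_cases hz : ∀ l ∈ E, l.coeff z = 0
      · exact ⟨E, hE.derives, hz, fun l hl => hE.good l hl (hz l hl)⟩
      · push Not at hz
        obtain ⟨l₀, hl₀, hne₀⟩ := hz
        obtain ⟨l₁, hl₁, hmin⟩ := (E.toFinset.filter fun l => l.coeff z ≠ 0).exists_min_image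
          (fun l => l.cut z β.val) ⟨l₀, by simp [hl₀, hne₀]⟩
        simp only [Finset.mem_filter, List.mem_toFinset, and_imp] at hl₁ hmin
        refine ih (l₁.cut z β.val) E hE (fun l hl hne => ⟨(hE' l hl hne).1, hmin l hl hne⟩) ?_
        have h1 := hE' l₁ hl₁.1 hl₁.2
        refine Nat.le_of_lt_succ (lt_of_lt_of_le (Finset.card_lt_card ?_) hN)
        refine (Finset.ssubset_iff_of_subset ?_).2 ⟨l₁.cut z β.val, ?_, ?_⟩
        · intro κ hκ
          simp only [Finset.mem_filter] at hκ ⊢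
          exact ⟨hκ.1, h1.2.1.trans hκ.2⟩
        · simp [h1]
        · simp
  obtain ⟨q, hq⟩ := exists_rat_below_cuts K
  obtain ⟨C, hC, hCL, -, hup⟩ := hbase q
  have hnoup : ∀ l ∈ C, l.coeff z ≠ 0 → 0 < l.coeff z := by
    intro l hl hz
    rcases lt_or_gt_of_ne hz with h | h
    · exact absurd (hq _ (hmemK C hCL l hl)) (hup l hl h).not_gt
    · exact h
  by_cases hz : ∀ l ∈ C, l.coeff z = 0
  · exact ⟨C, hC.derives, hz, fun l hl => hC.good l hl (hz l hl)⟩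
  · push Not at hz
    obtain ⟨l₀, hl₀, hne₀⟩ := hz
    obtain ⟨l₁, hl₁, hmin⟩ := (C.toFinset.filter fun l => l.coeff z ≠ 0).exists_min_image
      (fun l => l.cut z β.val) ⟨l₀, by simp [hl₀, hne₀]⟩
    simp only [Finset.mem_filter, List.mem_toFinset, and_imp] at hl₁ hmin
    exact main _ (l₁.cut z β.val) C hC (fun l hl hne => ⟨hnoup l hl hne, hmin l hl hne⟩) le_rfl

end DeltaKsmt

/-! ### Soundness of the transitions, progress, and checkable transitions -/

namespace DeltaKsmt

variable {n : ℕ}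

/-! ### Precision, machines and boxes -/

/-- This is the form in which precision is used. The minimum with `1` costs nothing, as `2⁻ᵖ ≤ 1`
for every natural `p`. -/
theorem precise_iff {δ : ℚ} (hδ : 0 < δ) (p : ℕ) :
    Precise δ p ↔ (2⁻¹ : ℝ) ^ p ≤ (δ : ℝ) / 4 := by
  have hδ' : (0 : ℝ) < δ := by exact_mod_cast hδ
  have hm : (0 : ℝ) < min 1 ((δ : ℝ) / 4) := lt_min one_pos (by positivity)
  have h1 : (2⁻¹ : ℝ) ^ p ≤ 1 := pow_le_one₀ (by norm_num) (by norm_num)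
  have h2 : (2 : ℝ) ^ (((-(p : ℤ)) : ℤ) : ℝ) = 2⁻¹ ^ p := by
    rw [Real.rpow_intCast, zpow_neg, zpow_natCast, inv_pow]
  rw [Precise, neg_le, Int.le_floor, Real.le_logb_iff_rpow_le one_lt_two hm, h2, le_min_iff]
  exact ⟨fun h => h.2, fun h => ⟨h1, h⟩⟩

theorem ratData_injective : Function.Injective ratData := by
  intro q r h
  simp only [ratData, Prod.mk.injEq] at h
  refine Rat.ext ?_ h.2.2
  omega

theorem ratCode_injective : Function.Injective ratCode :=
  Encodable.encode_injective.comp ratData_injective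

theorem RelZero.mono {s : Bool} {t u : ℝ} (h : RelZero s t) (htu : t ≤ u) : RelZero s u := by
  cases s <;> simp only [RelZero] at * <;> simp at * <;> linarith

/-- A clause univariate in `x i` cannot distinguish `x` from the constant point with value `x i`. -/
theorem Formula.mem_D {F : Formula n} {x : Fin n → ℝ} (h : ∀ C ∈ F.lin, Clause.Holds C x) :
    x ∈ F.D := by
  intro i C hC hu
  obtain ⟨l, hl, hx⟩ := h C hC
  refine ⟨l, hl, (Lit.holds_congr fun j hj => ?_).1 hx⟩
  by_contra hne
  exact hj (hu.1 l hl j fun h => hne (by rw [h]))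

theorem Formula.mem_DP {F : Formula n} {x : Fin n → ℝ} (h : x ∈ F.D) (P : NLConstraint n) :
    (fun j => x (P.args j)) ∈ F.DP P := fun j => h (P.args j)

/-- The output of the machine on the constant name of a rational point in `D_F`. -/
theorem Formula.machine_output {F : Formula n} (hb : F.BoundedInstance) (hw : F.WellPresented)
    {P : NLConstraint n} (hP : P ∈ F.nl) {a : Fin n → ℚ} (ha : (fun i => (a i : ℝ)) ∈ F.D) (p : ℕ) :
    ∃ y ∈ P.fn (fun j => (a (P.args j) : ℝ)),
      (∃ q : ℚ, ratCode q ∈ P.machine.eval (nameOracle fun _ j => a (P.args j)) p) ∧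
      ∀ q : ℚ, ratCode q ∈ P.machine.eval (nameOracle fun _ j => a (P.args j)) p →
        |(q : ℝ) - y| ≤ 2⁻¹ ^ p := by
  obtain ⟨y, hy⟩ := Part.dom_iff_mem.1 (hb.2 P hP (subset_closure (F.mem_DP ha P)))
  have hname : IsName (fun j => (a (P.args j) : ℝ)) (fun _ j => a (P.args j)) := by
    intro m
    have : (fun j => (a (P.args j) : ℝ)) - (fun j => (a (P.args j) : ℝ)) = 0 := sub_self _
    rw [this, norm_zero]
    positivity
  obtain ⟨q, hq, hqy⟩ := (hw P hP).1 _ y hy _ hname p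
  refine ⟨y, hy, ⟨q, hq⟩, fun q' hq' => ?_⟩
  rwa [ratCode_injective (Part.mem_unique hq' hq)]

theorem boxClause_holds {P : NLConstraint n} {a : Fin n → ℚ} {ε : ℚ} {x : Fin n → ℝ} :
    Clause.Holds (boxClause P a ε) x ↔
      ∃ j, x (P.args j) ≤ a (P.args j) - ε ∨ a (P.args j) + ε ≤ x (P.args j) := by
  have h1 : ∀ (c : ℚ) (d : ℚ) (i : Fin n), Lit.Holds ⟨Pi.single i c, d, false⟩ x ↔
      0 ≤ (d : ℝ) + c * x i := by
    intro c d i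
    have : ∑ k, ((Pi.single i c : Fin n → ℚ) k : ℝ) * x k = c * x i := by
      rw [Finset.sum_eq_single i]
      · simp
      · intro k _ hk; simp [hk]
      · simp
    simp [Lit.Holds, RelZero, this]
  simp only [Clause.Holds, boxClause, List.mem_append, List.mem_ofFn]
  constructor
  · rintro ⟨l, ⟨j, rfl⟩ | ⟨j, rfl⟩, h⟩
    · rw [h1] at h; push_cast at h; exact ⟨j, Or.inl (by linarith)⟩
    · rw [h1] at h; push_cast at h; exact ⟨j, Or.inr (by linarith)⟩
  · rintro ⟨j, h | h⟩
    · exact ⟨_, Or.inl ⟨j, rfl⟩, by rw [h1]; push_cast; linarith⟩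
    · exact ⟨_, Or.inr ⟨j, rfl⟩, by rw [h1]; push_cast; linarith⟩

/-- A solution `x` inside the box would satisfy `f x ≤ f a + 2⁻ᵖ ≤ q + 2·2⁻ᵖ ≤ q + δ/2`, where `q`
is the output at `a`; then `f x ⋄ 0` contradicts the rejection of `q`. The modulus applies because
`x` and `a` both satisfy `F.lin` or at least lie in `D_F`. -/
theorem Linearise.box_sound {F : Formula n} (hb : F.BoundedInstance) (hw : F.WellPresented)
    {δ : ℚ} {p : ℕ} (hp : (2⁻¹ : ℝ) ^ p ≤ (δ : ℝ) / 4) {P : NLConstraint n} (hP : P ∈ F.nl)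
    {a : Fin n → ℚ} (ha : (fun i => (a i : ℝ)) ∈ F.D) {C : Clause n}
    (hC : Linearise δ p a P (some C)) {x : Fin n → ℝ} (hx : F.Sat x) : Clause.Holds C x := by
  cases hC with
  | box q hq hrel m hm =>
    by_contra hbox
    rw [boxClause_holds] at hbox
    push Not at hbox
    obtain ⟨y, hy, -, hqy⟩ := F.machine_output hb hw hP ha p
    obtain ⟨w, hwx, hwr⟩ := hx.2 P hP
    obtain ⟨μ, hμ, hmod⟩ := (hw P hP).2
    have hmμ : m = μ p := Part.mem_unique hm (hμ p)
    have hnorm : ‖(fun j => x (P.args j)) - (fun j => (a (P.args j) : ℝ))‖ ≤ 2⁻¹ ^ μ p := by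
      rw [pi_norm_le_iff_of_nonneg (by positivity)]
      intro j
      have := hbox j
      rw [hmμ] at this
      push_cast at this
      rw [Pi.sub_apply, Real.norm_eq_abs, abs_le]
      constructor <;> linarith [this.1, this.2]
    have h1 := hmod p _ (subset_closure (F.mem_DP (F.mem_D hx.1) P)) _
      (subset_closure (F.mem_DP ha P)) hnorm w hwx y hy
    have h2 := hqy q hq
    rw [abs_le] at h1 h2
    exact hrel (hwr.mono (by linarith [h1.2, h2.1]))

theorem NlinLoop.exists_of_some {δ : ℚ} {p : ℕ} {a : Fin n → ℚ} {N : List (NLConstraint n)}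
    {r : Option (Clause n)} (h : NlinLoop δ p a N r) {C : Clause n} (hr : r = some C) :
    ∃ P ∈ N, Linearise δ p a P (some C) := by
  induction h with
  | done => simp at hr
  | found P N C' h => cases hr; exact ⟨P, by simp, h⟩
  | next P N r _ _ ih =>
    obtain ⟨Q, hQ, h⟩ := ih hr
    exact ⟨Q, by simp [hQ], h⟩

theorem NlinLoop.forall_of_none {δ : ℚ} {p : ℕ} {a : Fin n → ℚ} {N : List (NLConstraint n)}
    {r : Option (Clause n)} (h : NlinLoop δ p a N r) (hr : r = none) :
    ∀ P ∈ N, Linearise δ p a P none := by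
  induction h with
  | done => simp
  | found P N C' h => cases hr
  | next P N r h _ ih =>
    intro Q hQ
    rcases List.mem_cons.1 hQ with rfl | hQ
    · exact h
    · exact ih hr Q hQ

/-- The domain condition of bounded instances enters here: at points of `D_F` every machine and
every modulus program halts, so the loop has a result. -/
theorem Formula.exists_nlinLoop {F : Formula n} (hb : F.BoundedInstance) (hw : F.WellPresented)
    (δ : ℚ) (p : ℕ) {a : Fin n → ℚ} (ha : (fun i => (a i : ℝ)) ∈ F.D) (N : List (NLConstraint n))
    (hN : ∀ P ∈ N, P ∈ F.nl) : ∃ r, NlinLoop δ p a N r := by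
  induction N with
  | nil => exact ⟨none, .done⟩
  | cons P N ih =>
    obtain ⟨r, hr⟩ := ih fun Q hQ => hN Q (List.mem_cons_of_mem _ hQ)
    have hP := hN P (by simp)
    obtain ⟨-, -, ⟨q, hq⟩, -⟩ := F.machine_output hb hw hP ha p
    obtain ⟨μ, hμ, -⟩ := (hw P hP).2
    by_cases hrel : RelZero P.strict ((q : ℝ) + δ / 2)
    · exact ⟨r, .next P N r (.accept q hq hrel) hr⟩
    · exact ⟨_, .found P N _ (.box q hq hrel _ (hμ p))⟩

/-! ### Invariants of runs -/

/-- The assigned variables form an initial segment of the order. -/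
def Trail.DownClosed (π : Equiv.Perm (Fin n)) (α : Trail n) : Prop :=
  ∀ i j, (α.asg i).isSome → π.symm j < π.symm i → (α.asg j).isSome

/-- The properties of the trail and of the linear part of every reachable state. -/
structure RunInv (F : Formula n) (π : Equiv.Perm (Fin n)) (α : Trail n) (L : List (Clause n)) :
    Prop where
  sub : ∀ C ∈ F.lin, C ∈ L
  sound : ∀ x, F.Sat x → ∀ C ∈ L, Clause.Holds C x
  down : ∀ γ : Trail n, γ <+: α → Trail.DownClosed π γ
  nodup : (α.map Prod.fst).Nodup

theorem Trail.asg_isSome_iff (α : Trail n) (i : Fin n) :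
    (α.asg i).isSome ↔ i ∈ α.map Prod.fst := by
  induction α with
  | nil => simp [Trail.asg]
  | cons e α ih =>
    obtain ⟨k, q⟩ := e
    by_cases h : i = k
    · subst h; simp [Trail.asg]
    · have h' : (i == k) = false := by simpa using h
      have : Trail.asg ((k, q) :: α) i = Trail.asg α i := by simp [Trail.asg, List.lookup, h']
      rw [this, ih]
      simp [h]

theorem RunInv.init (F : Formula n) (π : Equiv.Perm (Fin n)) : RunInv F π [] F.lin where
  sub _ h := h
  sound _ hx := hx.1
  down γ hγ := by
    rw [List.prefix_nil.1 hγ]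
    intro i j hi
    simp [Trail.asg] at hi
  nodup := by simp

theorem RunInv.mem_D {F : Formula n} {π : Equiv.Perm (Fin n)} {α : Trail n} {L : List (Clause n)}
    (h : RunInv F π α L) (hL : LinTrue L α.asg) : (fun i => (α.asg.val i : ℝ)) ∈ F.D :=
  F.mem_D fun C hC => hL.holds C (h.sub C hC)

theorem RunInv.length_le {F : Formula n} {π : Equiv.Perm (Fin n)} {α : Trail n}
    {L : List (Clause n)} (h : RunInv F π α L) : α.length ≤ n := by
  simpa using h.nodup.length_le_card

/-- The invariant of states. -/
def StateInv (F : Formula n) (π : Equiv.Perm (Fin n)) (δ : ℚ) : State n → Prop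
  | .run α L => RunInv F π α L
  | s => F.CorrectAnswer δ s

/-- The clause that excludes exactly the values that `a` gives to the arguments of `P`. -/
def pointClause (P : NLConstraint n) (a : Fin n → ℚ) : Clause n :=
  (List.ofFn fun j => (⟨Pi.single (P.args j) (-1), a (P.args j), true⟩ : Lit n)) ++
    List.ofFn fun j => (⟨Pi.single (P.args j) 1, -(a (P.args j)), true⟩ : Lit n)

/-- The truth value of `P` depends only on its arguments, so an assignment making `P` true differs
from `β` in one of them. Hence the rule `sat` is blocked by any false constraint. -/
theorem isLinearisation_pointClause {P : NLConstraint n} {β : Asg n} (h : P.FalseAt β) :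
    IsLinearisation P β (pointClause P β.val) := by
  have h1 : ∀ (γ : Asg n) (c : ℚ) (d : ℚ) (i : Fin n),
      Lit.Holds ⟨Pi.single i c, d, true⟩ (fun k => (γ.val k : ℝ)) ↔ 0 < d + c * γ.val i := by
    intro γ c d i
    have : ∑ k, (Pi.single i c : Fin n → ℚ) k * γ.val k = c * γ.val i := by
      rw [Finset.sum_eq_single i]
      · simp
      · intro k _ hk; simp [hk]
      · simp
    rw [Lit.holds_cast]
    simp [RelZeroQ, Lit.evalQ, this]
  have h2 : ∀ (γ : Asg n) (c : ℚ) (d : ℚ) (j : Fin P.arity), (γ (P.args j)).isSome →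
      Lit.Assigned ⟨Pi.single (P.args j) c, d, true⟩ γ := by
    intro γ c d j hj i hi
    by_cases hij : i = P.args j
    · rwa [hij]
    · simp [hij] at hi
  constructor
  · intro γ hγ
    have : ∃ j, γ.val (P.args j) ≠ β.val (P.args j) := by
      by_contra hne
      push Not at hne
      obtain ⟨-, y, hy, hys⟩ := hγ
      obtain ⟨-, w, hw, hws⟩ := h
      simp only [hne] at hy
      exact hws (Part.mem_unique hy hw ▸ hys)
    obtain ⟨j, hj⟩ := this
    rcases lt_or_gt_of_ne hj with hj | hj
    · refine ⟨⟨Pi.single (P.args j) (-1), β.val (P.args j), true⟩, ?_, h2 γ _ _ j (hγ.1 j), ?_⟩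
      · simp only [pointClause, List.mem_append, List.mem_ofFn]
        exact Or.inl ⟨j, rfl⟩
      · rw [h1]; linarith
    · refine ⟨⟨Pi.single (P.args j) 1, -β.val (P.args j), true⟩, ?_, h2 γ _ _ j (hγ.1 j), ?_⟩
      · simp only [pointClause, List.mem_append, List.mem_ofFn]
        exact Or.inr ⟨j, rfl⟩
      · rw [h1]; linarith
  · intro l hl
    simp only [pointClause, List.mem_append, List.mem_ofFn] at hl
    rcases hl with ⟨j, rfl⟩ | ⟨j, rfl⟩
    · exact ⟨h2 β _ _ j (h.1 j), by rw [h1]; linarith⟩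
    · exact ⟨h2 β _ _ j (h.1 j), by rw [h1]; linarith⟩

section
variable {F : Formula n} {π : Equiv.Perm (Fin n)} {δ : ℚ} {p : ℕ}

/-- For final states the invariant is correctness of the answer, so its preservation contains the
whole soundness argument. -/
theorem StateInv.step (hδ : 0 < δ) (hp : Precise δ p) (hb : F.BoundedInstance)
    (hw : F.WellPresented) {s s' : State n} (hs : StateInv F π δ s) (h : Step F π δ p s s') :
    StateInv F π δ s' := by
  have hδ' : (0 : ℝ) < δ := by exact_mod_cast hδ
  rw [precise_iff hδ] at hp
  cases h with
  | assign α L z q hL hz hq =>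
    have hs : RunInv F π α L := hs
    refine ⟨hs.sub, hs.sound, fun γ hγ => ?_, ?_⟩
    · rcases List.prefix_concat_iff.1 hγ with rfl | hγ
      · intro i j hi hij
        rw [Trail.asg_concat _ _ _ hz.1] at hi ⊢
        by_cases hjz : j = z
        · simp [hjz]
        · simp only [Function.update_of_ne hjz]
          by_cases hiz : i = z
          · exact hz.2 j (hiz ▸ hij)
          · simp only [Function.update_of_ne hiz] at hi
            exact hs.down α (List.prefix_refl _) i j hi hij
      · exact hs.down γ hγ
    · have : z ∉ α.map Prod.fst := by
        rw [← Trail.asg_isSome_iff, hz.1]; simp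
      rw [List.map_append, List.nodup_append]
      refine ⟨hs.nodup, by simp, ?_⟩
      rintro a ha b hb rfl
      simp only [List.map_cons, List.map_nil, List.mem_singleton] at hb
      exact this (hb ▸ ha)
  | resolve α L z R hL hz hq hR =>
    have hs : RunInv F π α L := hs
    refine ⟨fun C hC => List.mem_append_right _ (hs.sub C hC), fun x hx C hC => ?_, hs.down,
      hs.nodup⟩
    rcases List.mem_append.1 hC with hC | hC
    · exact (hR.2 C hC).1.holds fun C hC _ => hs.sound x hx C hC
    · exact hs.sound x hx C hC
  -- Down-closedness is required of all prefixes in `RunInv` precisely so that it survives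
  -- backjumping.
  | backjump α γ L hL hpre hγ hmax =>
    have hs : RunInv F π α L := hs
    exact ⟨hs.sub, hs.sound, fun γ' h => hs.down γ' (h.trans hpre),
      hs.nodup.sublist (hpre.sublist.map _)⟩
  | linearise α L C hα hL hC =>
    have hs : RunInv F π α L := hs
    refine ⟨fun C hC => List.mem_cons_of_mem _ (hs.sub C hC), fun x hx C' hC' => ?_, hs.down,
      hs.nodup⟩
    rcases List.mem_cons.1 hC' with rfl | hC'
    · obtain ⟨P, hP, hlin⟩ := hC.exists_of_some rfl
      exact hlin.box_sound hb hw hp hP (hs.mem_D hL) hx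
    · exact hs.sound x hx C' hC'
  | deltaSat α L hα hL hN =>
    have hs : RunInv F π α L := hs
    refine ⟨α.asg.val, fun C hC => hL.holds C (hs.sub C hC), fun P hP => ?_⟩
    have := hN.forall_of_none rfl P hP
    obtain ⟨y, hy, -, hqy⟩ := F.machine_output hb hw hP (hs.mem_D hL) p
    refine ⟨y, hy, ?_⟩
    cases this with
    | accept q hq hrel =>
      have := hqy q hq
      rw [abs_le] at this
      -- The true value is at least `q - δ/4`, so adding `δ` gives more than `q + δ/2`.
      exact hrel.mono (by linarith [this.2])
  | sat α L hα hL hN =>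
    have hs : RunInv F π α L := hs
    have hsat : ∀ P ∈ F.nl, P.Holds (fun i => (α.asg.val i : ℝ)) := by
      intro P hP
      obtain ⟨y, hy, -⟩ := F.machine_output hb hw hP (hs.mem_D hL) p
      refine ⟨y, hy, ?_⟩
      by_contra hrel
      have hf : P.FalseAt α.asg := ⟨fun j => hα _, y, hy, hrel⟩
      exact hN ⟨P, hP, hf, _, isLinearisation_pointClause hf⟩
    have hlin := fun C hC => hL.holds C (hs.sub C hC)
    refine ⟨α.asg.val, ⟨hlin, hsat⟩, hlin, fun P hP => ?_⟩
    obtain ⟨y, hy, hr⟩ := hsat P hP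
    exact ⟨y, hy, hr.mono (by linarith)⟩
  | unsat α L hL =>
    have hs : RunInv F π α L := hs
    intro x hx
    obtain ⟨C, hC, hf⟩ := hL
    obtain ⟨l, hl, hh⟩ := hs.sound x hx C hC
    -- A literal that is false under the empty assignment contains no variable, so its truth value
    -- is the same at every point.
    refine (hf l hl).2 ((Lit.holds_congr fun i hi => ?_).1 hh)
    have := (hf l hl).1 i hi
    simp [Trail.asg] at this

/-! ### Effective steps -/

/-- The transitions except for the rule `sat`, with resolvents that consist of one clause and
without the premises that cannot be checked directly. -/
inductive EffStep (F : Formula n) (π : Equiv.Perm (Fin n)) (δ : ℚ) (p : ℕ) :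
    State n → State n → Prop
  | assign (α : Trail n) (L : List (Clause n)) (z : Fin n) (q : ℚ)
      (hL : ¬ LinFalse L α.asg) (hz : IsNext π α z)
      (hq : ¬ LinFalse L (Trail.asg (α ++ [(z, q)]))) :
      EffStep F π δ p (.run α L) (.run (α ++ [(z, q)]) L)
  | resolve (α : Trail n) (L : List (Clause n)) (z : Fin n) (C : Clause n)
      (hL : ¬ LinFalse L α.asg) (hz : α.asg z = none) (hC : Derives α.asg L z C)
      (hCz : ∀ l ∈ C, l.coeff z = 0) (hCf : Clause.FalseAt C α.asg) :
      EffStep F π δ p (.run α L) (.run α (C :: L))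
  | backjump (α : Trail n) (L : List (Clause n)) (k : ℕ)
      (hL : LinFalse L α.asg) (hγ : ¬ LinFalse L (Trail.asg (α.take k)))
      (hmax : ∀ j ≤ α.length, k < j → LinFalse L (Trail.asg (α.take j))) :
      EffStep F π δ p (.run α L) (.run (α.take k) L)
  | linearise (α : Trail n) (L : List (Clause n)) (C : Clause n)
      (hα : α.asg.Total) (hL : ¬ LinFalse L α.asg)
      (hC : NlinLoop δ p α.asg.val F.nl (some C)) :
      EffStep F π δ p (.run α L) (.run α (C :: L))
  | deltaSat (α : Trail n) (L : List (Clause n))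
      (hα : α.asg.Total) (hL : ¬ LinFalse L α.asg)
      (hN : NlinLoop δ p α.asg.val F.nl none) :
      EffStep F π δ p (.run α L) .deltaSat
  | unsat (α : Trail n) (L : List (Clause n))
      (hL : LinFalse L (Trail.asg [])) :
      EffStep F π δ p (.run α L) .unsat

/-- This replaces the infinitary premise of the rule `resolve`. If `L` were not false at `z ↦ q`,
then all clauses admitted to the derivation would be true there, since their variables are assigned;
soundness would make the false clause `C` true. -/
theorem linFalse_update_of_derives {β : Asg n} {L : List (Clause n)} {z : Fin n} {C : Clause n}
    (hz : β z = none) (hC : Derives β L z C) (hCf : Clause.FalseAt C β) (q : ℚ) :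
    LinFalse L (Function.update β z (some q)) := by
  set γ := Function.update β z (some q) with hγ
  by_contra hL
  have : Clause.Holds C (fun i => (Asg.val γ i : ℝ)) := by
    refine hC.holds fun B hB hv => ?_
    by_contra hBf
    refine hL ⟨B, hB, fun l hl => ⟨fun i hi => ?_, fun hh => hBf ⟨l, hl, hh⟩⟩⟩
    rcases hv l hl i hi with rfl | h
    · simp [hγ]
    · by_cases hiz : i = z
      · simp [hγ, hiz]
      · simpa [hγ, hiz] using h
  obtain ⟨l, hl, hh⟩ := this
  exact ((hCf l hl).mono (Asg.le_update hz q)).2 hh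

theorem EffStep.step {s s' : State n} (h : EffStep F π δ p s s') : Step F π δ p s s' := by
  cases h with
  | assign α L z q hL hz hq => exact .assign α L z q hL hz hq
  | resolve α L z C hL hz hC hCz hCf =>
    refine .resolve α L z [C] hL hz (fun q => ?_) ⟨by simp, by simpa using ⟨hC, hCz, hCf⟩⟩
    rw [Trail.asg_concat _ _ _ hz]
    exact linFalse_update_of_derives hz hC hCf q
  | backjump α L k hL hγ hmax =>
    refine .backjump α _ L hL (List.take_prefix _ _) hγ fun γ' hpre hγ' => ?_
    rw [List.prefix_iff_eq_take] at hpre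
    by_cases hk : γ'.length ≤ k
    · rw [hpre]; exact List.take_prefix_take_left hk
    · refine absurd (hmax γ'.length ?_ (not_le.1 hk)) (hpre ▸ hγ')
      rw [hpre]; simp
  | linearise α L C hα hL hC => exact .linearise α L C hα ((linTrue_iff hα).2 hL) hC
  | deltaSat α L hα hL hN => exact .deltaSat α L hα ((linTrue_iff hα).2 hL) hN
  | unsat α L hL => exact .unsat α L hL

/-- Progress already holds within the checkable transitions. It serves both to exclude stuck
non-final states and to construct the run found by the algorithm. -/
theorem RunInv.exists_effStep (hb : F.BoundedInstance) (hw : F.WellPresented) {α : Trail n}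
    {L : List (Clause n)} (h : RunInv F π α L) : ∃ s, EffStep F π δ p (.run α L) s := by
  classical
  by_cases hL : LinFalse L α.asg
  · by_cases h0 : LinFalse L (Trail.asg [])
    · exact ⟨_, .unsat α L h0⟩
    · let P : ℕ → Prop := fun k => ¬ LinFalse L (Trail.asg (α.take k))
      have hP0 : P 0 := by simpa [P] using h0
      refine ⟨_, .backjump α L (Nat.findGreatest P α.length) hL
        (Nat.findGreatest_spec (Nat.zero_le _) hP0) fun j hj hlt => ?_⟩
      by_contra hn
      exact absurd (Nat.le_findGreatest (P := P) hj hn) (not_le.2 hlt)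
  · by_cases hα : α.asg.Total
    · obtain ⟨r, hr⟩ := F.exists_nlinLoop hb hw δ p (h.mem_D ((linTrue_iff hα).2 hL)) F.nl
        fun _ h => h
      cases r with
      | none => exact ⟨_, .deltaSat α L hα hL hr⟩
      | some C => exact ⟨_, .linearise α L C hα hL hr⟩
    · have : ∃ z, IsNext π α z := by
        unfold Asg.Total at hα
        push Not at hα
        obtain ⟨i, hi⟩ := hα
        obtain ⟨z, hz, hmin⟩ := (Finset.univ.filter fun i => α.asg i = none).exists_min_image
          π.symm ⟨i, by simpa using hi⟩
        simp only [Finset.mem_filter, Finset.mem_univ, true_and] at hz hmin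
        refine ⟨z, hz, fun j hj => ?_⟩
        by_contra hn
        exact absurd (hmin j (by simpa using hn)) (not_le.2 hj)
      obtain ⟨z, hz⟩ := this
      by_cases hq : ∃ q : ℚ, ¬ LinFalse L (Trail.asg (α ++ [(z, q)]))
      · obtain ⟨q, hq⟩ := hq
        exact ⟨_, .assign α L z q hL hz hq⟩
      · push Not at hq
        simp only [Trail.asg_concat _ _ _ hz.1] at hq
        obtain ⟨C, hC, hCz, hCf⟩ := exists_derives_false hq
        exact ⟨_, .resolve α L z C hL hz.1 hC hCz hCf⟩

theorem StateInv.of_reachable (hδ : 0 < δ) (hp : Precise δ p) (hb : F.BoundedInstance)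
    (hw : F.WellPresented) {s : State n}
    (h : Relation.ReflTransGen (Step F π δ p) F.init s) : StateInv F π δ s := by
  induction h with
  | refl => exact RunInv.init F π
  | tail _ h ih => exact ih.step hδ hp hb hw h

theorem correctAnswer_of_terminal (hδ : 0 < δ) (hp : Precise δ p) (hb : F.BoundedInstance)
    (hw : F.WellPresented) {s : State n}
    (h : Relation.ReflTransGen (Step F π δ p) F.init s) (hs : ∀ s', ¬ Step F π δ p s s') :
    F.CorrectAnswer δ s := by
  have hinv := StateInv.of_reachable hδ hp hb hw h
  cases s with
  | run α L =>
    have hinv : RunInv F π α L := hinv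
    obtain ⟨s', h'⟩ := hinv.exists_effStep (δ := δ) (p := p) hb hw
    exact absurd h'.step (hs s')
  | unsat => exact hinv
  | deltaSat => exact hinv
  | sat => exact hinv

end

end DeltaKsmt

namespace DeltaKsmt

variable {n : ℕ}

/-! ### Termination -/

/-- One plus the largest position in the order of a variable of the literal. -/
def Lit.top (π : Equiv.Perm (Fin n)) (l : Lit n) : ℕ :=
  (Finset.univ.filter fun i => l.coeff i ≠ 0).sup fun i => (π.symm i : ℕ) + 1

theorem Lit.top_le_iff {π : Equiv.Perm (Fin n)} {l : Lit n} {t : ℕ} :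
    l.top π ≤ t ↔ ∀ i, l.coeff i ≠ 0 → (π.symm i : ℕ) < t := by
  simp [Lit.top, Finset.sup_le_iff]

/-- The literals obtained from `Λ` by at most `k` rounds of eliminations. -/
def elimClosure (Λ : Set (Lit n)) : ℕ → Set (Lit n)
  | 0 => Λ
  | k + 1 => elimClosure Λ k ∪
      ⋃ z : Fin n, Set.image2 (Lit.elim z) (elimClosure Λ k) (elimClosure Λ k)

theorem elimClosure_finite {Λ : Set (Lit n)} (h : Λ.Finite) (k : ℕ) : (elimClosure Λ k).Finite := by
  induction k with
  | zero => exact h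
  | succ k ih => exact ih.union (Set.finite_iUnion fun z => ih.image2 _ ih)

theorem elimClosure_mono (Λ : Set (Lit n)) : Monotone (elimClosure Λ) :=
  monotone_nat_of_le_succ fun _ => Set.subset_union_left

/-- The literals that can occur after a state with literals `Λ` if no box is excluded. -/
def GenLit (π : Equiv.Perm (Fin n)) (Λ : Set (Lit n)) (l : Lit n) : Prop :=
  l ∈ elimClosure Λ (n - l.top π)

/-- Since `z` is the last variable of both literals, elimination lowers `Lit.top`. The budget `n -
l.top π` of rounds thus grows by at least the one round that is spent. -/
theorem GenLit.elim {π : Equiv.Perm (Fin n)} {Λ : Set (Lit n)} {z : Fin n} {l₁ l₂ : Lit n}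
    (h₁ : GenLit π Λ l₁) (h₂ : GenLit π Λ l₂) (hz₁ : l₁.coeff z ≠ 0) (hz₂ : l₂.coeff z ≠ 0)
    (hv₁ : ∀ i, l₁.coeff i ≠ 0 → π.symm i ≤ π.symm z)
    (hv₂ : ∀ i, l₂.coeff i ≠ 0 → π.symm i ≤ π.symm z) : GenLit π Λ (l₁.elim z l₂) := by
  have ht : ∀ l : Lit n, l.coeff z ≠ 0 → (∀ i, l.coeff i ≠ 0 → π.symm i ≤ π.symm z) →
      l.top π = (π.symm z : ℕ) + 1 := by
    intro l hz hv
    apply le_antisymm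
    · exact Lit.top_le_iff.2 fun i hi => Nat.lt_succ_of_le (hv i hi)
    · exact Lit.top_le_iff.1 le_rfl z hz
  have hte : (l₁.elim z l₂).top π ≤ (π.symm z : ℕ) := by
    refine Lit.top_le_iff.2 fun i hi => ?_
    have hne : i ≠ z := by rintro rfl; exact hi (Lit.elim_coeff_self _ _ _)
    have hle : π.symm i ≤ π.symm z := by
      by_cases h : l₁.coeff i = 0
      · refine hv₂ i fun h' => hi ?_
        simp [Lit.elim, h, h']
      · exact hv₁ i h
    exact lt_of_le_of_ne hle fun h => hne (π.symm.injective (Fin.ext h))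
  unfold GenLit at h₁ h₂ ⊢
  rw [ht l₁ hz₁ hv₁] at h₁
  rw [ht l₂ hz₂ hv₂] at h₂
  refine elimClosure_mono Λ (?_ : n - ((π.symm z : ℕ) + 1) + 1 ≤ _)
    (Or.inr (Set.mem_iUnion.2 ⟨z, Set.mem_image2_of_mem h₁ h₂⟩))
  have := (π.symm z).2
  omega

/-- A literal produced by elimination no longer contains `z` and is never resolved upon again. So a
derivation on `z` of any length combines each literal at most once. -/
theorem Derives.lit {α : Asg n} {L : List (Clause n)} {z : Fin n} {C : Clause n}
    (h : Derives α L z C) (Q : Lit n → Prop)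
    (hQ : ∀ C ∈ L, ∀ l ∈ C, (∀ i, l.coeff i ≠ 0 → i = z ∨ (α i).isSome) → Q l) :
    ∀ l ∈ C, (Q l ∧ ∀ i, l.coeff i ≠ 0 → i = z ∨ (α i).isSome) ∨
      ∃ l₁ l₂ : Lit n, l = l₁.elim z l₂ ∧ Q l₁ ∧ Q l₂ ∧ l₁.coeff z ≠ 0 ∧ l₂.coeff z ≠ 0 ∧
        (∀ i, l₁.coeff i ≠ 0 → i = z ∨ (α i).isSome) ∧
        (∀ i, l₂.coeff i ≠ 0 → i = z ∨ (α i).isSome) := by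
  induction h with
  | base C hC hv => exact fun l hl => Or.inl ⟨hQ C hC l hl (hv l hl), hv l hl⟩
  | resolve C₁ C₂ l₁ l₂ _ _ hl₁ hl₂ hpos hneg ih₁ ih₂ =>
    intro l hl
    simp only [List.mem_append, List.mem_filter, List.mem_singleton] at hl
    rcases hl with (hl | hl) | rfl
    · exact ih₁ l hl.1
    · exact ih₂ l hl.1
    · have a₁ := (ih₁ l₁ hl₁).resolve_right (by
        rintro ⟨k₁, k₂, rfl, -⟩
        exact hpos.ne' (Lit.elim_coeff_self _ _ _))
      have a₂ := (ih₂ l₂ hl₂).resolve_right (by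
        rintro ⟨k₁, k₂, rfl, -⟩
        exact hneg.ne (Lit.elim_coeff_self _ _ _))
      exact Or.inr ⟨l₁, l₂, rfl, a₁.1, a₂.1, hpos.ne', hneg.ne, a₁.2, a₂.2⟩

/-- All literals of `L` can occur after a state with literals `Λ`. -/
def GenClauses (π : Equiv.Perm (Fin n)) (Λ : Set (Lit n)) (L : List (Clause n)) : Prop :=
  ∀ C ∈ L, ∀ l ∈ C, GenLit π Λ l

/-- The clauses of `L` as sets of literals. -/
def clauseSets (L : List (Clause n)) : Finset (Finset (Lit n)) := (L.map List.toFinset).toFinset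

open Classical in
/-- A measure that decreases in all steps that do not exclude a box, if `N` bounds the number of
sets of literals that can occur. -/
noncomputable def linMeasure (N : ℕ) (α : Trail n) (L : List (Clause n)) : ℕ :=
  (N - (clauseSets L).card) * (2 * n + 2) + (if LinFalse L α.asg then n + 1 else 0) +
    (n - α.length)

/-- The step excludes a box. -/
def IsBoxStep (F : Formula n) (δ : ℚ) (p : ℕ) (α : Trail n) (L L' : List (Clause n)) : Prop :=
  LinTrue L α.asg ∧ ∃ C, L' = C :: L ∧ NlinLoop δ p α.asg.val F.nl (some C)

section
variable {F : Formula n} {π : Equiv.Perm (Fin n)} {δ : ℚ} {p : ℕ}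

theorem Step.subset {α α' : Trail n} {L L' : List (Clause n)}
    (h : Step F π δ p (.run α L) (.run α' L')) : ∀ C ∈ L, C ∈ L' := by
  cases h with
  | assign => exact fun _ h => h
  | resolve => exact fun _ h => List.mem_append_right _ h
  | backjump => exact fun _ h => h
  | linearise => exact fun _ h => List.mem_cons_of_mem _ h

theorem Step.genClauses {α α' : Trail n} {L L' : List (Clause n)} {Λ : Set (Lit n)}
    (h : Step F π δ p (.run α L) (.run α' L')) (hinv : RunInv F π α L)
    (hbox : ¬ IsBoxStep F δ p α L L') (hΛ : GenClauses π Λ L) : GenClauses π Λ L' := by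
  cases h with
  | assign => exact hΛ
  | backjump => exact hΛ
  | linearise _ _ C hα hL hC => exact absurd ⟨hL, C, rfl, hC⟩ hbox
  | resolve _ _ z R hL hz hq hR =>
    -- An assigned variable after the unassigned `z` would contradict that the assigned variables
    -- form an initial segment.
    have hle : ∀ i, i = z ∨ (α.asg i).isSome → π.symm i ≤ π.symm z := by
      rintro i (rfl | hi)
      · exact le_rfl
      · by_contra hlt
        have := hinv.down α (List.prefix_refl _) i z hi (not_le.1 hlt)
        simp [hz] at this
    intro C hC l hl
    rcases List.mem_append.1 hC with hC | hC
    · rcases (hR.2 C hC).1.lit (GenLit π Λ) (fun C hC l hl _ => hΛ C hC l hl) l hl with h | h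
      · exact h.1
      · obtain ⟨l₁, l₂, rfl, h₁, h₂, hz₁, hz₂, hv₁, hv₂⟩ := h
        exact h₁.elim h₂ hz₁ hz₂ (fun i hi => hle i (hv₁ i hi)) fun i hi => hle i (hv₂ i hi)
    · exact hΛ C hC l hl

/-- Assigning lengthens the trail. Backjumping clears the falsity term `n + 1`, which outweighs the
at most `n` entries dropped. A resolvent adds a new set of literals, worth `2 * n + 2`, more than
the falsity term it may create. -/
theorem Step.linMeasure_lt {α α' : Trail n} {L L' : List (Clause n)}
    (h : Step F π δ p (.run α L) (.run α' L')) (hinv : RunInv F π α L)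
    (hinv' : RunInv F π α' L') (hbox : ¬ IsBoxStep F δ p α L L') {N : ℕ}
    (hN : (clauseSets L').card ≤ N) : linMeasure N α' L' < linMeasure N α L := by
  have hlen := hinv.length_le
  have hlen' := hinv'.length_le
  unfold linMeasure
  cases h with
  | assign _ _ z q hL hz hq =>
    rw [if_neg hL, if_neg hq]
    simp only [List.length_append, List.length_singleton] at hlen' ⊢
    omega
  | backjump _ _ _ hL hpre hγ hmax =>
    rw [if_pos hL, if_neg hγ]
    omega
  | linearise _ _ C hα hL hC => exact absurd ⟨hL, C, rfl, hC⟩ hbox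
  | resolve _ _ z R hL hz hq hR =>
    have hlt : (clauseSets L).card < (clauseSets (R ++ L)).card := by
      obtain ⟨C, hC⟩ := List.exists_mem_of_ne_nil R hR.1
      refine Finset.card_lt_card ((Finset.ssubset_iff_of_subset ?_).2 ⟨C.toFinset, ?_, ?_⟩)
      · intro S hS
        simp only [clauseSets, List.mem_toFinset, List.mem_map, List.mem_append] at hS ⊢
        obtain ⟨B, hB, rfl⟩ := hS
        exact ⟨B, Or.inr hB, rfl⟩
      · simp only [clauseSets, List.mem_toFinset, List.mem_map, List.mem_append]
        exact ⟨C, Or.inl hC, rfl⟩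
      · simp only [clauseSets, List.mem_toFinset, List.mem_map]
        rintro ⟨B, hB, hBC⟩
        -- An old clause with the same literals as the resolvent would be false under the trail, but
        -- `L` is not.
        refine hL ⟨B, hB, fun l hl => (hR.2 C hC).2.2 l ?_⟩
        rw [← List.mem_toFinset, ← hBC, List.mem_toFinset]
        exact hl
    rw [if_neg hL]
    have h1 : N - (clauseSets (R ++ L)).card + 1 ≤ N - (clauseSets L).card := by omega
    have h2 := Nat.mul_le_mul_right (2 * n + 2) h1
    rw [add_mul, one_mul] at h2
    split_ifs <;> omega

/-- A run that never ends excludes boxes infinitely often. -/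
theorem frequently_isBoxStep {α : ℕ → Trail n} {L : ℕ → List (Clause n)}
    (hinv : ∀ i, RunInv F π (α i) (L i))
    (hstep : ∀ i, Step F π δ p (.run (α i) (L i)) (.run (α (i + 1)) (L (i + 1)))) :
    ∃ᶠ i in Filter.atTop, IsBoxStep F δ p (α i) (L i) (L (i + 1)) := by
  intro hev
  obtain ⟨N, hN⟩ := Filter.eventually_atTop.1 hev
  -- From stage `N` on no box is excluded, so all later literals come from the finite set
  -- `elimClosure Λ n`. This bounds the number of clauses as sets, and the measure would decrease
  -- forever.
  set Λ : Set (Lit n) := {l | l ∈ (L N).flatten} with hΛ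
  have hfin : (elimClosure Λ n).Finite := elimClosure_finite (List.finite_toSet _) n
  have hgen : ∀ k, GenClauses π Λ (L (N + k)) := by
    intro k
    induction k with
    | zero =>
      intro C hC l hl
      exact elimClosure_mono Λ (Nat.zero_le _) (List.mem_flatten.2 ⟨C, hC, hl⟩)
    | succ k ih => exact (hstep (N + k)).genClauses (hinv _) (hN _ (by omega)) ih
  set B := hfin.toFinset.powerset.card with hB
  have hcard : ∀ k, (clauseSets (L (N + k))).card ≤ B := by
    intro k
    refine Finset.card_le_card fun S hS => ?_
    simp only [clauseSets, List.mem_toFinset, List.mem_map] at hS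
    obtain ⟨C, hC, rfl⟩ := hS
    rw [Finset.mem_powerset]
    intro l hl
    rw [Set.Finite.mem_toFinset]
    exact elimClosure_mono Λ (Nat.sub_le _ _) (hgen k C hC l (List.mem_toFinset.1 hl))
  have hdec : ∀ k, linMeasure B (α (N + k)) (L (N + k)) + k ≤ linMeasure B (α N) (L N) := by
    intro k
    induction k with
    | zero => simp
    | succ k ih =>
      have := (hstep (N + k)).linMeasure_lt (hinv _) (hinv _) (hN _ (by omega)) (hcard (k + 1))
      rw [← add_assoc N k 1]
      omega
  have := hdec (linMeasure B (α N) (L N) + 1)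
  omega

/-- With finitely many constraints and fixed `p`, the radii of all excluded boxes have a common
positive lower bound. -/
theorem exists_modulus_bound (hw : F.WellPresented) (p : ℕ) :
    ∃ M : ℕ, ∀ P ∈ F.nl, ∀ m ∈ P.modulus.eval p, m ≤ M := by
  have : ∀ N : List (NLConstraint n), (∀ P ∈ N, P ∈ F.nl) →
      ∃ M : ℕ, ∀ P ∈ N, ∀ m ∈ P.modulus.eval p, m ≤ M := by
    intro N hN
    induction N with
    | nil => exact ⟨0, by simp⟩
    | cons P N ih =>
      obtain ⟨M, hM⟩ := ih fun Q hQ => hN Q (List.mem_cons_of_mem _ hQ)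
      obtain ⟨μ, hμ, -⟩ := (hw P (hN P (by simp))).2
      refine ⟨max M (μ p), fun Q hQ m hm => ?_⟩
      rcases List.mem_cons.1 hQ with rfl | hQ
      · rw [Part.mem_unique hm (hμ p)]; exact le_max_right _ _
      · exact (hM Q hQ m hm).trans (le_max_left _ _)
  exact this F.nl fun _ h => h

/-- The box clause is still present later, so a later satisfying assignment avoids the box. In the
maximum norm one argument outside the radius suffices, although the box restricts only the arguments
of one constraint. -/
theorem IsBoxStep.separated {M : ℕ} (hM : ∀ P ∈ F.nl, ∀ m ∈ P.modulus.eval p, m ≤ M)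
    {α α' : Trail n} {L₀ L₁ L' : List (Clause n)} (h : IsBoxStep F δ p α L₀ L₁)
    (hsub : ∀ C ∈ L₁, C ∈ L') (h' : LinTrue L' α'.asg) :
    (2⁻¹ : ℝ) ^ M ≤ dist (fun i => (α.asg.val i : ℝ)) (fun i => (α'.asg.val i : ℝ)) := by
  obtain ⟨-, C, rfl, hC⟩ := h
  obtain ⟨P, hP, hlin⟩ := hC.exists_of_some rfl
  have hh := h'.holds C (hsub C (by simp))
  cases hlin with
  | box q hq hrel m hm =>
    rw [boxClause_holds] at hh
    obtain ⟨j, hj⟩ := hh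
    have h1 : (2⁻¹ : ℝ) ^ M ≤ 2⁻¹ ^ m :=
      pow_le_pow_of_le_one (by norm_num) (by norm_num) (hM P hP m hm)
    refine h1.trans (le_trans ?_ (dist_le_pi_dist _ _ (P.args j)))
    push_cast at hj
    rw [Real.dist_eq, le_abs]
    rcases hj with hj | hj
    · left; linarith
    · right; linarith

theorem not_exists_infinite_run (hδ : 0 < δ) (hp : Precise δ p) (hb : F.BoundedInstance)
    (hw : F.WellPresented) :
    ¬ ∃ S : ℕ → State n, S 0 = F.init ∧ ∀ i, Step F π δ p (S i) (S (i + 1)) := by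
  rintro ⟨S, h0, hstep⟩
  have hrun : ∀ i, ∃ α L, S i = .run α L := by
    intro i
    have := hstep i
    cases h : S i with
    | run α L => exact ⟨α, L, rfl⟩
    | unsat => rw [h] at this; cases this
    | deltaSat => rw [h] at this; cases this
    | sat => rw [h] at this; cases this
  choose α L hS using hrun
  have hsi : ∀ i, StateInv F π δ (S i) := by
    intro i
    induction i with
    | zero => rw [h0]; exact RunInv.init F π
    | succ i ih => exact ih.step hδ hp hb hw (hstep i)
  have hinv : ∀ i, RunInv F π (α i) (L i) := fun i => by
    have := hsi i
    rw [hS i] at this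
    exact this
  have hstep' : ∀ i, Step F π δ p (.run (α i) (L i)) (.run (α (i + 1)) (L (i + 1))) := fun i => by
    have := hstep i
    rwa [hS i, hS (i + 1)] at this
  have hsub : ∀ i k, ∀ C ∈ L i, C ∈ L (i + k) := by
    intro i k
    induction k with
    | zero => exact fun _ h => h
    | succ k ih => exact fun C hC => (hstep' (i + k)).subset C (ih C hC)
  obtain ⟨φ, hφ, hbox⟩ := Filter.extraction_of_frequently_atTop (frequently_isBoxStep hinv hstep')
  obtain ⟨M, hM⟩ := exists_modulus_bound hw p
  -- The centres of the boxes lie in the bounded set `F.D`, so a subsequence converges and is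
  -- Cauchy, against their uniform separation.
  obtain ⟨a, -, ψ, hψ, hlim⟩ := tendsto_subseq_of_bounded hb.1
    (x := fun k => fun i => ((α (φ k)).asg.val i : ℝ)) fun k => (hinv (φ k)).mem_D (hbox k).1
  obtain ⟨N, hN⟩ := Metric.cauchySeq_iff.1 hlim.cauchySeq ((2⁻¹ : ℝ) ^ M) (by positivity)
  refine absurd (hN N le_rfl (N + 1) (Nat.le_succ N)) (not_lt.2 ?_)
  refine (hbox (ψ N)).separated hM (fun C hC => ?_) (hbox (ψ (N + 1))).1
  -- The clause excluded at stage `i` belongs to the linear part only from stage `i + 1` on.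
  have hlt : φ (ψ N) + 1 ≤ φ (ψ (N + 1)) := hφ (hψ (Nat.lt_succ_self N))
  obtain ⟨k, hk⟩ := Nat.exists_eq_add_of_le hlt
  rw [hk]
  exact hsub _ k C hC

/-- There is a complete run that consists of effective steps. -/
theorem exists_effective_run (hδ : 0 < δ) (hp : Precise δ p) (hb : F.BoundedInstance)
    (hw : F.WellPresented) :
    ∃ r : List (State n), r.head? = some F.init ∧ r.IsChain (EffStep F π δ p) ∧
      (r.getLast? = some .unsat ∨ r.getLast? = some .deltaSat) := by
  have hreach : ∃ s, Relation.ReflTransGen (EffStep F π δ p) F.init s ∧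
      (s = .unsat ∨ s = .deltaSat) := by
    -- Otherwise every state reachable by effective steps has an effective successor, and iterating
    -- a choice of successors gives an infinite run.
    by_contra hno
    push Not at hno
    have hnext : ∀ s : {s // Relation.ReflTransGen (EffStep F π δ p) F.init s},
        ∃ s' : {s // Relation.ReflTransGen (EffStep F π δ p) F.init s},
          EffStep F π δ p s.1 s'.1 := by
      rintro ⟨s, hs⟩
      have hinv := StateInv.of_reachable hδ hp hb hw (π := π) (δ := δ) (p := p)
        (Relation.ReflTransGen.mono (fun _ _ h => EffStep.step h) _ _ hs)
      cases s with
      | run α L =>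
        have hinv : RunInv F π α L := hinv
        obtain ⟨s', h'⟩ := hinv.exists_effStep (δ := δ) (p := p) hb hw
        exact ⟨⟨s', hs.tail h'⟩, h'⟩
      | unsat => exact absurd rfl (hno _ hs).1
      | deltaSat => exact absurd rfl (hno _ hs).2
      | sat =>
        rcases Relation.ReflTransGen.cases_tail hs with h | ⟨_, _, h⟩
        · cases h
        · cases h
    choose f hf using hnext
    refine not_exists_infinite_run (π := π) hδ hp hb hw
      ⟨fun i => (f^[i] ⟨F.init, .refl⟩).1, rfl, fun i => ?_⟩
    simp only [Function.iterate_succ_apply']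
    exact (hf _).step
  obtain ⟨s, hs, hfin⟩ := hreach
  obtain ⟨l, hl, hlast⟩ := List.exists_isChain_cons_of_relationReflTransGen hs
  refine ⟨F.init :: l, rfl, hl, ?_⟩
  rw [List.getLast?_eq_some_getLast (List.cons_ne_nil _ _), hlast]
  simpa using hfin

end

end DeltaKsmt

/-! ### Effectiveness: coding of rationals and of programs -/

namespace DeltaKsmt

/-! ### Primitive recursive arithmetic of rationals -/

section
open Primrec

/-- The rational with the given positive part and negative part of the numerator and the given
denominator. -/
def toRat (t : RatData) : ℚ := mkRat ((t.1 : ℤ) - t.2.1) t.2.2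

theorem toRat_ratData (q : ℚ) : toRat (ratData q) = q := by
  have h : ((q.num.toNat : ℤ) - ((-q.num).toNat : ℤ)) = q.num := by omega
  rw [toRat, ratData]
  dsimp only
  rw [h, Rat.mkRat_self]

theorem primrec_nat_pow : Primrec₂ ((· ^ ·) : ℕ → ℕ → ℕ) :=
  Primrec₂.unpaired'.1 Nat.Primrec.pow

theorem primrecRel_dvd : PrimrecRel ((· ∣ ·) : ℕ → ℕ → Prop) :=
  (Primrec.eq.comp (nat_mod.comp snd fst) (const 0)).of_eq fun p =>
    (Nat.dvd_iff_mod_eq_zero (m := p.1) (n := p.2)).symm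

/-- The bounded search for a common divisor goes up to the sum, because the gcd equals the other
argument if one argument is `0`. If both are `0`, the search returns `0` as it should. -/
theorem primrec_gcd : Primrec₂ Nat.gcd := by
  have h : Primrec fun x : ℕ × ℕ =>
      (x.1 + x.2).findGreatest fun k => k ∣ x.1 ∧ k ∣ x.2 :=
    nat_findGreatest (p := fun (x : ℕ × ℕ) k => k ∣ x.1 ∧ k ∣ x.2)
      (nat_add.comp fst snd)
      ((primrecRel_dvd.comp snd (fst.comp fst)).and (primrecRel_dvd.comp snd (snd.comp fst)))
  refine h.of_eq fun x => ?_
  rw [Nat.findGreatest_eq_iff]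
  have hle : Nat.gcd x.1 x.2 ≤ x.1 + x.2 := by
    rcases Nat.eq_zero_or_pos x.1 with h0 | h0
    · simp [h0]
    · exact (Nat.gcd_le_left _ h0).trans (Nat.le_add_right _ _)
  refine ⟨hle, fun _ => ⟨Nat.gcd_dvd_left _ _, Nat.gcd_dvd_right _ _⟩, ?_⟩
  intro k hk hle h
  have hpos : 0 < Nat.gcd x.1 x.2 := by
    rw [Nat.gcd_pos_iff]
    omega
  exact absurd (Nat.le_of_dvd hpos (Nat.dvd_gcd h.1 h.2)) (not_le.2 hk)

/-- The truncated differences are the positive and negative part of the numerator. One of them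
vanishes, so their sum is its absolute value, and dividing by the gcd gives lowest terms. -/
theorem ratData_toRat (t : RatData) : ratData (toRat t) = if t.2.2 = 0 then (0, 0, 1) else
    ((t.1 - t.2.1) / Nat.gcd t.2.2 ((t.1 - t.2.1) + (t.2.1 - t.1)),
      (t.2.1 - t.1) / Nat.gcd t.2.2 ((t.1 - t.2.1) + (t.2.1 - t.1)),
      t.2.2 / Nat.gcd t.2.2 ((t.1 - t.2.1) + (t.2.1 - t.1))) := by
  obtain ⟨a, b, d⟩ := t
  simp only [ratData, toRat, Rat.num_mkRat, Rat.den_mkRat]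
  by_cases hd : d = 0
  · simp [hd]
  · have hab : ((a : ℤ) - b).natAbs = (a - b) + (b - a) := by omega
    simp only [hd, if_false, hab]
    have hpos : 0 < Nat.gcd d ((a - b) + (b - a)) := Nat.gcd_pos_of_pos_left _ (by omega)
    have hdvd : Nat.gcd d ((a - b) + (b - a)) ∣ (a - b) + (b - a) := Nat.gcd_dvd_right _ _
    generalize Nat.gcd d ((a - b) + (b - a)) = g at *
    rcases le_total b a with h | h
    · have e : ((a : ℤ) - b) = ((a - b : ℕ) : ℤ) := by omega
      have e0 : b - a = 0 := by omega
      have : ((a - b : ℕ) : ℤ) / (g : ℤ) = ((a - b) / g : ℕ) := by simp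
      rw [e, this, e0]
      generalize (a - b) / g = x
      simp
    · have e : ((a : ℤ) - b) = -((b - a : ℕ) : ℤ) := by omega
      have e0 : a - b = 0 := by omega
      rw [e0, zero_add] at hdvd
      have : -((b - a : ℕ) : ℤ) / (g : ℤ) = -((b - a) / g : ℕ) := by
        rw [Int.neg_ediv_of_dvd (by exact_mod_cast hdvd)]; simp
      rw [e, this, e0]
      generalize (b - a) / g = x
      simp

theorem primrec_normalize : Primrec fun t => ratData (toRat t) := by
  have hd : Primrec fun t : RatData => t.2.2 := snd.comp snd
  have hp : Primrec fun t : RatData => t.1 - t.2.1 := nat_sub.comp fst (fst.comp snd)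
  have hm : Primrec fun t : RatData => t.2.1 - t.1 := nat_sub.comp (fst.comp snd) fst
  have hg : Primrec fun t : RatData => Nat.gcd t.2.2 ((t.1 - t.2.1) + (t.2.1 - t.1)) :=
    primrec_gcd.comp hd (nat_add.comp hp hm)
  exact (Primrec.ite (Primrec.eq.comp hd (const 0)) (const ((0, 0, 1) : RatData))
    ((nat_div.comp hp hg).pair ((nat_div.comp hm hg).pair (nat_div.comp hd hg)))).of_eq
    fun t => (ratData_toRat t).symm

/-- The presentations of rationals that are in lowest terms. -/
def IsRatData (t : RatData) : Prop := ratData (toRat t) = t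

instance : DecidablePred IsRatData := fun _ => inferInstanceAs (Decidable (_ = _))

theorem primrecPred_isRatData : PrimrecPred IsRatData :=
  Primrec.eq.comp primrec_normalize Primrec.id

/-- Rationals are presented by their presentations in lowest terms. -/
def ratEquiv : ℚ ≃ Subtype IsRatData where
  toFun q := ⟨ratData q, by rw [IsRatData, toRat_ratData]⟩
  invFun t := toRat t.1
  left_inv := toRat_ratData
  right_inv t := Subtype.ext t.2

/-- The code of a rational under this instance is `ratCode` by definition, so machine outputs can be
decoded directly. Explicit instance arguments below select it. -/
instance ratPrimcodable : Primcodable ℚ :=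
  letI := Primcodable.subtype primrecPred_isRatData
  Primcodable.ofEquiv (Subtype IsRatData) ratEquiv

theorem primrec_ratData : Primrec ratData := by
  let := Primcodable.subtype primrecPred_isRatData
  exact (subtype_val (hp := primrecPred_isRatData)).comp (of_equiv (e := ratEquiv))

variable {σ : Type*} [Primcodable σ]

theorem primrec_of_ratData {f : σ → ℚ} (h : Primrec fun s => ratData (f s)) : Primrec f := by
  let := Primcodable.subtype primrecPred_isRatData
  exact (of_equiv_iff ratEquiv).1 ((subtype_val_iff (hp := primrecPred_isRatData)).1 h)

theorem primrec_toRat : Primrec toRat := primrec_of_ratData primrec_normalize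

theorem encode_rat (q : ℚ) : @Encodable.encode ℚ ratPrimcodable.toEncodable q = ratCode q := rfl

theorem ratData_den_ne_zero (q : ℚ) : ((ratData q).2.2 : ℚ) ≠ 0 := by
  simp [ratData]

theorem eq_ratData_div (q : ℚ) :
    q = (((ratData q).1 : ℚ) - (ratData q).2.1) / (ratData q).2.2 := by
  conv_lhs => rw [← toRat_ratData q, toRat, Rat.mkRat_eq_div]
  push_cast
  rfl

theorem toRat_eq_div (t : RatData) : toRat t = ((t.1 : ℚ) - t.2.1) / t.2.2 := by
  rw [toRat, Rat.mkRat_eq_div]; push_cast; rfl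

theorem primrec_rat_add : Primrec₂ ((· + ·) : ℚ → ℚ → ℚ) := by
  have a := fst.comp (primrec_ratData.comp (fst (α := ℚ) (β := ℚ)))
  have b := (fst.comp snd).comp (primrec_ratData.comp (fst (α := ℚ) (β := ℚ)))
  have d := (snd.comp snd).comp (primrec_ratData.comp (fst (α := ℚ) (β := ℚ)))
  have a' := fst.comp (primrec_ratData.comp (snd (α := ℚ) (β := ℚ)))
  have b' := (fst.comp snd).comp (primrec_ratData.comp (snd (α := ℚ) (β := ℚ)))
  have d' := (snd.comp snd).comp (primrec_ratData.comp (snd (α := ℚ) (β := ℚ)))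
  refine (primrec_toRat.comp ((nat_add.comp (nat_mul.comp a d') (nat_mul.comp a' d)).pair
    ((nat_add.comp (nat_mul.comp b d') (nat_mul.comp b' d)).pair (nat_mul.comp d d')))).of_eq ?_
  rintro ⟨q, r⟩
  have hq := ratData_den_ne_zero q
  have hr := ratData_den_ne_zero r
  rw [toRat_eq_div]
  conv_rhs => rw [eq_ratData_div q, eq_ratData_div r]
  push_cast
  field_simp
  ring

theorem primrec_rat_mul : Primrec₂ ((· * ·) : ℚ → ℚ → ℚ) := by
  have a := fst.comp (primrec_ratData.comp (fst (α := ℚ) (β := ℚ)))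
  have b := (fst.comp snd).comp (primrec_ratData.comp (fst (α := ℚ) (β := ℚ)))
  have d := (snd.comp snd).comp (primrec_ratData.comp (fst (α := ℚ) (β := ℚ)))
  have a' := fst.comp (primrec_ratData.comp (snd (α := ℚ) (β := ℚ)))
  have b' := (fst.comp snd).comp (primrec_ratData.comp (snd (α := ℚ) (β := ℚ)))
  have d' := (snd.comp snd).comp (primrec_ratData.comp (snd (α := ℚ) (β := ℚ)))
  refine (primrec_toRat.comp ((nat_add.comp (nat_mul.comp a a') (nat_mul.comp b b')).pair
    ((nat_add.comp (nat_mul.comp a b') (nat_mul.comp b a')).pair (nat_mul.comp d d')))).of_eq ?_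
  rintro ⟨q, r⟩
  have hq := ratData_den_ne_zero q
  have hr := ratData_den_ne_zero r
  rw [toRat_eq_div]
  conv_rhs => rw [eq_ratData_div q, eq_ratData_div r]
  push_cast
  field_simp
  ring

theorem primrec_rat_neg : Primrec (Neg.neg : ℚ → ℚ) := by
  refine (primrec_rat_mul.comp (const (-1)) Primrec.id).of_eq fun q => ?_
  simp

theorem primrecPred_rat_pos : PrimrecPred fun q : ℚ => 0 < q := by
  refine ((Primrec.eq.comp (fst.comp primrec_ratData) (const 0)).not).of_eq fun q => ?_
  rw [← Rat.num_pos]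
  simp only [ratData]
  omega

theorem primrecRel_relZeroQ : PrimrecRel RelZeroQ := by
  have hpos := primrecPred_rat_pos.comp (snd (α := Bool) (β := ℚ))
  have hneg := primrecPred_rat_pos.comp (primrec_rat_neg.comp (snd (α := Bool) (β := ℚ)))
  have hs : PrimrecPred fun x : Bool × ℚ => x.1 = true := Primrec.eq.comp fst (const true)
  refine ((hs.and hpos).or (hs.not.and hneg.not)).of_eq ?_
  rintro ⟨s, q⟩
  cases s <;> simp [RelZeroQ]

theorem primrec_two_inv_pow : Primrec fun m : ℕ => (2⁻¹ : ℚ) ^ m := by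
  refine (primrec_toRat.comp ((const 1).pair ((const 0).pair
    (primrec_nat_pow.comp (const 2) Primrec.id)))).of_eq fun m => ?_
  rw [toRat_eq_div]
  simp

theorem primrecPred_exists_lt {f : σ → ℕ} {R : ℕ → σ → Prop} (hf : Primrec f)
    (hR : PrimrecRel R) : PrimrecPred fun s => ∃ i < f s, R i s :=
  (hR.exists_mem_list.comp (list_range.comp hf) Primrec.id).of_eq (by simp)

theorem primrecPred_forall_lt {f : σ → ℕ} {R : ℕ → σ → Prop} (hf : Primrec f)
    (hR : PrimrecRel R) : PrimrecPred fun s => ∀ i < f s, R i s :=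
  (hR.forall_mem_list.comp (list_range.comp hf) Primrec.id).of_eq (by simp)

theorem primrecPred_exists_mem {β : Type*} [Primcodable β] {f : σ → List β} {R : β → σ → Prop}
    (hf : Primrec f) (hR : PrimrecRel R) : PrimrecPred fun s => ∃ b ∈ f s, R b s :=
  hR.exists_mem_list.comp hf Primrec.id

theorem primrecPred_forall_mem {β : Type*} [Primcodable β] {f : σ → List β} {R : β → σ → Prop}
    (hf : Primrec f) (hR : PrimrecRel R) : PrimrecPred fun s => ∀ b ∈ f s, R b s :=
  hR.forall_mem_list.comp hf Primrec.id

end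

/-! ### Oracle machines with a constant oracle -/

open Nat.Partrec (Code)

/-- The program that results if the oracle is replaced by the constant `v`. -/
def OCode.subst (v : ℕ) : OCode → Code
  | .zero => .zero
  | .succ => .succ
  | .left => .left
  | .right => .right
  | .oracle => Code.const v
  | .pair cf cg => .pair (cf.subst v) (cg.subst v)
  | .comp cf cg => .comp (cf.subst v) (cg.subst v)
  | .prec cf cg => .prec (cf.subst v) (cg.subst v)
  | .rfind' cf => .rfind' (cf.subst v)

/-- The procedure runs machines only on constant names, where every query has the same answer.
Relative computation thus reduces to ordinary programs, for which `Code.evaln` gives bounded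
evaluation. -/
theorem OCode.eval_subst (v : ℕ) (c : OCode) : (c.subst v).eval = c.eval fun _ => v := by
  induction c with
  | zero => rfl
  | succ => rfl
  | left => rfl
  | right => rfl
  | oracle => funext n; exact Code.eval_const v n
  | pair cf cg ihf ihg => simp only [OCode.subst, OCode.eval, Code.eval, ihf, ihg]; rfl
  | comp cf cg ihf ihg => simp only [OCode.subst, OCode.eval, Code.eval, ihf, ihg]; rfl
  | prec cf cg ihf ihg => simp only [OCode.subst, OCode.eval, Code.eval, ihf, ihg]; rfl
  | rfind' cf ihf => simp only [OCode.subst, OCode.eval, Code.eval, ihf]; rfl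

/-- `OCode.subst` on numbers of programs. -/
def substNat (v : ℕ) : ℕ → Code
  | 0 => .zero
  | 1 => .succ
  | 2 => .left
  | 3 => .right
  | 4 => Code.const v
  | m + 5 =>
    have : (m / 4).unpair.1 < m + 5 := by have := (m / 4).unpair_left_le; omega
    have : (m / 4).unpair.2 < m + 5 := by have := (m / 4).unpair_right_le; omega
    have : m / 4 < m + 5 := by omega
    if m % 4 = 0 then .pair (substNat v (m / 4).unpair.1) (substNat v (m / 4).unpair.2)
    else if m % 4 = 1 then .comp (substNat v (m / 4).unpair.1) (substNat v (m / 4).unpair.2)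
    else if m % 4 = 2 then .prec (substNat v (m / 4).unpair.1) (substNat v (m / 4).unpair.2)
    else .rfind' (substNat v (m / 4))

theorem substNat_toNat (v : ℕ) (c : OCode) : substNat v c.toNat = c.subst v := by
  induction c with
  | zero => simp [OCode.toNat, substNat, OCode.subst]
  | succ => simp [OCode.toNat, substNat, OCode.subst]
  | left => simp [OCode.toNat, substNat, OCode.subst]
  | right => simp [OCode.toNat, substNat, OCode.subst]
  | oracle => simp [OCode.toNat, substNat, OCode.subst]
  | pair cf cg ihf ihg =>
    rw [OCode.toNat, substNat]
    have h1 : 4 * Nat.pair cf.toNat cg.toNat % 4 = 0 := by omega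
    have h2 : 4 * Nat.pair cf.toNat cg.toNat / 4 = Nat.pair cf.toNat cg.toNat := by omega
    simp [h1, h2, ihf, ihg, OCode.subst]
  | comp cf cg ihf ihg =>
    rw [OCode.toNat, show 4 * Nat.pair cf.toNat cg.toNat + 6 =
      4 * Nat.pair cf.toNat cg.toNat + 1 + 5 from rfl, substNat]
    have h1 : (4 * Nat.pair cf.toNat cg.toNat + 1) % 4 = 1 := by omega
    have h2 : (4 * Nat.pair cf.toNat cg.toNat + 1) / 4 = Nat.pair cf.toNat cg.toNat := by omega
    simp [h1, h2, ihf, ihg, OCode.subst]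
  | prec cf cg ihf ihg =>
    rw [OCode.toNat, show 4 * Nat.pair cf.toNat cg.toNat + 7 =
      4 * Nat.pair cf.toNat cg.toNat + 2 + 5 from rfl, substNat]
    have h1 : (4 * Nat.pair cf.toNat cg.toNat + 2) % 4 = 2 := by omega
    have h2 : (4 * Nat.pair cf.toNat cg.toNat + 2) / 4 = Nat.pair cf.toNat cg.toNat := by omega
    simp [h1, h2, ihf, ihg, OCode.subst]
  | rfind' cf ihf =>
    rw [OCode.toNat, show 4 * cf.toNat + 8 = 4 * cf.toNat + 3 + 5 from rfl, substNat]
    have h1 : (4 * cf.toNat + 3) % 4 = 3 := by omega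
    have h2 : (4 * cf.toNat + 3) / 4 = cf.toNat := by omega
    simp [h1, h2, ihf, OCode.subst]

-- By course-of-values recursion: `G` receives the list of all earlier values, so the length of the
-- list is the current argument.
open Primrec in
theorem primrec_substNat : Primrec₂ substNat := by
  let G : ℕ → List Code → Code := fun v l =>
    let m := l.length - 5
    let c₁ := l.getD (m / 4).unpair.1 Code.zero
    let c₂ := l.getD (m / 4).unpair.2 Code.zero
    if l.length = 0 then .zero
    else if l.length = 1 then .succ
    else if l.length = 2 then .left
    else if l.length = 3 then .right
    else if l.length = 4 then Code.const v
    else if m % 4 = 0 then .pair c₁ c₂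
    else if m % 4 = 1 then .comp c₁ c₂
    else if m % 4 = 2 then .prec c₁ c₂
    else .rfind' (l.getD (m / 4) Code.zero)
  have hlen : Primrec fun x : ℕ × List Code => x.2.length := list_length.comp snd
  have hm : Primrec fun x : ℕ × List Code => x.2.length - 5 := nat_sub.comp hlen (const 5)
  have hdiv := nat_div.comp hm (const 4)
  have hmod := nat_mod.comp hm (const 4)
  have hc₁ : Primrec fun x : ℕ × List Code =>
      x.2.getD ((x.2.length - 5) / 4).unpair.1 Code.zero :=
    (list_getD Code.zero).comp snd (fst.comp (unpair.comp hdiv))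
  have hc₂ : Primrec fun x : ℕ × List Code =>
      x.2.getD ((x.2.length - 5) / 4).unpair.2 Code.zero :=
    (list_getD Code.zero).comp snd (snd.comp (unpair.comp hdiv))
  have hc₃ : Primrec fun x : ℕ × List Code => x.2.getD ((x.2.length - 5) / 4) Code.zero :=
    (list_getD Code.zero).comp snd hdiv
  have hG : Primrec₂ G :=
    .ite (Primrec.eq.comp hlen (const 0)) (const _) <|
    .ite (Primrec.eq.comp hlen (const 1)) (const _) <|
    .ite (Primrec.eq.comp hlen (const 2)) (const _) <|
    .ite (Primrec.eq.comp hlen (const 3)) (const _) <|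
    .ite (Primrec.eq.comp hlen (const 4)) (Code.primrec_const.comp fst) <|
    .ite (Primrec.eq.comp hmod (const 0)) (Code.primrec₂_pair.comp hc₁ hc₂) <|
    .ite (Primrec.eq.comp hmod (const 1)) (Code.primrec₂_comp.comp hc₁ hc₂) <|
    .ite (Primrec.eq.comp hmod (const 2)) (Code.primrec₂_prec.comp hc₁ hc₂) <|
    Code.primrec_rfind'.comp hc₃
  refine nat_strong_rec substNat (g := fun v l => some (G v l)) (option_some_iff.2 hG) fun v m => ?_
  have hget : ∀ k < m, ((List.range m).map (substNat v)).getD k Code.zero = substNat v k := by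
    intro k hk
    simp [List.getD, hk]
  simp only [G, List.length_map, List.length_range, Option.some.injEq]
  match m, hget with
  | 0, _ => simp [substNat]
  | 1, _ => simp [substNat]
  | 2, _ => simp [substNat]
  | 3, _ => simp [substNat]
  | 4, _ => simp [substNat]
  | m + 5, hget =>
    rw [substNat]
    have h1 : (m / 4).unpair.1 < m + 5 := by have := (m / 4).unpair_left_le; omega
    have h2 : (m / 4).unpair.2 < m + 5 := by have := (m / 4).unpair_right_le; omega
    have h3 : m / 4 < m + 5 := by omega
    simp only [Nat.add_sub_cancel, hget _ h1, hget _ h2, hget _ h3]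
    simp

end DeltaKsmt

namespace DeltaKsmt

/-! ### The calculus on finite presentations -/

open Nat.Partrec (Code)

/-- Coefficients, constant, strictness. -/
abbrev LitQ : Type := List ℚ × ℚ × Bool

abbrev ClauseQ : Type := List LitQ

abbrev TrailQ : Type := List (ℕ × ℚ)

/-- A number that is `0` for non-final states, the trail, and the linear part. -/
abbrev StateQ : Type := ℕ × TrailQ × List ClauseQ

def valQ (α : TrailQ) (i : ℕ) : ℚ := (α.lookup i).getD 0

/-- The variable is assigned. -/
def IsAsgQ (α : TrailQ) (i : ℕ) : Prop := (α.lookup i).isSome = true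

def litEvalQ (l : LitQ) (α : TrailQ) : ℚ :=
  (List.range l.1.length).foldr (fun i s => l.1.getD i 0 * valQ α i + s) l.2.1

def LitFalseQ (l : LitQ) (α : TrailQ) : Prop :=
  (∀ i < l.1.length, l.1.getD i 0 = 0 ∨ IsAsgQ α i) ∧ ¬ RelZeroQ l.2.2 (litEvalQ l α)

def ClauseFalseQ (C : ClauseQ) (α : TrailQ) : Prop := ∀ l ∈ C, LitFalseQ l α

def LinFalseQ (L : List ClauseQ) (α : TrailQ) : Prop := ∃ C ∈ L, ClauseFalseQ C α

def elimQ (z : ℕ) (l₁ l₂ : LitQ) : LitQ :=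
  ((List.range l₁.1.length).map fun i =>
      -(l₂.1.getD z 0) * l₁.1.getD i 0 + l₁.1.getD z 0 * l₂.1.getD i 0,
    -(l₂.1.getD z 0) * l₁.2.1 + l₁.1.getD z 0 * l₂.2.1, l₁.2.2 || l₂.2.2)

def resolveQ (z : ℕ) (C₁ C₂ : ClauseQ) (l₁ l₂ : LitQ) : ClauseQ :=
  C₁.filter (fun l => l ≠ l₁) ++ C₂.filter (fun l => l ≠ l₂) ++ [elimQ z l₁ l₂]

/-- One round of arithmetical resolution on `z`. -/
def resolventsQ (z : ℕ) (S : List ClauseQ) : List ClauseQ :=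
  S ++ S.flatMap fun C₁ => S.flatMap fun C₂ => C₁.flatMap fun l₁ => C₂.flatMap fun l₂ =>
    if 0 < l₁.1.getD z 0 ∧ 0 < -(l₂.1.getD z 0) then [resolveQ z C₁ C₂ l₁ l₂] else []

/-- Only `z` and assigned variables occur in the clause. -/
def ClauseVarsQ (C : ClauseQ) (b : TrailQ × ℕ) : Prop :=
  ∀ l ∈ C, ∀ i < l.1.length, l.1.getD i 0 = 0 ∨ i = b.2 ∨ IsAsgQ b.1 i

open Classical in
noncomputable def baseQ (L : List ClauseQ) (b : TrailQ × ℕ) : List ClauseQ :=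
  L.filter fun C => ClauseVarsQ C b

def singleQ (n i : ℕ) (c : ℚ) : List ℚ := (List.range n).map fun j => if j = i then c else 0

def boxClauseQ (n : ℕ) (args : List ℕ) (α : TrailQ) (m : ℕ) : ClauseQ :=
  args.map (fun i => (singleQ n i (-1), valQ α i + -(2⁻¹ ^ m), false)) ++
    args.map fun i => (singleQ n i 1, -(valQ α i) + -(2⁻¹ ^ m), false)

/-- The output of the machine on the constant name of the arguments, computed with fuel `K`. -/
def machineQ (K p : ℕ) (α : TrailQ) (P : NLData) : Option ℚ :=
  (Code.evaln K (substNat (Encodable.encode (P.1.map fun i => ratData (valQ α i))) P.2.2.1) p).bind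
    (@Encodable.decode₂ ℚ ratPrimcodable.toEncodable)

def RelQ (K p : ℕ) (δ : ℚ) (α : TrailQ) (P : NLData) : Prop :=
  RelZeroQ P.2.1 ((machineQ K p α P).getD 0 + δ * 2⁻¹)

def AcceptQ (K p : ℕ) (δ : ℚ) (α : TrailQ) (P : NLData) : Prop :=
  (machineQ K p α P).isSome = true ∧ RelQ K p δ α P

def FoundQ (K p : ℕ) (δ : ℚ) (n : ℕ) (α : TrailQ) (P : NLData) (C : ClauseQ) : Prop :=
  (machineQ K p α P).isSome = true ∧ ¬ RelQ K p δ α P ∧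
    (Code.evaln K P.2.2.2 p).isSome = true ∧
      C = boxClauseQ n P.1 α ((Code.evaln K P.2.2.2 p).getD 0)

/-- The new entry is sought among the entries of the target, so the quantifier ranges over a finite
list. The conditions `C ∈ L'` in `ResolveQ` and `LineariseQ` serve the same end. -/
def AssignQ (ord : List ℕ) (α : TrailQ) (L : List ClauseQ) (α' : TrailQ) : Prop :=
  ¬ LinFalseQ L α ∧ ¬ LinFalseQ L α' ∧ ∃ e ∈ α', α' = α ++ [e] ∧ ¬ IsAsgQ α e.1 ∧
    ∃ k < ord.length, ord.getD k 0 = e.1 ∧ ∀ j < k, IsAsgQ α (ord.getD j 0)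

def ResolveQ (K n : ℕ) (α : TrailQ) (L L' : List ClauseQ) : Prop :=
  ¬ LinFalseQ L α ∧ ∃ C ∈ L', L' = C :: L ∧ ClauseFalseQ C α ∧ ∃ z < n, ¬ IsAsgQ α z ∧
    (∀ l ∈ C, l.1.getD z 0 = 0) ∧ ∃ D ∈ (resolventsQ z)^[K] (baseQ L (α, z)), D = C

def BackjumpQ (α : TrailQ) (L : List ClauseQ) (α' : TrailQ) : Prop :=
  LinFalseQ L α ∧ ¬ LinFalseQ L α' ∧ ∃ k < α.length + 1, α' = α.take k ∧
    ∀ j < α.length + 1, j ≤ k ∨ LinFalseQ L (α.take j)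

def TotalQ (n : ℕ) (α : TrailQ) : Prop := ∀ i < n, IsAsgQ α i

def LineariseQ (K p : ℕ) (δ : ℚ) (n : ℕ) (N : List NLData) (α : TrailQ) (L L' : List ClauseQ) :
    Prop :=
  ¬ LinFalseQ L α ∧ TotalQ n α ∧ ∃ C ∈ L', L' = C :: L ∧ ∃ i < N.length,
    FoundQ K p δ n α (N.getD i ([], false, 0, .zero)) C ∧
      ∀ j < i, AcceptQ K p δ α (N.getD j ([], false, 0, .zero))

def DeltaSatQ (K p : ℕ) (δ : ℚ) (n : ℕ) (N : List NLData) (α : TrailQ) (L : List ClauseQ) : Prop :=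
  ¬ LinFalseQ L α ∧ TotalQ n α ∧ ∀ P ∈ N, AcceptQ K p δ α P

/-- Parameter `δ`, variable order, linear part and non-linear part. -/
abbrev InputQ : Type := ℚ × List ℕ × List ClauseQ × List NLData

/-- The precision that the procedure uses. -/
def precQ (δ : ℚ) : ℕ := 4 * (ratData δ).2.2

/-- The fuel `K` bounds both the evaluation of programs and the rounds of resolution, which makes
the relation primitive recursive. Its disjuncts are those of `EffStep`; none corresponds to the rule
`sat`. -/
def StepQ (I : InputQ) (K : ℕ) (s s' : StateQ) : Prop :=
  s.1 = 0 ∧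
    ((s'.1 = 0 ∧
        ((s'.2.2 = s.2.2 ∧ (AssignQ I.2.1 s.2.1 s.2.2 s'.2.1 ∨ BackjumpQ s.2.1 s.2.2 s'.2.1)) ∨
          (s'.2.1 = s.2.1 ∧ (ResolveQ K I.2.1.length s.2.1 s.2.2 s'.2.2 ∨
            LineariseQ K (precQ I.1) I.1 I.2.1.length I.2.2.2 s.2.1 s.2.2 s'.2.2)))) ∨
      (s' = (1, [], []) ∧ LinFalseQ s.2.2 []) ∨
      (s' = (2, [], []) ∧ DeltaSatQ K (precQ I.1) I.1 I.2.1.length I.2.2.2 s.2.1 s.2.2))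

/-- The list of states, each with the fuel for the transition to it, is a complete run. -/
def RunQ (I : InputQ) (c : List (ℕ × StateQ)) : Prop :=
  (c.getD 0 (0, 3, [], [])).2 = (0, [], I.2.2.1) ∧
    (∀ i < c.length - 1,
      StepQ I (c.getD (i + 1) (0, 3, [], [])).1 (c.getD i (0, 3, [], [])).2
        (c.getD (i + 1) (0, 3, [], [])).2) ∧
    ((c.getD (c.length - 1) (0, 3, [], [])).2 = (1, [], []) ∨
      (c.getD (c.length - 1) (0, 3, [], [])).2 = (2, [], []))

/-! ### Primitive recursiveness of the test for complete runs -/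

section
open Primrec
variable {σ : Type*} [Primcodable σ]

theorem primrecRel_mk {β : Type*} [Primcodable β] {R : β → σ → Prop}
    (h : PrimrecPred fun x : β × σ => R x.1 x.2) : PrimrecRel R := h

theorem primrec_valQ {α : σ → TrailQ} {i : σ → ℕ} (hα : Primrec α) (hi : Primrec i) :
    Primrec fun s => valQ (α s) (i s) :=
  option_getD.comp (listLookup.comp hi hα) (const 0)

theorem primrecPred_isAsgQ {α : σ → TrailQ} {i : σ → ℕ} (hα : Primrec α) (hi : Primrec i) :
    PrimrecPred fun s => IsAsgQ (α s) (i s) :=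
  Primrec.eq.comp (option_isSome.comp (listLookup.comp hi hα)) (const true)

theorem primrec_coeffQ {l : σ → LitQ} {i : σ → ℕ} (hl : Primrec l) (hi : Primrec i) :
    Primrec fun s => (l s).1.getD (i s) 0 :=
  (list_getD 0).comp (fst.comp hl) hi

theorem primrec_litEvalQ {l : σ → LitQ} {α : σ → TrailQ} (hl : Primrec l) (hα : Primrec α) :
    Primrec fun s => litEvalQ (l s) (α s) :=
  list_foldr (list_range.comp (list_length.comp (fst.comp hl))) (fst.comp (snd.comp hl))
    (primrec_rat_add.comp
      (primrec_rat_mul.comp (primrec_coeffQ (hl.comp fst) (fst.comp snd))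
        (primrec_valQ (hα.comp fst) (fst.comp snd))) (snd.comp snd)).to₂

theorem primrecPred_litFalseQ {l : σ → LitQ} {α : σ → TrailQ} (hl : Primrec l) (hα : Primrec α) :
    PrimrecPred fun s => LitFalseQ (l s) (α s) :=
  (primrecPred_forall_lt (list_length.comp (fst.comp hl))
    ((Primrec.eq.comp (primrec_coeffQ (hl.comp snd) fst) (const 0)).or
      (primrecPred_isAsgQ (hα.comp snd) fst)).primrecRel).and
  (primrecRel_relZeroQ.comp (snd.comp (snd.comp hl)) (primrec_litEvalQ hl hα)).not

theorem primrecPred_clauseFalseQ {C : σ → ClauseQ} {α : σ → TrailQ} (hC : Primrec C)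
    (hα : Primrec α) : PrimrecPred fun s => ClauseFalseQ (C s) (α s) :=
  primrecPred_forall_mem hC (primrecPred_litFalseQ fst (hα.comp snd)).primrecRel

theorem primrecPred_linFalseQ {L : σ → List ClauseQ} {α : σ → TrailQ} (hL : Primrec L)
    (hα : Primrec α) : PrimrecPred fun s => LinFalseQ (L s) (α s) :=
  primrecPred_exists_mem hL (primrecPred_clauseFalseQ fst (hα.comp snd)).primrecRel

theorem primrec_elimQ {z : σ → ℕ} {l₁ l₂ : σ → LitQ} (hz : Primrec z) (h₁ : Primrec l₁)
    (h₂ : Primrec l₂) : Primrec fun s => elimQ (z s) (l₁ s) (l₂ s) := by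
  have hc₁ := primrec_coeffQ h₁ hz
  have hc₂ := primrec_rat_neg.comp (primrec_coeffQ h₂ hz)
  refine Primrec.pair (list_map (list_range.comp (list_length.comp (fst.comp h₁))) ?_)
    (Primrec.pair ?_ (Primrec.or.comp (snd.comp (snd.comp h₁)) (snd.comp (snd.comp h₂))))
  · exact (primrec_rat_add.comp
      (primrec_rat_mul.comp (hc₂.comp fst) (primrec_coeffQ (h₁.comp fst) snd))
      (primrec_rat_mul.comp (hc₁.comp fst) (primrec_coeffQ (h₂.comp fst) snd))).to₂
  · exact primrec_rat_add.comp (primrec_rat_mul.comp hc₂ (fst.comp (snd.comp h₁)))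
      (primrec_rat_mul.comp hc₁ (fst.comp (snd.comp h₂)))

theorem primrec_filter_ne {C : σ → ClauseQ} {l : σ → LitQ} (hC : Primrec C) (hl : Primrec l) :
    Primrec fun s => (C s).filter fun k => k ≠ l s := by
  have : PrimrecRel fun k l : LitQ => k ≠ l := (Primrec.eq (α := LitQ)).not
  exact (this.listFilter.comp hC hl).of_eq fun s => by congr

theorem primrec_resolveQ {z : σ → ℕ} {C₁ C₂ : σ → ClauseQ} {l₁ l₂ : σ → LitQ} (hz : Primrec z)
    (hC₁ : Primrec C₁) (hC₂ : Primrec C₂) (h₁ : Primrec l₁) (h₂ : Primrec l₂) :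
    Primrec fun s => resolveQ (z s) (C₁ s) (C₂ s) (l₁ s) (l₂ s) :=
  list_append.comp (list_append.comp (primrec_filter_ne hC₁ h₁) (primrec_filter_ne hC₂ h₂))
    (list_cons.comp (primrec_elimQ hz h₁ h₂) (const []))

theorem primrec_resolventsQ : Primrec₂ resolventsQ := by
  refine list_append.comp snd ?_
  refine list_flatMap snd (Primrec₂.mk ?_)
  refine list_flatMap (snd.comp fst) (Primrec₂.mk ?_)
  refine list_flatMap (snd.comp fst) (Primrec₂.mk ?_)
  refine list_flatMap (snd.comp fst) (Primrec₂.mk ?_)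
  have hz : Primrec fun a : ((((ℕ × List ClauseQ) × ClauseQ) × ClauseQ) × LitQ) × LitQ =>
      a.1.1.1.1.1 := fst.comp (fst.comp (fst.comp (fst.comp fst)))
  refine Primrec.ite ((primrecPred_rat_pos.comp (primrec_coeffQ (snd.comp fst) hz)).and
    (primrecPred_rat_pos.comp (primrec_rat_neg.comp (primrec_coeffQ snd hz)))) ?_ (const [])
  exact list_cons.comp (primrec_resolveQ hz (snd.comp (fst.comp (fst.comp fst)))
    (snd.comp (fst.comp fst)) (snd.comp fst) snd) (const [])

theorem primrec_baseQ : Primrec₂ baseQ := by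
  classical
  have : PrimrecRel ClauseVarsQ := by
    refine primrecPred_forall_mem fst (primrecRel_mk ?_)
    refine primrecPred_forall_lt (list_length.comp (fst.comp fst)) (primrecRel_mk ?_)
    exact ((Primrec.eq.comp (primrec_coeffQ (fst.comp snd) fst) (const 0)).or
      ((Primrec.eq.comp fst (snd.comp (snd.comp (snd.comp snd)))).or
        (primrecPred_isAsgQ (fst.comp (snd.comp (snd.comp snd))) fst)))
  exact this.listFilter.of_eq fun L b => by unfold baseQ; congr

theorem primrec_singleQ {n i : σ → ℕ} (hn : Primrec n) (hi : Primrec i) (c : ℚ) :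
    Primrec fun s => singleQ (n s) (i s) c :=
  list_map (list_range.comp hn)
    (Primrec.ite (Primrec.eq.comp snd (hi.comp fst)) (const c) (const 0)).to₂

theorem primrec_boxClauseQ {n m : σ → ℕ} {args : σ → List ℕ} {α : σ → TrailQ} (hn : Primrec n)
    (ha : Primrec args) (hα : Primrec α) (hm : Primrec m) :
    Primrec fun s => boxClauseQ (n s) (args s) (α s) (m s) := by
  have hε : Primrec fun x : σ × ℕ => -((2⁻¹ : ℚ) ^ m x.1) :=
    primrec_rat_neg.comp (primrec_two_inv_pow.comp (hm.comp fst))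
  have hv : Primrec fun x : σ × ℕ => valQ (α x.1) x.2 := primrec_valQ (hα.comp fst) snd
  refine list_append.comp (list_map ha ?_) (list_map ha ?_)
  · exact ((primrec_singleQ (hn.comp fst) snd _).pair
      ((primrec_rat_add.comp hv hε).pair (const false))).to₂
  · exact ((primrec_singleQ (hn.comp fst) snd _).pair
      ((primrec_rat_add.comp (primrec_rat_neg.comp hv) hε).pair (const false))).to₂

theorem primrec_evaln {K p : σ → ℕ} {c : σ → Code} (hK : Primrec K) (hc : Primrec c)
    (hp : Primrec p) : Primrec fun s => Code.evaln (K s) (c s) (p s) :=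
  Code.primrec_evaln.comp ((hK.pair hc).pair hp)

theorem primrec_machineQ {K p : σ → ℕ} {α : σ → TrailQ} {P : σ → NLData} (hK : Primrec K)
    (hp : Primrec p) (hα : Primrec α) (hP : Primrec P) :
    Primrec fun s => machineQ (K s) (p s) (α s) (P s) := by
  refine option_bind (primrec_evaln hK (primrec_substNat.comp ?_
    (fst.comp (snd.comp (snd.comp hP)))) hp) (Primrec.decode₂.comp snd).to₂
  exact Primrec.encode.comp (list_map (fst.comp hP)
    (primrec_ratData.comp (primrec_valQ (hα.comp fst) snd)).to₂)

theorem primrecPred_relQ {K p : σ → ℕ} {δ : σ → ℚ} {α : σ → TrailQ} {P : σ → NLData}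
    (hK : Primrec K) (hp : Primrec p) (hδ : Primrec δ) (hα : Primrec α) (hP : Primrec P) :
    PrimrecPred fun s => RelQ (K s) (p s) (δ s) (α s) (P s) :=
  primrecRel_relZeroQ.comp (fst.comp (snd.comp hP))
    (primrec_rat_add.comp (option_getD.comp (primrec_machineQ hK hp hα hP) (const 0))
      (primrec_rat_mul.comp hδ (const 2⁻¹)))

theorem primrecPred_acceptQ {K p : σ → ℕ} {δ : σ → ℚ} {α : σ → TrailQ} {P : σ → NLData}
    (hK : Primrec K) (hp : Primrec p) (hδ : Primrec δ) (hα : Primrec α) (hP : Primrec P) :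
    PrimrecPred fun s => AcceptQ (K s) (p s) (δ s) (α s) (P s) :=
  (Primrec.eq.comp (option_isSome.comp (primrec_machineQ hK hp hα hP)) (const true)).and
    (primrecPred_relQ hK hp hδ hα hP)

theorem primrecPred_foundQ {K p n : σ → ℕ} {δ : σ → ℚ} {α : σ → TrailQ} {P : σ → NLData}
    {C : σ → ClauseQ} (hK : Primrec K) (hp : Primrec p) (hδ : Primrec δ) (hn : Primrec n)
    (hα : Primrec α) (hP : Primrec P) (hC : Primrec C) :
    PrimrecPred fun s => FoundQ (K s) (p s) (δ s) (n s) (α s) (P s) (C s) := by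
  have he := primrec_evaln hK (snd.comp (snd.comp (snd.comp hP))) hp
  exact (Primrec.eq.comp (option_isSome.comp (primrec_machineQ hK hp hα hP)) (const true)).and <|
    (primrecPred_relQ hK hp hδ hα hP).not.and <|
    (Primrec.eq.comp (option_isSome.comp he) (const true)).and <|
    Primrec.eq.comp hC (primrec_boxClauseQ hn (fst.comp hP) hα (option_getD.comp he (const 0)))

theorem primrecPred_assignQ {ord : σ → List ℕ} {α α' : σ → TrailQ} {L : σ → List ClauseQ}
    (ho : Primrec ord) (hα : Primrec α) (hL : Primrec L) (hα' : Primrec α') :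
    PrimrecPred fun s => AssignQ (ord s) (α s) (L s) (α' s) := by
  refine (primrecPred_linFalseQ hL hα).not.and <| (primrecPred_linFalseQ hL hα').not.and <|
    primrecPred_exists_mem hα' (primrecRel_mk ?_)
  refine (Primrec.eq.comp (hα'.comp snd) (list_append.comp (hα.comp snd)
    (list_cons.comp fst (const [])))).and <|
    (primrecPred_isAsgQ (hα.comp snd) (fst.comp fst)).not.and <|
    primrecPred_exists_lt (list_length.comp (ho.comp snd)) (primrecRel_mk ?_)
  refine (Primrec.eq.comp ((list_getD 0).comp (ho.comp (snd.comp snd)) fst)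
    (fst.comp (fst.comp snd))).and <| primrecPred_forall_lt fst (primrecRel_mk ?_)
  exact primrecPred_isAsgQ (hα.comp (snd.comp (snd.comp snd)))
    ((list_getD 0).comp (ho.comp (snd.comp (snd.comp snd))) fst)

theorem primrecPred_resolveQ {K n : σ → ℕ} {α : σ → TrailQ} {L L' : σ → List ClauseQ}
    (hK : Primrec K) (hn : Primrec n) (hα : Primrec α) (hL : Primrec L) (hL' : Primrec L') :
    PrimrecPred fun s => ResolveQ (K s) (n s) (α s) (L s) (L' s) := by
  refine (primrecPred_linFalseQ hL hα).not.and <|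
    primrecPred_exists_mem hL' (primrecRel_mk ?_)
  refine (Primrec.eq.comp (hL'.comp snd) (list_cons.comp fst (hL.comp snd))).and <|
    (primrecPred_clauseFalseQ fst (hα.comp snd)).and <|
    primrecPred_exists_lt (hn.comp snd) (primrecRel_mk ?_)
  refine (primrecPred_isAsgQ (hα.comp (snd.comp snd)) fst).not.and <|
    (primrecPred_forall_mem (fst.comp snd) (Primrec.eq.comp
      (primrec_coeffQ fst (fst.comp snd)) (const 0)).primrecRel).and <|
    primrecPred_exists_mem ?_ (Primrec.eq.comp fst (fst.comp (snd.comp snd))).primrecRel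
  exact nat_iterate (hK.comp (snd.comp snd)) (primrec_baseQ.comp (hL.comp (snd.comp snd))
    ((hα.comp (snd.comp snd)).pair fst)) (primrec_resolventsQ.comp (fst.comp fst) snd).to₂

theorem primrecPred_backjumpQ {α α' : σ → TrailQ} {L : σ → List ClauseQ} (hα : Primrec α)
    (hL : Primrec L) (hα' : Primrec α') :
    PrimrecPred fun s => BackjumpQ (α s) (L s) (α' s) := by
  refine (primrecPred_linFalseQ hL hα).and <| (primrecPred_linFalseQ hL hα').not.and <|
    primrecPred_exists_lt (succ.comp (list_length.comp hα)) (primrecRel_mk ?_)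
  refine (Primrec.eq.comp (hα'.comp snd) (list_take.comp fst (hα.comp snd))).and <|
    primrecPred_forall_lt (succ.comp (list_length.comp (hα.comp snd))) (primrecRel_mk ?_)
  exact (nat_le.comp fst (fst.comp snd)).or <| primrecPred_linFalseQ (hL.comp (snd.comp snd))
    (list_take.comp fst (hα.comp (snd.comp snd)))

theorem primrecPred_totalQ {n : σ → ℕ} {α : σ → TrailQ} (hn : Primrec n) (hα : Primrec α) :
    PrimrecPred fun s => TotalQ (n s) (α s) :=
  primrecPred_forall_lt hn (primrecPred_isAsgQ (hα.comp snd) fst).primrecRel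

theorem primrecPred_lineariseQ {K p n : σ → ℕ} {δ : σ → ℚ} {N : σ → List NLData}
    {α : σ → TrailQ} {L L' : σ → List ClauseQ} (hK : Primrec K) (hp : Primrec p)
    (hδ : Primrec δ) (hn : Primrec n) (hN : Primrec N) (hα : Primrec α) (hL : Primrec L)
    (hL' : Primrec L') :
    PrimrecPred fun s => LineariseQ (K s) (p s) (δ s) (n s) (N s) (α s) (L s) (L' s) := by
  refine (primrecPred_linFalseQ hL hα).not.and <| (primrecPred_totalQ hn hα).and <|
    primrecPred_exists_mem hL' (primrecRel_mk ?_)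
  refine (Primrec.eq.comp (hL'.comp snd) (list_cons.comp fst (hL.comp snd))).and <|
    primrecPred_exists_lt (list_length.comp (hN.comp snd)) (primrecRel_mk ?_)
  have s₂ : Primrec fun x : ℕ × ClauseQ × σ => x.2.2 := snd.comp snd
  have s₃ : Primrec fun x : ℕ × ℕ × ClauseQ × σ => x.2.2.2 := snd.comp (snd.comp snd)
  refine (primrecPred_foundQ (hK.comp s₂) (hp.comp s₂) (hδ.comp s₂) (hn.comp s₂) (hα.comp s₂)
    ((list_getD _).comp (hN.comp s₂) fst) (fst.comp snd)).and <|
    primrecPred_forall_lt fst (primrecRel_mk ?_)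
  exact primrecPred_acceptQ (hK.comp s₃) (hp.comp s₃) (hδ.comp s₃) (hα.comp s₃)
    ((list_getD _).comp (hN.comp s₃) fst)

theorem primrecPred_deltaSatQ {K p n : σ → ℕ} {δ : σ → ℚ} {N : σ → List NLData}
    {α : σ → TrailQ} {L : σ → List ClauseQ} (hK : Primrec K) (hp : Primrec p)
    (hδ : Primrec δ) (hn : Primrec n) (hN : Primrec N) (hα : Primrec α) (hL : Primrec L) :
    PrimrecPred fun s => DeltaSatQ (K s) (p s) (δ s) (n s) (N s) (α s) (L s) :=
  (primrecPred_linFalseQ hL hα).not.and <| (primrecPred_totalQ hn hα).and <|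
    primrecPred_forall_mem hN (primrecPred_acceptQ (hK.comp snd) (hp.comp snd) (hδ.comp snd)
      (hα.comp snd) fst).primrecRel

theorem primrec_precQ : Primrec precQ :=
  nat_mul.comp (const 4) (snd.comp (snd.comp primrec_ratData))

theorem primrecPred_stepQ {I : σ → InputQ} {K : σ → ℕ} {s s' : σ → StateQ} (hI : Primrec I)
    (hK : Primrec K) (hs : Primrec s) (hs' : Primrec s') :
    PrimrecPred fun x => StepQ (I x) (K x) (s x) (s' x) := by
  have hδ : Primrec fun x => (I x).1 := fst.comp hI
  have ho : Primrec fun x => (I x).2.1 := fst.comp (snd.comp hI)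
  have hn : Primrec fun x => (I x).2.1.length := list_length.comp ho
  have hN : Primrec fun x => (I x).2.2.2 := snd.comp (snd.comp (snd.comp hI))
  have hp : Primrec fun x => precQ (I x).1 := primrec_precQ.comp hδ
  have hα : Primrec fun x => (s x).2.1 := fst.comp (snd.comp hs)
  have hL : Primrec fun x => (s x).2.2 := snd.comp (snd.comp hs)
  have hα' : Primrec fun x => (s' x).2.1 := fst.comp (snd.comp hs')
  have hL' : Primrec fun x => (s' x).2.2 := snd.comp (snd.comp hs')
  refine (Primrec.eq.comp (fst.comp hs) (const 0)).and (.or ?_ (.or ?_ ?_))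
  · refine (Primrec.eq.comp (fst.comp hs') (const 0)).and (.or ?_ ?_)
    · exact (Primrec.eq.comp hL' hL).and
        ((primrecPred_assignQ ho hα hL hα').or (primrecPred_backjumpQ hα hL hα'))
    · exact (Primrec.eq.comp hα' hα).and
        ((primrecPred_resolveQ hK hn hα hL hL').or
          (primrecPred_lineariseQ hK hp hδ hn hN hα hL hL'))
  · exact (Primrec.eq.comp hs' (const _)).and (primrecPred_linFalseQ hL (const []))
  · exact (Primrec.eq.comp hs' (const _)).and (primrecPred_deltaSatQ hK hp hδ hn hN hα hL)

theorem primrecRel_runQ : PrimrecRel RunQ := by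
  have hc : Primrec fun x : InputQ × List (ℕ × StateQ) => x.2 := snd
  have hlast : Primrec fun x : InputQ × List (ℕ × StateQ) => x.2.length - 1 :=
    nat_sub.comp (list_length.comp snd) (const 1)
  have hl := snd.comp ((list_getD ((0, 3, [], []) : ℕ × StateQ)).comp hc hlast)
  refine .and ?_ (.and ?_ ?_)
  · exact Primrec.eq.comp (snd.comp ((list_getD _).comp hc (const 0)))
      ((const 0).pair ((const []).pair (fst.comp (snd.comp (snd.comp fst)))))
  · refine primrecPred_forall_lt hlast (primrecRel_mk ?_)
    have h₁ := (list_getD ((0, 3, [], []) : ℕ × StateQ)).comp (hc.comp snd)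
      (fst (α := ℕ) (β := InputQ × List (ℕ × StateQ)))
    have h₂ := (list_getD ((0, 3, [], []) : ℕ × StateQ)).comp (hc.comp snd)
      (succ.comp (fst (α := ℕ) (β := InputQ × List (ℕ × StateQ))))
    exact primrecPred_stepQ (fst.comp snd) (fst.comp h₂) (snd.comp h₁) (snd.comp h₂)
  · exact (Primrec.eq.comp hl (const _)).or (Primrec.eq.comp hl (const _))

end

end DeltaKsmt

/-! ### Correspondence between the calculus and its presentation -/

namespace DeltaKsmt

open Nat.Partrec (Code)

variable {n : ℕ}

/-! ### Presentations of literals, clauses, trails and states -/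

def Lit.q (l : Lit n) : LitQ := (List.ofFn l.coeff, l.const, l.strict)

def clauseQ (C : Clause n) : ClauseQ := C.map Lit.q

def trailQ (α : Trail n) : TrailQ := α.map fun e => ((e.1 : ℕ), e.2)

def State.q : State n → StateQ
  | .run α L => (0, trailQ α, L.map clauseQ)
  | .unsat => (1, [], [])
  | .deltaSat => (2, [], [])
  | .sat => (3, [], [])

def Formula.q (F : Formula n) (π : Equiv.Perm (Fin n)) (δ : ℚ) : InputQ :=
  (δ, List.ofFn fun i => (π i : ℕ), F.lin.map clauseQ, F.nl.map NLConstraint.data)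

theorem Lit.q_injective : Function.Injective (Lit.q (n := n)) := by
  rintro ⟨c, d, s⟩ ⟨c', d', s'⟩ h
  simp only [Lit.q, Prod.mk.injEq] at h
  obtain ⟨h1, rfl, rfl⟩ := h
  rw [List.ofFn_injective h1]

@[simp] theorem Lit.q_length (l : Lit n) : l.q.1.length = n := by simp [Lit.q]

theorem Lit.q_getD (l : Lit n) (i : Fin n) : l.q.1.getD i 0 = l.coeff i := by
  simp [Lit.q, List.getD]

theorem forall_lt_fin {Q : ℕ → Prop} : (∀ i < n, Q i) ↔ ∀ i : Fin n, Q i :=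
  ⟨fun h i => h i i.2, fun h i hi => h ⟨i, hi⟩⟩

theorem lookup_trailQ (α : Trail n) (i : Fin n) : (trailQ α).lookup (i : ℕ) = α.asg i := by
  induction α with
  | nil => rfl
  | cons e α ih =>
    obtain ⟨k, q⟩ := e
    by_cases h : i = k
    · subst h; simp [trailQ, Trail.asg]
    · have h1 : (i == k) = false := by simpa using h
      have h2 : ((i : ℕ) == (k : ℕ)) = false := by simpa [Fin.ext_iff] using h
      simp only [trailQ, Trail.asg, List.map_cons, List.lookup, h1, h2] at ih ⊢
      exact ih

theorem isAsgQ_iff (α : Trail n) (i : Fin n) : IsAsgQ (trailQ α) i ↔ (α.asg i).isSome := by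
  rw [IsAsgQ, lookup_trailQ]

theorem not_isAsgQ_iff (α : Trail n) (i : Fin n) : ¬ IsAsgQ (trailQ α) i ↔ α.asg i = none := by
  rw [isAsgQ_iff]; simp

theorem valQ_trailQ (α : Trail n) (i : Fin n) : valQ (trailQ α) i = α.asg.val i := by
  rw [valQ, lookup_trailQ]; rfl

theorem foldr_range_add (f : ℕ → ℚ) (m : ℕ) (c : ℚ) :
    (List.range m).foldr (fun i s => f i + s) c = c + ∑ i ∈ Finset.range m, f i := by
  induction m generalizing c with
  | zero => simp
  | succ m ih => rw [List.range_succ, List.foldr_append, ih, Finset.sum_range_succ]; simp; ring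

theorem litEvalQ_q (l : Lit n) (α : Trail n) : litEvalQ l.q (trailQ α) = l.evalQ α.asg.val := by
  rw [litEvalQ, foldr_range_add, Lit.q_length, Finset.sum_range]
  simp only [Lit.q_getD, valQ_trailQ]
  rfl

theorem litFalseQ_iff (l : Lit n) (α : Trail n) :
    LitFalseQ l.q (trailQ α) ↔ l.FalseAt α.asg := by
  rw [LitFalseQ, Lit.q_length, forall_lt_fin, litEvalQ_q, Lit.FalseAt, Lit.holds_cast]
  simp only [Lit.q_getD, isAsgQ_iff, Lit.Assigned, or_iff_not_imp_left]
  rfl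

theorem clauseFalseQ_iff (C : Clause n) (α : Trail n) :
    ClauseFalseQ (clauseQ C) (trailQ α) ↔ Clause.FalseAt C α.asg := by
  simp [ClauseFalseQ, clauseQ, litFalseQ_iff, Clause.FalseAt]

theorem linFalseQ_iff (L : List (Clause n)) (α : Trail n) :
    LinFalseQ (L.map clauseQ) (trailQ α) ↔ LinFalse L α.asg := by
  simp [LinFalseQ, clauseFalseQ_iff, LinFalse]

theorem totalQ_iff (α : Trail n) : TotalQ n (trailQ α) ↔ α.asg.Total := by
  rw [TotalQ, forall_lt_fin]; simp only [isAsgQ_iff]; rfl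

/-! ### Resolution on presentations -/

theorem range_map_eq_ofFn {β : Type*} (f : ℕ → β) :
    (List.range n).map f = List.ofFn fun i : Fin n => f i := by
  apply List.ext_getElem <;> simp

theorem elimQ_q (z : Fin n) (l₁ l₂ : Lit n) : elimQ z l₁.q l₂.q = (l₁.elim z l₂).q := by
  simp only [elimQ, Lit.q_length, range_map_eq_ofFn, Lit.q_getD]
  rfl

theorem filter_ne_clauseQ (C : Clause n) (l : Lit n) :
    (clauseQ C).filter (fun k => k ≠ l.q) = clauseQ (C.filter fun k => k ≠ l) := by
  simp only [clauseQ, List.filter_map]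
  congr 1
  refine List.filter_congr fun k _ => ?_
  simp [Lit.q_injective.eq_iff]

theorem resolveQ_q (z : Fin n) (C₁ C₂ : Clause n) (l₁ l₂ : Lit n) :
    resolveQ z (clauseQ C₁) (clauseQ C₂) l₁.q l₂.q =
      clauseQ (C₁.filter (fun l => l ≠ l₁) ++ C₂.filter (fun l => l ≠ l₂) ++ [l₁.elim z l₂]) := by
  rw [resolveQ, filter_ne_clauseQ, filter_ne_clauseQ, elimQ_q]
  simp [clauseQ]

theorem clauseVarsQ_iff (C : Clause n) (α : Trail n) (z : Fin n) :
    ClauseVarsQ (clauseQ C) (trailQ α, (z : ℕ)) ↔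
      ∀ l ∈ C, ∀ i, l.coeff i ≠ 0 → i = z ∨ (α.asg i).isSome := by
  have : ∀ l : Lit n, (∀ i < l.q.1.length, l.q.1.getD i 0 = 0 ∨ i = z ∨ IsAsgQ (trailQ α) i) ↔
      ∀ i, l.coeff i ≠ 0 → i = z ∨ (α.asg i).isSome := by
    intro l
    rw [Lit.q_length, forall_lt_fin]
    simp only [Lit.q_getD, isAsgQ_iff, or_iff_not_imp_left (a := l.coeff _ = 0), Fin.ext_iff,
      ne_eq]
  simp only [ClauseVarsQ, clauseQ, List.forall_mem_map, this]

theorem mem_resolventsQ {z : ℕ} {S : List ClauseQ} {D : ClauseQ} :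
    D ∈ resolventsQ z S ↔ D ∈ S ∨ ∃ C₁ ∈ S, ∃ C₂ ∈ S, ∃ l₁ ∈ C₁, ∃ l₂ ∈ C₂,
      (0 < l₁.1.getD z 0 ∧ 0 < -(l₂.1.getD z 0)) ∧ D = resolveQ z C₁ C₂ l₁ l₂ := by
  simp only [resolventsQ, List.mem_append, List.mem_flatMap, List.mem_ite_nil_right,
    List.mem_singleton]

/-- Nothing spurious arises on raw data: every list produced by the rounds presents a genuinely
derived clause. -/
theorem derives_of_mem_iterate {α : Trail n} {L : List (Clause n)} {z : Fin n} (K : ℕ)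
    {D : ClauseQ} (hD : D ∈ (resolventsQ z)^[K] (baseQ (L.map clauseQ) (trailQ α, (z : ℕ)))) :
    ∃ C, clauseQ C = D ∧ Derives α.asg L z C := by
  induction K generalizing D with
  | zero =>
    simp only [Function.iterate_zero, id, baseQ, List.mem_filter, List.mem_map,
      decide_eq_true_eq] at hD
    obtain ⟨⟨C, hC, rfl⟩, hv⟩ := hD
    exact ⟨C, rfl, .base C hC ((clauseVarsQ_iff C α z).1 hv)⟩
  | succ K ih =>
    rw [Function.iterate_succ_apply', mem_resolventsQ] at hD
    rcases hD with hD | ⟨C₁, h₁, C₂, h₂, l₁, hl₁, l₂, hl₂, hpos, rfl⟩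
    · exact ih hD
    · obtain ⟨C₁, rfl, d₁⟩ := ih h₁
      obtain ⟨C₂, rfl, d₂⟩ := ih h₂
      obtain ⟨l₁, hk₁, rfl⟩ := List.mem_map.1 hl₁
      obtain ⟨l₂, hk₂, rfl⟩ := List.mem_map.1 hl₂
      rw [Lit.q_getD, Lit.q_getD] at hpos
      exact ⟨_, (resolveQ_q z C₁ C₂ l₁ l₂).symm,
        .resolve C₁ C₂ l₁ l₂ d₁ d₂ hk₁ hk₂ hpos.1 (neg_pos.1 hpos.2)⟩

theorem iterate_resolventsQ_mono {z : ℕ} {S : List ClauseQ} {D : ClauseQ} {K K' : ℕ}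
    (h : K ≤ K') (hD : D ∈ (resolventsQ z)^[K] S) : D ∈ (resolventsQ z)^[K'] S := by
  induction h with
  | refl => exact hD
  | step _ ih => rw [Function.iterate_succ_apply', mem_resolventsQ]; exact Or.inl ih

/-- Rounds keep all earlier clauses, so the larger of the numbers for the two parents, plus one,
suffices. -/
theorem Derives.exists_mem_iterate {α : Trail n} {L : List (Clause n)} {z : Fin n} {C : Clause n}
    (h : Derives α.asg L z C) :
    ∃ K, clauseQ C ∈ (resolventsQ z)^[K] (baseQ (L.map clauseQ) (trailQ α, (z : ℕ))) := by
  induction h with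
  | base C hC hv =>
    refine ⟨0, ?_⟩
    simp only [Function.iterate_zero, id, baseQ, List.mem_filter, decide_eq_true_eq]
    exact ⟨List.mem_map_of_mem hC, (clauseVarsQ_iff C α z).2 hv⟩
  | resolve C₁ C₂ l₁ l₂ _ _ hl₁ hl₂ hpos hneg ih₁ ih₂ =>
    obtain ⟨K₁, h₁⟩ := ih₁
    obtain ⟨K₂, h₂⟩ := ih₂
    refine ⟨max K₁ K₂ + 1, ?_⟩
    rw [Function.iterate_succ_apply', mem_resolventsQ]
    refine Or.inr ⟨_, iterate_resolventsQ_mono (le_max_left _ _) h₁, _,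
      iterate_resolventsQ_mono (le_max_right _ _) h₂, l₁.q, List.mem_map_of_mem hl₁, l₂.q,
      List.mem_map_of_mem hl₂, ?_, (resolveQ_q z C₁ C₂ l₁ l₂).symm⟩
    rw [Lit.q_getD, Lit.q_getD]
    exact ⟨hpos, neg_pos.2 hneg⟩

/-! ### Linearisation on presentations -/

/-- A constant name has the same code at every query, so its member `0` determines the oracle.
`decode₂` accepts exactly the codes of rationals, which gives an equivalence. -/
theorem mem_machineQ_iff {K p : ℕ} {α : Trail n} {P : NLConstraint n} {y : ℚ} :
    machineQ K p (trailQ α) P.data = some y ↔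
      ratCode y ∈ Code.evaln K
        (P.machine.subst (nameOracle (fun _ j => α.asg.val (P.args j)) 0)) p := by
  have hv : Encodable.encode (P.data.1.map fun i => ratData (valQ (trailQ α) i)) =
      nameOracle (fun _ j => α.asg.val (P.args j)) 0 := by
    simp only [NLConstraint.data, nameOracle, List.map_ofFn]
    congr 2
    funext j
    simp [valQ_trailQ]
  rw [machineQ, hv]
  have : P.data.2.2.1 = P.machine.toNat := rfl
  rw [this, substNat_toNat]
  simp only [Option.bind_eq_some_iff]
  constructor
  · rintro ⟨o, ho, hy⟩
    have := (@Encodable.mem_decode₂ ℚ ratPrimcodable.toEncodable _ _).1 hy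
    rw [encode_rat] at this
    rwa [this]
  · intro h
    exact ⟨_, h, (@Encodable.mem_decode₂ ℚ ratPrimcodable.toEncodable _ _).2 (encode_rat y)⟩

theorem eval_of_machineQ {K p : ℕ} {α : Trail n} {P : NLConstraint n} {y : ℚ}
    (h : machineQ K p (trailQ α) P.data = some y) :
    ratCode y ∈ P.machine.eval (nameOracle fun _ j => α.asg.val (P.args j)) p := by
  have := Code.evaln_sound (mem_machineQ_iff.1 h)
  rwa [OCode.eval_subst] at this

theorem machineQ_of_eval {p : ℕ} {α : Trail n} {P : NLConstraint n} {y : ℚ}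
    (h : ratCode y ∈ P.machine.eval (nameOracle fun _ j => α.asg.val (P.args j)) p) :
    ∃ K₀, ∀ K ≥ K₀, machineQ K p (trailQ α) P.data = some y := by
  have h' : ratCode y ∈
      (P.machine.subst (nameOracle (fun _ j => α.asg.val (P.args j)) 0)).eval p := by
    rw [OCode.eval_subst]; exact h
  obtain ⟨K₀, hK₀⟩ := Code.evaln_complete.1 h'
  exact ⟨K₀, fun K hK => mem_machineQ_iff.2 (Code.evaln_mono hK hK₀)⟩

theorem relQ_iff {K p : ℕ} {δ : ℚ} {α : Trail n} {P : NLConstraint n} {y : ℚ}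
    (h : machineQ K p (trailQ α) P.data = some y) :
    RelQ K p δ (trailQ α) P.data ↔ RelZero P.strict ((y : ℝ) + δ / 2) := by
  have : ((y : ℝ) + δ / 2) = ((y + δ * 2⁻¹ : ℚ) : ℝ) := by push_cast; ring
  rw [RelQ, h, this, relZero_cast]
  rfl

theorem Linearise.of_acceptQ {K p : ℕ} {δ : ℚ} {α : Trail n} {P : NLConstraint n}
    (h : AcceptQ K p δ (trailQ α) P.data) : Linearise δ p α.asg.val P none := by
  obtain ⟨y, hy⟩ := Option.isSome_iff_exists.1 h.1
  exact .accept y (eval_of_machineQ hy) ((relQ_iff hy).1 h.2)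

theorem boxClauseQ_eq (P : NLConstraint n) (α : Trail n) (m : ℕ) :
    boxClauseQ n P.data.1 (trailQ α) m = clauseQ (boxClause P α.asg.val (2⁻¹ ^ m)) := by
  have hs : ∀ (i : Fin n) (c : ℚ), singleQ n i c = List.ofFn (Pi.single i c : Fin n → ℚ) := by
    intro i c
    rw [singleQ, range_map_eq_ofFn]
    congr 1
    funext j
    simp [Pi.single_apply, Fin.ext_iff]
  simp only [boxClauseQ, boxClause, clauseQ, NLConstraint.data, List.map_append, List.map_ofFn]
  congr 2 <;> funext j <;> simp [hs, valQ_trailQ, Lit.q, sub_eq_add_neg]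

theorem Linearise.of_foundQ {K p : ℕ} {δ : ℚ} {α : Trail n} {P : NLConstraint n} {D : ClauseQ}
    (h : FoundQ K p δ n (trailQ α) P.data D) :
    ∃ C, D = clauseQ C ∧ Linearise δ p α.asg.val P (some C) := by
  obtain ⟨h1, h2, h3, rfl⟩ := h
  obtain ⟨y, hy⟩ := Option.isSome_iff_exists.1 h1
  obtain ⟨m, hm⟩ := Option.isSome_iff_exists.1 h3
  refine ⟨_, boxClauseQ_eq P α _, .box y (eval_of_machineQ hy) (fun h => h2 ((relQ_iff hy).2 h)) _
    ?_⟩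
  rw [hm]
  exact Code.evaln_sound hm

/-- The claim covers all sufficiently large fuels, so that finitely many constraints can later share
one fuel. -/
theorem Linearise.acceptQ {p : ℕ} {δ : ℚ} {α : Trail n} {P : NLConstraint n}
    (h : Linearise δ p α.asg.val P none) : ∃ K₀, ∀ K ≥ K₀, AcceptQ K p δ (trailQ α) P.data := by
  cases h with
  | accept y hy hrel =>
    obtain ⟨K₀, hK₀⟩ := machineQ_of_eval hy
    exact ⟨K₀, fun K hK => ⟨by rw [hK₀ K hK]; rfl, (relQ_iff (hK₀ K hK)).2 hrel⟩⟩

theorem Linearise.foundQ {p : ℕ} {δ : ℚ} {α : Trail n} {P : NLConstraint n} {C : Clause n}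
    (h : Linearise δ p α.asg.val P (some C)) :
    ∃ K₀, ∀ K ≥ K₀, FoundQ K p δ n (trailQ α) P.data (clauseQ C) := by
  cases h with
  | box y hy hrel m hm =>
    obtain ⟨K₀, hK₀⟩ := machineQ_of_eval hy
    obtain ⟨K₁, hK₁⟩ := Code.evaln_complete.1 hm
    refine ⟨max K₀ K₁, fun K hK => ?_⟩
    have hy' := hK₀ K ((le_max_left _ _).trans hK)
    have hm' : Code.evaln K P.data.2.2.2 p = some m :=
      Code.evaln_mono ((le_max_right _ _).trans hK) hK₁
    refine ⟨by rw [hy']; rfl, fun h => hrel ((relQ_iff hy').1 h), by rw [hm']; rfl, ?_⟩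
    rw [hm', boxClauseQ_eq]
    rfl

theorem NlinLoop.of_foundQ {K p : ℕ} {δ : ℚ} {α : Trail n} {d : NLData} {D : ClauseQ}
    (N : List (NLConstraint n)) (i : ℕ) (hi : i < N.length)
    (hD : FoundQ K p δ n (trailQ α) ((N.map NLConstraint.data).getD i d) D)
    (hacc : ∀ j < i, AcceptQ K p δ (trailQ α) ((N.map NLConstraint.data).getD j d)) :
    ∃ C, D = clauseQ C ∧ NlinLoop δ p α.asg.val N (some C) := by
  induction N generalizing i with
  | nil => simp at hi
  | cons P N ih =>
    cases i with
    | zero =>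
      obtain ⟨C, rfl, hC⟩ := Linearise.of_foundQ (P := P) (by simpa using hD)
      exact ⟨C, rfl, .found P N C hC⟩
    | succ i =>
      obtain ⟨C, rfl, hC⟩ := ih i (by simpa using hi) (by simpa using hD)
        fun j hj => by simpa using hacc (j + 1) (by omega)
      refine ⟨C, rfl, .next P N _ (Linearise.of_acceptQ (K := K) ?_) hC⟩
      simpa using hacc 0 (by omega)

theorem NlinLoop.of_forall_acceptQ {K p : ℕ} {δ : ℚ} {α : Trail n} (N : List (NLConstraint n))
    (h : ∀ P ∈ N.map NLConstraint.data, AcceptQ K p δ (trailQ α) P) :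
    NlinLoop δ p α.asg.val N none := by
  induction N with
  | nil => exact .done
  | cons P N ih =>
    simp only [List.map_cons, List.forall_mem_cons] at h
    exact .next P N _ (Linearise.of_acceptQ h.1) (ih h.2)

theorem NlinLoop.acceptQ {p : ℕ} {δ : ℚ} {α : Trail n} {N : List (NLConstraint n)}
    (h : ∀ P ∈ N, Linearise δ p α.asg.val P none) :
    ∃ K₀, ∀ K ≥ K₀, ∀ P ∈ N.map NLConstraint.data, AcceptQ K p δ (trailQ α) P := by
  induction N with
  | nil => exact ⟨0, by simp⟩
  | cons P N ih =>
    simp only [List.forall_mem_cons] at h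
    obtain ⟨K₀, h₀⟩ := h.1.acceptQ
    obtain ⟨K₁, h₁⟩ := ih h.2
    refine ⟨max K₀ K₁, fun K hK => ?_⟩
    simp only [List.map_cons, List.forall_mem_cons]
    exact ⟨h₀ K ((le_max_left _ _).trans hK), h₁ K ((le_max_right _ _).trans hK)⟩

theorem NlinLoop.foundQ {p : ℕ} {δ : ℚ} {α : Trail n} {N : List (NLConstraint n)}
    {r : Option (Clause n)} (d : NLData) (h : NlinLoop δ p α.asg.val N r) {C : Clause n}
    (hr : r = some C) : ∃ K₀, ∀ K ≥ K₀, ∃ i < (N.map NLConstraint.data).length,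
      FoundQ K p δ n (trailQ α) ((N.map NLConstraint.data).getD i d) (clauseQ C) ∧
        ∀ j < i, AcceptQ K p δ (trailQ α) ((N.map NLConstraint.data).getD j d) := by
  induction h with
  | done => simp at hr
  | found P N C' h =>
    cases hr
    obtain ⟨K₀, h₀⟩ := h.foundQ
    exact ⟨K₀, fun K hK => ⟨0, by simp, by simpa using h₀ K hK, by simp⟩⟩
  | next P N r h _ ih =>
    obtain ⟨K₀, h₀⟩ := h.acceptQ
    obtain ⟨K₁, h₁⟩ := ih hr
    refine ⟨max K₀ K₁, fun K hK => ?_⟩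
    obtain ⟨i, hi, hf, ha⟩ := h₁ K ((le_max_right _ _).trans hK)
    refine ⟨i + 1, by simpa using hi, by simpa using hf, fun j hj => ?_⟩
    cases j with
    | zero => simpa using h₀ K ((le_max_left _ _).trans hK)
    | succ j => simpa using ha j (by omega)

end DeltaKsmt

namespace DeltaKsmt

open Nat.Partrec (Code)

variable {n : ℕ}

/-! ### Steps and runs on presentations -/

theorem trailQ_append (α γ : Trail n) : trailQ (α ++ γ) = trailQ α ++ trailQ γ :=
  List.map_append

theorem trailQ_take (α : Trail n) (k : ℕ) : trailQ (α.take k) = (trailQ α).take k :=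
  List.map_take

theorem trailQ_length (α : Trail n) : (trailQ α).length = List.length α := by simp [trailQ]

section
variable {F : Formula n} {π : Equiv.Perm (Fin n)} {δ : ℚ}

theorem Formula.q_length : (F.q π δ).2.1.length = n := by simp [Formula.q]

theorem Formula.q_getD (i : Fin n) : (F.q π δ).2.1.getD i 0 = (π i : ℕ) := by
  simp [Formula.q, List.getD]

theorem isNext_iff {α : Trail n} (k : Fin n) :
    IsNext π α (π k) ↔ ¬ IsAsgQ (trailQ α) (π k) ∧
      ∀ j < (k : ℕ), IsAsgQ (trailQ α) ((F.q π δ).2.1.getD j 0) := by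
  rw [not_isAsgQ_iff, IsNext, Equiv.symm_apply_apply]
  refine and_congr_right fun _ => ⟨fun h j hj => ?_, fun h i hi => ?_⟩
  · have := h (π ⟨j, hj.trans k.2⟩) (by rw [Equiv.symm_apply_apply]; exact hj)
    have e := F.q_getD (π := π) (δ := δ) ⟨j, hj.trans k.2⟩
    dsimp only at e
    rwa [e, isAsgQ_iff]
  · have := h (π.symm i) hi
    rwa [Formula.q_getD, isAsgQ_iff, Equiv.apply_symm_apply] at this

theorem State.eq_run_of_q {s : State n} (h : s.q.1 = 0) : ∃ α L, s = .run α L := by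
  cases s with
  | run α L => exact ⟨α, L, rfl⟩
  | unsat => simp [State.q] at h
  | deltaSat => simp [State.q] at h
  | sat => simp [State.q] at h

/-- The target `t` is arbitrary raw data; passing the test forces it to present a state. Hence a
search over raw data can find only genuine runs. -/
theorem StepQ.effStep {K : ℕ} {s : State n} {t : StateQ} (h : StepQ (F.q π δ) K s.q t) :
    ∃ s', t = State.q s' ∧ EffStep F π δ (precQ δ) s s' := by
  obtain ⟨h0, h⟩ := h
  obtain ⟨α, L, rfl⟩ := State.eq_run_of_q h0
  obtain ⟨b, α', L'⟩ := t
  simp only [State.q, Formula.q_length] at h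
  rcases h with ⟨rfl, ⟨rfl, h | h⟩ | ⟨rfl, h | h⟩⟩ | ⟨h, hf⟩ | ⟨h, hd⟩
  · obtain ⟨hL, hL', e, -, rfl, hz, k, hk, hke, hj⟩ := h
    rw [Formula.q_length] at hk
    obtain ⟨e, q⟩ := e
    have hke' : e = (π ⟨k, hk⟩ : ℕ) := by
      rw [← Formula.q_getD (F := F) (δ := δ)]; exact hke.symm
    subst hke'
    have e1 : trailQ α ++ [((π ⟨k, hk⟩ : ℕ), q)] = trailQ (α ++ [(π ⟨k, hk⟩, q)]) := by
      rw [trailQ_append]; rfl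
    rw [e1] at hL' ⊢
    exact ⟨.run _ L, rfl, .assign α L _ q (mt (linFalseQ_iff L α).2 hL)
      ((isNext_iff ⟨k, hk⟩).2 ⟨hz, hj⟩) (mt (linFalseQ_iff L _).2 hL')⟩
  · obtain ⟨hL, hL', k, -, rfl, hj⟩ := h
    rw [← trailQ_take] at hL' ⊢
    refine ⟨.run (α.take k) L, rfl, .backjump α L k ((linFalseQ_iff L α).1 hL)
      (mt (linFalseQ_iff L _).2 hL') fun j hjl hkj => ?_⟩
    have := (hj j (by rw [trailQ_length]; omega)).resolve_left (not_le.2 hkj)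
    rwa [← trailQ_take, linFalseQ_iff] at this
  · obtain ⟨hL, D, -, rfl, hD, z, hz, hza, hDz, _, hmem, rfl⟩ := h
    obtain ⟨C, rfl, hC⟩ := derives_of_mem_iterate (z := ⟨z, hz⟩) K hmem
    refine ⟨.run α (C :: L), rfl, .resolve α L ⟨z, hz⟩ C (mt (linFalseQ_iff L α).2 hL)
      ((not_isAsgQ_iff α ⟨z, hz⟩).1 hza) hC (fun l hl => ?_) ((clauseFalseQ_iff C α).1 hD)⟩
    rw [← Lit.q_getD]
    exact hDz l.q (List.mem_map_of_mem hl)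
  · obtain ⟨hL, hT, D, -, rfl, i, hi, hf, ha⟩ := h
    obtain ⟨C, rfl, hC⟩ := NlinLoop.of_foundQ F.nl i (by simpa [Formula.q] using hi) hf ha
    exact ⟨.run α (C :: L), rfl, .linearise α L C ((totalQ_iff α).1 hT)
      (mt (linFalseQ_iff L α).2 hL) hC⟩
  · exact ⟨.unsat, h, .unsat α L ((linFalseQ_iff L []).1 hf)⟩
  · obtain ⟨hL, hT, ha⟩ := hd
    exact ⟨.deltaSat, h, .deltaSat α L ((totalQ_iff α).1 hT) (mt (linFalseQ_iff L α).2 hL)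
      (NlinLoop.of_forall_acceptQ F.nl ha)⟩

theorem EffStep.stepQ {s s' : State n} (h : EffStep F π δ (precQ δ) s s') :
    ∃ K, StepQ (F.q π δ) K s.q s'.q := by
  cases h with
  | assign α L z q hL hz hq =>
    refine ⟨0, rfl, Or.inl ⟨rfl, Or.inl ⟨rfl, Or.inl ⟨mt (linFalseQ_iff L α).1 hL,
      mt (linFalseQ_iff L _).1 hq, ((z : ℕ), q), ?_, ?_, ?_⟩⟩⟩⟩
    · simp [State.q, trailQ]
    · simp [State.q, trailQ]
    · have h := (isNext_iff (F := F) (δ := δ) (π := π) (α := α) (π.symm z)).1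
        (by rwa [Equiv.apply_symm_apply])
      rw [Equiv.apply_symm_apply] at h
      refine ⟨h.1, (π.symm z : ℕ), by rw [Formula.q_length]; exact (π.symm z).2, ?_, h.2⟩
      rw [Formula.q_getD, Equiv.apply_symm_apply]
  | resolve α L z C hL hz hC hCz hCf =>
    obtain ⟨K, hK⟩ := hC.exists_mem_iterate
    refine ⟨K, rfl, Or.inl ⟨rfl, Or.inr ⟨rfl, Or.inl ⟨mt (linFalseQ_iff L α).1 hL, clauseQ C,
      by simp [State.q], rfl, (clauseFalseQ_iff C α).2 hCf, z, ?_,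
      (not_isAsgQ_iff α z).2 hz, ?_, _, hK, rfl⟩⟩⟩⟩
    · rw [Formula.q_length]; exact z.2
    · intro l hl
      obtain ⟨l, hl', rfl⟩ := List.mem_map.1 hl
      rw [Lit.q_getD]
      exact hCz l hl'
  | backjump α L k hL hγ hmax =>
    -- For larger `k` the prefix would be `α` itself, under which `L` is false.
    have hk : k ≤ List.length α := by
      by_contra hk
      rw [List.take_of_length_le (by omega)] at hγ
      exact hγ hL
    refine ⟨0, rfl, Or.inl ⟨rfl, Or.inl ⟨rfl, Or.inr ⟨(linFalseQ_iff L α).2 hL,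
      mt (linFalseQ_iff L _).1 hγ, k, ?_, trailQ_take α k, fun j hj => ?_⟩⟩⟩⟩
    · simp only [State.q, trailQ_length]; omega
    · simp only [State.q, trailQ_length] at hj
      by_cases hjk : j ≤ k
      · exact Or.inl hjk
      · right
        have := (linFalseQ_iff L _).2 (hmax j (by omega) (not_le.1 hjk))
        rwa [trailQ_take] at this
  | linearise α L C hα hL hC =>
    obtain ⟨K, hK⟩ := hC.foundQ ([], false, 0, Code.zero) rfl
    refine ⟨K, rfl, Or.inl ⟨rfl, Or.inr ⟨rfl, Or.inr ⟨mt (linFalseQ_iff L α).1 hL, ?_, clauseQ C,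
      by simp [State.q], rfl, ?_⟩⟩⟩⟩
    · rw [Formula.q_length]; exact (totalQ_iff α).2 hα
    · rw [Formula.q_length]; exact hK K le_rfl
  | deltaSat α L hα hL hN =>
    obtain ⟨K, hK⟩ := NlinLoop.acceptQ (hN.forall_of_none rfl)
    refine ⟨K, rfl, Or.inr (Or.inr ⟨rfl, mt (linFalseQ_iff L α).1 hL, ?_, hK K le_rfl⟩)⟩
    rw [Formula.q_length]; exact (totalQ_iff α).2 hα
  | unsat α L hL => exact ⟨0, rfl, Or.inr (Or.inl ⟨rfl, (linFalseQ_iff L []).2 hL⟩)⟩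

/-- Consecutive entries of a run. -/
def StepsToQ (I : InputQ) (x y : ℕ × StateQ) : Prop := StepQ I y.1 x.2 y.2

/-- The default entry in `RunQ` has state number `3`, neither initial nor an accepted final number,
so the empty list does not pass as a run. -/
theorem runQ_iff {I : InputQ} {c : List (ℕ × StateQ)} :
    RunQ I c ↔ (∃ k c', c = (k, 0, [], I.2.2.1) :: c') ∧ c.IsChain (StepsToQ I) ∧
      ((c.getLast?.map Prod.snd = some (1, [], [])) ∨
        (c.getLast?.map Prod.snd = some (2, [], []))) := by
  cases c with
  | nil => simp [RunQ]
  | cons x c =>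
    have hlast : ((x :: c).getLast?).map Prod.snd =
        some ((x :: c).getD ((x :: c).length - 1) (0, 3, [], [])).2 := by
      rw [List.getLast?_eq_getElem?, List.getD]
      simp
    rw [hlast, Option.some.injEq, Option.some.injEq, RunQ, List.isChain_iff_getElem]
    refine and_congr ?_ (and_congr ?_ Iff.rfl)
    · obtain ⟨k, x⟩ := x
      simp
    · refine forall_congr' fun i => ?_
      constructor
      · intro h hi
        have := h (by omega)
        rw [List.getD_eq_getElem _ _ hi, List.getD_eq_getElem _ _ (by omega)] at this
        exact this
      · intro h hi
        have := h (by omega)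
        rw [List.getD_eq_getElem _ _ (by omega : i + 1 < (x :: c).length),
          List.getD_eq_getElem _ _ (by omega)]
        exact this

theorem isChain_stepsToQ {k : ℕ} {s : State n} {c : List (ℕ × StateQ)}
    (h : ((k, s.q) :: c).IsChain (StepsToQ (F.q π δ))) :
    ∃ r : List (State n), c.map Prod.snd = r.map State.q ∧
      (s :: r).IsChain (EffStep F π δ (precQ δ)) := by
  induction c generalizing k s with
  | nil => exact ⟨[], rfl, .singleton s⟩
  | cons y c ih =>
    rw [List.isChain_cons_cons] at h
    obtain ⟨k', t⟩ := y
    obtain ⟨s', rfl, hs'⟩ := StepQ.effStep h.1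
    obtain ⟨r, hr, hch⟩ := ih h.2
    exact ⟨s' :: r, by simp [hr], .cons_cons hs' hch⟩

theorem exists_isChain_stepsToQ {s : State n} {r : List (State n)}
    (h : (s :: r).IsChain (EffStep F π δ (precQ δ))) :
    ∃ c : List (ℕ × StateQ), c.map Prod.snd = r.map State.q ∧
      ∀ k, ((k, s.q) :: c).IsChain (StepsToQ (F.q π δ)) := by
  induction r generalizing s with
  | nil => exact ⟨[], rfl, fun k => .singleton _⟩
  | cons s' r ih =>
    rw [List.isChain_cons_cons] at h
    obtain ⟨c, hc, hch⟩ := ih h.2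
    obtain ⟨K, hK⟩ := h.1.stepQ
    exact ⟨(K, s'.q) :: c, by simp [hc], fun k => .cons_cons hK (hch K)⟩

theorem State.eq_of_q {s : State n} : (s.q = (1, [], []) → s = .unsat) ∧
    (s.q = (2, [], []) → s = .deltaSat) := by
  cases s <;> simp [State.q]

theorem RunQ.exists_run {c : List (ℕ × StateQ)} (h : RunQ (F.q π δ) c) :
    ∃ r : List (State n), c.map Prod.snd = r.map State.q ∧ r.head? = some F.init ∧
      r.IsChain (EffStep F π δ (precQ δ)) ∧
      (r.getLast? = some .unsat ∨ r.getLast? = some .deltaSat) := by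
  rw [runQ_iff] at h
  obtain ⟨⟨k, c, rfl⟩, hch, hlast⟩ := h
  change (((k, F.init.q) :: c).getLast?.map Prod.snd = _ ∨
    ((k, F.init.q) :: c).getLast?.map Prod.snd = _) at hlast
  obtain ⟨r, hr, hch⟩ := isChain_stepsToQ (s := F.init) hch
  have hmap : ((k, F.init.q) :: c).map Prod.snd = (F.init :: r).map State.q := by simp [hr]
  refine ⟨F.init :: r, hmap, rfl, hch, ?_⟩
  rw [← List.getLast?_map, hmap, List.getLast?_map] at hlast
  rcases hlast with h | h
  · obtain ⟨s, hs, hq⟩ := Option.map_eq_some_iff.1 h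
    exact Or.inl (by rw [hs, State.eq_of_q.1 hq])
  · obtain ⟨s, hs, hq⟩ := Option.map_eq_some_iff.1 h
    exact Or.inr (by rw [hs, State.eq_of_q.2 hq])

theorem exists_runQ {r : List (State n)} (h₀ : r.head? = some F.init)
    (hch : r.IsChain (EffStep F π δ (precQ δ)))
    (hlast : r.getLast? = some .unsat ∨ r.getLast? = some .deltaSat) :
    ∃ c, RunQ (F.q π δ) c := by
  cases r with
  | nil => simp at h₀
  | cons s r =>
    simp only [List.head?_cons, Option.some.injEq] at h₀
    subst h₀
    obtain ⟨c, hc, hch'⟩ := exists_isChain_stepsToQ hch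
    refine ⟨(0, F.init.q) :: c, runQ_iff.2 ⟨⟨0, c, rfl⟩, hch' 0, ?_⟩⟩
    have hmap : ((0, F.init.q) :: c).map Prod.snd = (F.init :: r).map State.q := by simp [hc]
    rw [← List.getLast?_map, hmap, List.getLast?_map]
    rcases hlast with h | h
    · exact Or.inl (by rw [h]; rfl)
    · exact Or.inr (by rw [h]; rfl)

end

/-! ### The algorithm -/

def litOfData (l : LitData) : LitQ := (l.1.map toRat, toRat l.2.1, l.2.2)

def litToData (l : LitQ) : LitData := (l.1.map ratData, ratData l.2.1, l.2.2)

def inputOfData (I : InputData) : InputQ :=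
  (toRat I.1, I.2.1, I.2.2.1.map fun C => C.map litOfData, I.2.2.2)

/-- In `StateQ` the number `0` marks non-final states, so the numbers of final states are shifted by
one. -/
def stateToData (s : StateQ) : StateData :=
  if s.1 = 0 then
    .inl (s.2.1.map fun e => (e.1, ratData e.2), s.2.2.map fun C => C.map litToData)
  else .inr (s.1 - 1)

theorem litOfData_data {n : ℕ} (l : Lit n) : litOfData l.data = l.q := by
  simp [litOfData, Lit.data, Lit.q, Function.comp_def, toRat_ratData]

theorem litToData_q {n : ℕ} (l : Lit n) : litToData l.q = l.data := by
  simp [litToData, Lit.data, Lit.q, Function.comp_def]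

theorem inputOfData_data (F : Formula n) (π : Equiv.Perm (Fin n)) (δ : ℚ) :
    inputOfData (F.data π δ) = F.q π δ := by
  simp [inputOfData, Formula.data, Formula.q, toRat_ratData, clauseQ, Clause.data,
    Function.comp_def, litOfData_data]

theorem stateToData_q (s : State n) : stateToData s.q = s.data := by
  cases s <;>
  simp [stateToData, State.q, State.data, clauseQ, Clause.data, trailQ, Function.comp_def,
    litToData_q]

section
open Primrec

theorem primrec_litOfData : Primrec litOfData :=
  (list_map fst (primrec_toRat.comp snd).to₂).pair
    ((primrec_toRat.comp (fst.comp snd)).pair (snd.comp snd))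

theorem primrec_litToData : Primrec litToData :=
  (list_map fst (primrec_ratData.comp snd).to₂).pair
    ((primrec_ratData.comp (fst.comp snd)).pair (snd.comp snd))

theorem primrec_inputOfData : Primrec inputOfData :=
  (primrec_toRat.comp fst).pair <| (fst.comp snd).pair <|
    (list_map (fst.comp (snd.comp snd))
      (list_map snd (primrec_litOfData.comp snd).to₂).to₂).pair (snd.comp (snd.comp snd))

theorem primrec_stateToData : Primrec stateToData := by
  refine Primrec.ite (Primrec.eq.comp fst (const 0)) (sumInl.comp (.pair ?_ ?_))
    (sumInr.comp (nat_sub.comp fst (const 1)))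
  · exact list_map (fst.comp snd)
      ((fst.comp snd).pair (primrec_ratData.comp (snd.comp snd))).to₂
  · exact list_map (snd.comp snd) (list_map snd (primrec_litToData.comp snd).to₂).to₂

end

open Classical in
/-- The result for the run with number `k`, if it is a complete run for the input. -/
noncomputable def execStage (I : InputData) (k : ℕ) : Option (ℕ × List StateData) :=
  (@Encodable.decode (List (ℕ × StateQ)) Primcodable.toEncodable k).bind fun c =>
    if RunQ (inputOfData I) c then
      some (precQ (inputOfData I).1, c.map fun x => stateToData x.2)
    else none

open Primrec in
theorem primrec_execStage : Primrec₂ execStage := by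
  classical
  refine option_bind (Primrec.decode.comp snd) (Primrec₂.mk ?_)
  have hI : Primrec fun x : (InputData × ℕ) × List (ℕ × StateQ) => inputOfData x.1.1 :=
    primrec_inputOfData.comp (fst.comp fst)
  refine Primrec.ite (primrecRel_runQ.comp hI snd) (option_some.comp (.pair ?_ ?_)) (const none)
  · exact primrec_precQ.comp (fst.comp hI)
  · exact list_map snd (primrec_stateToData.comp (snd.comp snd)).to₂

/-- A positive rational is at least the reciprocal of its denominator `d`, and `2 ^ (4 * d) ≥ 4 *
d`. No logarithm need be computed. -/
theorem precise_precQ {δ : ℚ} (hδ : 0 < δ) : Precise δ (precQ δ) := by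
  rw [precise_iff hδ]
  have hd : (0 : ℝ) < δ.den := by exact_mod_cast δ.den_pos
  have h1 : (4 * δ.den : ℝ) ≤ 2 ^ precQ δ := by
    exact_mod_cast (Nat.lt_two_pow_self (n := 4 * δ.den)).le
  have h2 : (1 : ℝ) / δ.den ≤ δ := by
    have hn : (1 : ℝ) ≤ δ.num := by exact_mod_cast Rat.num_pos.2 hδ
    have : (δ : ℝ) = (δ.num : ℝ) / δ.den := by exact_mod_cast (Rat.num_div_den δ).symm
    rw [this]
    gcongr
  calc (2⁻¹ : ℝ) ^ precQ δ = 1 / 2 ^ precQ δ := by rw [inv_pow, one_div]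
    _ ≤ 1 / (4 * δ.den) := one_div_le_one_div_of_le (by positivity) h1
    _ = 1 / δ.den / 4 := by field_simp
    _ ≤ δ / 4 := by linarith

/-- Unbounded search through all codes of fuelled lists of states. It halts since an effective run
exists; whichever complete run it meets first is converted back into a run of the calculus. -/
theorem exists_algorithm :
    ∃ exec : InputData →. ℕ × List StateData, Partrec exec ∧
      ∀ (n : ℕ) (F : Formula n) (π : Equiv.Perm (Fin n)) (δ : ℚ),
        0 < δ → F.BoundedInstance → F.WellPresented →
          ∃ (p : ℕ) (r : List (State n)), Precise δ p ∧
            (p, r.map State.data) ∈ exec (F.data π δ) ∧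
            r.head? = some F.init ∧ r.IsChain (Step F π δ p) ∧
            (r.getLast? = some State.unsat ∨ r.getLast? = some State.deltaSat) := by
  refine ⟨fun I => Nat.rfindOpt (execStage I), Partrec.rfindOpt primrec_execStage.to_comp, ?_⟩
  intro n F π δ hδ hb hw
  have hp := precise_precQ hδ
  have hdom : (Nat.rfindOpt (execStage (F.data π δ))).Dom := by
    obtain ⟨r, h₀, hch, hlast⟩ := exists_effective_run (π := π) hδ hp hb hw
    obtain ⟨c, hc⟩ := exists_runQ h₀ hch hlast
    refine Nat.rfindOpt_dom.2 ⟨@Encodable.encode _ Primcodable.toEncodable c,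
      (precQ δ, c.map fun x => stateToData x.2), ?_⟩
    rw [execStage, @Encodable.encodek _ Primcodable.toEncodable, Option.bind_some,
      inputOfData_data, if_pos hc]
    rfl
  obtain ⟨a, ha⟩ := Part.dom_iff_mem.1 hdom
  obtain ⟨k, hk⟩ := Nat.rfindOpt_spec ha
  rw [execStage, inputOfData_data, Option.mem_def, Option.bind_eq_some_iff] at hk
  obtain ⟨c, -, hc⟩ := hk
  split_ifs at hc with hrun
  obtain ⟨r, hr, h₀, hch, hlast⟩ := hrun.exists_run
  refine ⟨precQ δ, r, hp, ?_, h₀, hch.imp fun _ _ h => h.step, hlast⟩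
  have hmap : (c.map fun x => stateToData x.2) = r.map State.data := by
    have : (c.map fun x => stateToData x.2) = (c.map Prod.snd).map stateToData := by
      rw [List.map_map]; rfl
    rw [this, hr, List.map_map]
    exact List.map_congr_left fun s _ => stateToData_q s
  rw [hmap] at hc
  rw [← Option.some.inj hc] at ha
  exact ha

end DeltaKsmt

theorem mainTheorem1 :
    -- every run on a bounded instance is finite, and every state in which a run can end is a
    -- final state with a correct answer
    (∀ (n : ℕ) (F : Formula n) (π : Equiv.Perm (Fin n)) (δ : ℚ) (p : ℕ),
      0 < δ → Precise δ p → F.BoundedInstance → F.WellPresented →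
        (¬ ∃ S : ℕ → State n, S 0 = F.init ∧ ∀ i, Step F π δ p (S i) (S (i + 1))) ∧
        ∀ S : State n, Relation.ReflTransGen (Step F π δ p) F.init S →
          (∀ S', ¬ Step F π δ p S S') → F.CorrectAnswer δ S) ∧
    -- the procedure is effective: one algorithm computes, for every bounded instance, a precision
    -- and a complete run that ends with the answer UNSAT or δ-SAT
    (∃ exec : InputData →. ℕ × List StateData, Partrec exec ∧
      ∀ (n : ℕ) (F : Formula n) (π : Equiv.Perm (Fin n)) (δ : ℚ),
        0 < δ → F.BoundedInstance → F.WellPresented →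
          ∃ (p : ℕ) (r : List (State n)), Precise δ p ∧
            (p, r.map State.data) ∈ exec (F.data π δ) ∧
            r.head? = some F.init ∧ r.IsChain (Step F π δ p) ∧
            (r.getLast? = some State.unsat ∨ r.getLast? = some State.deltaSat)) := by
  exact ⟨fun n F π δ p hδ hp hb hw => ⟨not_exists_infinite_run hδ hp hb hw,
    fun S hS h => correctAnswer_of_terminal hδ hp hb hw hS h⟩, exists_algorithm⟩
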